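/- Let $\Gamma=\Gamma[2,3,7]=\langle A,B,C\mid A^2=B^3=C^7=ABC=1\rangle$ be the triangle group acting on the hyperbolic plane $\mathbb H$ as the conformal automorphism group of the universal map of type $\{3,7\}$ (the tessellation by regular triangles, seven at each vertex); $A$, $B$, $C$ are rotations about an edge-centre, a face-centre and a vertex. A \emph{Hurwitz map} is a regular map of type $\{3,7\}$ on a compact Riemann surface $X$, that is, the image of the universal map on $X\cong\mathbb H/M$, where $M$ is a normal subgroup of $\Gamma$ acting freely on $\mathbb H$. Its \emph{geometric points} are its vertices (labelled $0$), edge-centres (labelled $1$) and face-centres (labelled $2$). A \emph{mirror} is a connected component of the fixed point set of an anticonformal involution of $X$; it is a simple closed curve. The labels of the geometric points met in succession when the mirror is traversed once form its \emph{pattern}; if this word is $\ell^N$ with a word $\ell$ that is not a proper power, then $N$ is the \emph{link index} of the mirror. \emph{Macbeath's surface} is the surface $\mathbb H/K$ with $K$ normal in $\Gamma$ and $\Gamma/K\cong PSL(2,8)$ (order $504$); \emph{Klein's surface} is $\mathbb H/K$ with $K$ normal in $\Gamma$ and $\Gamma/K\cong PSL(2,7)$ (order $168$). Theorem. All mirrors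 of a Hurwitz map have one and the same link index, called the link index of the map (a Hurwitz map without mirrors has no link index). Moreover: (i) No Hurwitz map has link index $1$. (ii) A Hurwitz map has link index $2$ if and only if the underlying Riemann surface is Macbeath's surface, which has genus $7$. (iii) A Hurwitz map has link index $3$ if and only if the underlying Riemann surface is Klein's surface, which has genus $3$. -/

import Mathlib

open scoped Manifold ContDiff UpperHalfPlane

noncomputable section

namespace HurwitzMirror

/-! ### The extended triangle group `Γ(2,3,7)` acting on the hyperbolic plane

Mathlib lets `GL(2, ℝ)` act on `ℍ`; a matrix `!![a, b; c, d]` of negative determinant acts by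
`z ↦ (a * conj z + b) / (c * conj z + d)`, an orientation reversing isometry. A matrix of
determinant `-1` and trace `0` acts as the reflection in a geodesic, and the geodesics of two such
matrices `X`, `Y` meet at the angle `θ` with `|tr (X * Y)| = 2 * |cos θ|`, if `|tr (X * Y)| < 2`. -/

/-- `cos (π / 7)`. -/
def cosA : ℝ := Real.cos (Real.pi / 7)

/-- `√(2 cos (2π / 7) - 1)`. -/
def sqD : ℝ := Real.sqrt (2 * Real.cos (2 * Real.pi / 7) - 1)

/-- `z ↦ -conj z`, the reflection in the imaginary axis. -/
def matP : Matrix (Fin 2) (Fin 2) ℝ := !![1, 0; 0, -1]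

/-- `z ↦ 1 / conj z`, the reflection in the unit circle. -/
def matQ : Matrix (Fin 2) (Fin 2) ℝ := !![0, 1; 1, 0]

/-- The reflection in the geodesic that meets the imaginary axis at the angle `π / 7` and the
unit circle at the angle `π / 3`. -/
def matR : Matrix (Fin 2) (Fin 2) ℝ := !![cosA, (1 - sqD) / 2; (1 + sqD) / 2, -cosA]

theorem det_matP : matP.det = -1 := by simp [matP]

theorem det_matQ : matQ.det = -1 := by simp [matQ]

theorem sqD_sq : sqD ^ 2 = 2 * Real.cos (2 * Real.pi / 7) - 1 := by
  have h : Real.cos (Real.pi / 3) ≤ Real.cos (2 * Real.pi / 7) := by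
    apply Real.cos_le_cos_of_nonneg_of_le_pi <;> linarith [Real.pi_pos]
  rw [Real.cos_pi_div_three] at h
  exact Real.sq_sqrt (by linarith)

theorem sqD_sq' : sqD ^ 2 = 4 * cosA ^ 2 - 3 := by
  have h := Real.cos_two_mul (Real.pi / 7)
  rw [sqD_sq, cosA, show 2 * Real.pi / 7 = 2 * (Real.pi / 7) by ring, h]
  ring

theorem det_matR : matR.det = -1 := by
  have h := sqD_sq'
  simp only [matR, Matrix.det_fin_two_of]
  linarith

theorem trace_matP_mul_matQ : (matP * matQ).trace = 0 := by
  simp [matP, matQ, Matrix.trace_fin_two]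

theorem trace_matQ_mul_matR : (matQ * matR).trace = 2 * Real.cos (Real.pi / 3) := by
  simp [matQ, matR, Matrix.trace_fin_two]
  ring

theorem trace_matR_mul_matP : (matR * matP).trace = 2 * Real.cos (Real.pi / 7) := by
  simp [matR, matP, Matrix.trace_fin_two, cosA]
  ring

/-- An invertible real matrix as a bijection of the hyperbolic plane. -/
def act (g : Matrix (Fin 2) (Fin 2) ℝ) (h : g.det = -1) : Equiv.Perm ℍ :=
  MulAction.toPerm (Matrix.GeneralLinearGroup.mkOfDetNeZero g (by rw [h]; norm_num))

/-- The reflection in the side of the `(2,3,7)`-triangle joining the vertex to the edge-centre. -/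
def P : Equiv.Perm ℍ := act matP det_matP

/-- The reflection in the side joining the edge-centre to the face-centre. -/
def Q : Equiv.Perm ℍ := act matQ det_matQ

/-- The reflection in the side joining the face-centre to the vertex. -/
def R : Equiv.Perm ℍ := act matR det_matR

/-- The triangle group `Γ[2,3,7]` of orientation preserving isometries, generated by the rotations
`A = PQ`, `B = QR`, `C = RP` of orders `2`, `3`, `7`. It is the group of conformal automorphisms of
the universal map of type `{3,7}`. -/
def TriangleGroup : Subgroup (Equiv.Perm ℍ) :=
  Subgroup.closure {P * Q, Q * R, R * P}

/-- The corners of the `(2,3,7)`-triangle, each given (as a one-point set) by the two sides through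
it: `0` is the vertex, `1` the edge-centre and `2` the face-centre. -/
def corner : Fin 3 → Set ℍ :=
  ![{z | R z = z ∧ P z = z}, {z | P z = z ∧ Q z = z}, {z | Q z = z ∧ R z = z}]

/-- The vertices (`0`), edge-centres (`1`) and face-centres (`2`) of the universal map of type
`{3,7}`. -/
def universalGeometricPoint (i : Fin 3) : Set ℍ :=
  {z | ∃ g ∈ TriangleGroup, g z ∈ corner i}

/-! ### Hurwitz maps -/

section Surface

variable (X : Type*) [TopologicalSpace X] [ChartedSpace ℂ X]

/-- A regular map of type `{3,7}` on the Riemann surface `X`: a normal subgroup `M` of `Γ[2,3,7]`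
together with a holomorphic projection `ℍ → X` that identifies `X` with the Riemann surface `ℍ / M`;
the map on `X` is the image of the universal map. As the projection is locally injective, `M` acts
without fixed points, so that the type of the map is exactly `{3,7}`. -/
structure HurwitzMap where
  mapSubgroup : Subgroup TriangleGroup
  normal : mapSubgroup.Normal
  proj : ℍ → X
  surjective : Function.Surjective proj
  isLocalDiffeomorph : IsLocalDiffeomorph 𝓘(ℂ) 𝓘(ℂ) ω proj
  proj_eq_iff : ∀ z w : ℍ,
    proj z = proj w ↔ ∃ m ∈ mapSubgroup, ((m : TriangleGroup) : Equiv.Perm ℍ) z = w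

attribute [instance] HurwitzMap.normal

/-- `X` is Klein's surface: the quotient of `ℍ` by a normal subgroup of `Γ[2,3,7]` with quotient
group `PSL(2,7)`, of order `168`. -/
def IsKleinSurface : Prop :=
  ∃ h : HurwitzMap X, Nonempty ((TriangleGroup ⧸ h.mapSubgroup) ≃*
    Matrix.ProjectiveSpecialLinearGroup (Fin 2) (ZMod 7))

/-- `X` is Macbeath's surface: the quotient of `ℍ` by a normal subgroup of `Γ[2,3,7]` with quotient
group `PSL(2,8)`, of order `504`. -/
def IsMacbeathSurface : Prop :=
  ∃ h : HurwitzMap X, Nonempty ((TriangleGroup ⧸ h.mapSubgroup) ≃*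
    Matrix.ProjectiveSpecialLinearGroup (Fin 2) (GaloisField 2 3))

variable {X}

/-- `T` is antiholomorphic: in charts, the complex conjugate of `T` is complex differentiable. -/
def IsAntiholomorphic (T : X → X) : Prop :=
  Continuous T ∧ ∀ x : X, DifferentiableAt ℂ
    (fun z : ℂ => starRingEnd ℂ (chartAt ℂ (T x) (T ((chartAt ℂ x).symm z)))) (chartAt ℂ x x)

/-- A symmetry of a Riemann surface is an anticonformal involution. -/
def IsSymmetry (T : X → X) : Prop :=
  Function.Involutive T ∧ IsAntiholomorphic T

/-- A mirror is one of the curves that make up the fixed point set of a symmetry, i.e. a connected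
component of that set. -/
def IsMirror (L : Set X) : Prop :=
  ∃ T : X → X, IsSymmetry T ∧ ∃ x ∈ Function.fixedPoints T,
    L = connectedComponentIn (Function.fixedPoints T) x

/-- A word is primitive if it is not a proper power (in particular it is not empty). -/
def IsPrimitiveWord (u : List (Fin 3)) : Prop :=
  ∀ (v : List (Fin 3)) (k : ℕ), u = (List.replicate k v).flatten → k = 1

namespace HurwitzMap

variable (h : HurwitzMap X)

/-- The vertices (`0`), edge-centres (`1`) and face-centres (`2`) of the map. -/
def geometricPoint (i : Fin 3) : Set X := h.proj '' universalGeometricPoint i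

/-- The map lies on a surface of genus `g`: `V - E + F = 2 - 2g`. -/
def HasGenus (g : ℕ) : Prop :=
  ((h.geometricPoint 0).ncard : ℤ) - (h.geometricPoint 1).ncard + (h.geometricPoint 2).ncard
    = 2 - 2 * (g : ℤ)

/-- The word `w` is a pattern of the Jordan curve `L`: there is a parametrization `γ` of `L`, of
period `1` and injective on `[0,1)`, such that `w` lists the labels of the geometric points that are
met successively, at the times `t 0 < t 1 < ⋯`, as `γ` runs once along `L`. -/
def IsPattern (L : Set X) (w : List (Fin 3)) : Prop :=
  ∃ γ : ℝ → X, Continuous γ ∧ (∀ s s' : ℝ, γ s = γ s' ↔ ∃ n : ℤ, s = s' + n) ∧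
    Set.range γ = L ∧
    ∃ t : Fin w.length → ℝ, StrictMono t ∧
      Set.range t = {s | s ∈ Set.Ico (0 : ℝ) 1 ∧ ∃ i, γ s ∈ h.geometricPoint i} ∧
      ∀ j, γ (t j) ∈ h.geometricPoint (w.get j)

/-- The curve `L` has link index `N`: it has a pattern `u u ⋯ u` (`N` times), where the link `u` is
not itself a repetition of a shorter word. -/
def MirrorHasLinkIndex (L : Set X) (N : ℕ) : Prop :=
  ∃ u : List (Fin 3), IsPrimitiveWord u ∧ h.IsPattern L (List.replicate N u).flatten

/-- The map has link index `N` if it has a mirror with link index `N`. -/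
def HasLinkIndex (N : ℕ) : Prop :=
  ∃ L : Set X, IsMirror L ∧ h.MirrorHasLinkIndex L N

end HurwitzMap

end Surface

end HurwitzMirror

end

/-!
Write `M` for the subgroup of `Γ = Γ[2,3,7]` that belongs to a Hurwitz map, `P` for the reflection in
the imaginary axis, and `W` for the translation along this axis by the product of the half-turns
about two successive edge-centres on it. The proof reduces the link index to the order of `W` in
`Γ / M`, and then determines the groups `Γ / M` in which `W` has order `1`, `2` or `3`.

*Geometry.* By compactness, `M` acts with displacements bounded away from zero, and so the group
`N` of all isometries of `ℍ` that normalize `M` is discrete. A discrete group that contains `Γ`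
preserves the tessellation: the orbit of the vertex is separated by the length of the edges, the
barycentric coordinates of a point of the `(2,3,7)`-triangle order its distances from the nearest
vertices, and the triangle is a strict fundamental domain (`IsDiscreteOver.le_extGroup`,
`IsDiscreteOver.eq_of_extGroup`). Hence `N` is contained in the extended triangle group, in which
every reflection is conjugate to `P`, and the stabilizers in `Γ` of the corners of the triangle are
generated by the rotations `C`, `A`, `B`.

*Lifting.* The projection `ℍ → X` is a covering map. A conformal or anticonformal homeomorphism
lifts to `ℍ`, and the Schwarz-Pick lemma makes the lift an isometry, which normalizes `M`. For the
identity and two Hurwitz maps on `X` this shows that `Γ / M` depends only on `X`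
(`nonempty_quotient_mulEquiv`). For a symmetry with a fixed point it shows that the symmetry lifts to
a conjugate of `P`, and its mirror is the image of a translate of the axis.

*Patterns.* The geometric points on the axis have the labels `0 1 0 2 1 2` repeated, and `W` is the
translation by one period of this word. If `K` is the order of `W` in `Γ / M`, then the image of the
axis is a closed curve that is covered by `K` periods. Any parametrization of the mirror lifts to a
monotone parametrization of the axis, so that every pattern is a cyclic shift of the `K`-th power
of a primitive word of length `6`. So all mirrors have the link index `K`, and
there is a mirror if and only if `P` normalizes `M` (`hasLinkIndex_iff`).

*Groups.* Let `G` be generated by `x`, `y` with `x ^ 2 = y ^ 3 = (y⁻¹ * x) ^ 7 = 1`. The kernel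
evaluates a coset enumeration (`CosetEnumeration.card_quotient_le`) which shows that `W = 1` forces
`G` to be trivial, that `W ^ 2 = 1` forces `|G| ≤ 504`, and that `W ^ 3 = 1` forces `|G| ≤ 168`. The
groups `PSL(2, 8)` and `PSL(2, 7)`, of these orders, have such generators. Applied to a subdirect
product, the bound shows that they are the only nontrivial ones (`nonempty_mulEquiv_of_card_le`).
Conversely, the trace of `W` in `SL(2, F)` is a polynomial in the trace of `y⁻¹ * x`
(`slTrace_mirrorWord`), and the relation of order `7` forces it to be `0` in characteristic `2` and
`1` in characteristic `7`, for any pair of generators. In these cases `Γ / M` is as large as the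
bound permits, and since `P` commutes with `W` this makes `M` invariant under `P`
(`P_mem_isoNormalizer`), so that mirrors exist. The genus is found by counting the cosets of the
stabilizers of the three kinds of geometric points.
-/

noncomputable section

namespace HurwitzMirror

open UpperHalfPlane

section

/-! ### The hyperboloid model -/

/-- The coordinate `|z|² / im z` of `z` in the hyperboloid model: `z` is encoded by the positive
definite symmetric matrix `!![cp z, cq z; cq z, cr z]` of determinant `1`. -/
def cp (z : ℍ) : ℝ := (z.re ^ 2 + z.im ^ 2) / z.im

/-- The off-diagonal coordinate `re z / im z` in the hyperboloid model. -/
def cq (z : ℍ) : ℝ := z.re / z.im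

/-- The coordinate `1 / im z` in the hyperboloid model. -/
def cr (z : ℍ) : ℝ := 1 / z.im

/-- The hyperbolic cosine of the distance, as the Minkowski form of the hyperboloid model. -/
def form (z w : ℍ) : ℝ := (cp z * cr w + cr z * cp w) / 2 - cq z * cq w

theorem cp_mul_cr (z : ℍ) : cp z * cr z - cq z ^ 2 = 1 := by
  have := z.im_pos.ne'
  simp only [cp, cq, cr]
  field_simp
  ring

theorem cr_pos (z : ℍ) : 0 < cr z := one_div_pos.2 z.im_pos

theorem coords_ext {z w : ℍ} (hq : cq z = cq w) (hr : cr z = cr w) : z = w := by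
  have h1 := z.im_pos.ne'
  have h2 := w.im_pos.ne'
  have hi : z.im = w.im := by
    have := hr
    simp only [cr] at this
    field_simp at this
    exact this.symm
  have hre : z.re = w.re := by
    have := hq
    simp only [cq, hi] at this
    field_simp at this
    exact this
  exact UpperHalfPlane.ext (Complex.ext hre hi)

theorem exists_coords {p q r : ℝ} (hr : 0 < r) (h : p * r - q ^ 2 = 1) :
    ∃ z : ℍ, cp z = p ∧ cq z = q ∧ cr z = r := by
  refine ⟨⟨⟨q / r, 1 / r⟩, by simpa using hr⟩, ?_, ?_, ?_⟩
  · simp only [cp, UpperHalfPlane.re, UpperHalfPlane.im]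
    field_simp
    linarith
  · simp only [cq, UpperHalfPlane.re, UpperHalfPlane.im]
    field_simp
  · simp only [cr, UpperHalfPlane.im]
    field_simp

theorem form_comm (z w : ℍ) : form z w = form w z := by
  unfold form; ring

theorem form_self (z : ℍ) : form z z = 1 := by
  have := cp_mul_cr z
  unfold form; linarith

theorem cosh_dist_eq_form (z w : ℍ) : Real.cosh (dist z w) = form z w := by
  have h1 := z.im_pos.ne'
  have h2 := w.im_pos.ne'
  rw [UpperHalfPlane.cosh_dist, Complex.dist_eq, ← Complex.normSq_eq_norm_sq, Complex.normSq_apply]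
  simp only [form, cp, cq, cr, Complex.sub_re, Complex.sub_im, coe_re, coe_im]
  field_simp
  ring

theorem form_le_form_iff {z w z' w' : ℍ} : form z w ≤ form z' w' ↔ dist z w ≤ dist z' w' := by
  rw [← cosh_dist_eq_form, ← cosh_dist_eq_form, Real.cosh_le_cosh, abs_of_nonneg dist_nonneg,
    abs_of_nonneg dist_nonneg]

theorem form_eq_form_iff {z w z' w' : ℍ} : form z w = form z' w' ↔ dist z w = dist z' w' := by
  rw [le_antisymm_iff, le_antisymm_iff, form_le_form_iff, form_le_form_iff]

theorem one_lt_form {z w : ℍ} (h : z ≠ w) : 1 < form z w := by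
  rw [← cosh_dist_eq_form, Real.one_lt_cosh]
  exact (dist_pos.2 h).ne'

theorem isometry_iff_form {t : ℍ → ℍ} : Isometry t ↔ ∀ z w, form (t z) (t w) = form z w := by
  rw [isometry_iff_dist_eq]
  exact forall₂_congr fun z w => form_eq_form_iff.symm

/-! The Minkowski form is nondegenerate on the points of the plane. -/

theorem coords_eq_zero {p q r : ℝ} (h : ∀ w : ℍ, (p * cr w + r * cp w) / 2 - q * cq w = 0) :
    p = 0 ∧ q = 0 ∧ r = 0 := by
  obtain ⟨w1, h1, h2, h3⟩ := exists_coords (p := 1) (q := 0) (r := 1) one_pos (by norm_num)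
  obtain ⟨w2, h4, h5, h6⟩ := exists_coords (p := 2) (q := 0) (r := 1 / 2) (by norm_num)
    (by norm_num)
  obtain ⟨w3, h7, h8, h9⟩ := exists_coords (p := 2) (q := 1) (r := 1) (by norm_num) (by norm_num)
  have e1 := h w1
  have e2 := h w2
  have e3 := h w3
  rw [h1, h2, h3] at e1
  rw [h4, h5, h6] at e2
  rw [h7, h8, h9] at e3
  refine ⟨?_, ?_, ?_⟩ <;> linarith

/-- Isometries of the hyperbolic plane are linear in the hyperboloid model. -/
theorem Isometry.map_combination {t : ℍ → ℍ} (ht : Isometry t) (hs : Function.Surjective t)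
    {z z₁ z₂ : ℍ} {α β : ℝ} (hp : cp z = α * cp z₁ + β * cp z₂)
    (hq : cq z = α * cq z₁ + β * cq z₂) (hr : cr z = α * cr z₁ + β * cr z₂) :
    cp (t z) = α * cp (t z₁) + β * cp (t z₂) ∧ cq (t z) = α * cq (t z₁) + β * cq (t z₂) ∧
      cr (t z) = α * cr (t z₁) + β * cr (t z₂) := by
  have key := coords_eq_zero (p := cp (t z) - (α * cp (t z₁) + β * cp (t z₂)))
    (q := cq (t z) - (α * cq (t z₁) + β * cq (t z₂)))
    (r := cr (t z) - (α * cr (t z₁) + β * cr (t z₂))) (by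
      intro w'
      obtain ⟨w, rfl⟩ := hs w'
      have h := isometry_iff_form.1 ht
      have e := h z w
      have e1 := h z₁ w
      have e2 := h z₂ w
      have e0 : form z w = α * form z₁ w + β * form z₂ w := by
        simp only [form, hp, hq, hr]; ring
      rw [← e, ← e1, ← e2] at e0
      simp only [form] at e0
      linarith)
  exact ⟨by linarith [key.1], by linarith [key.2.1], by linarith [key.2.2]⟩

/-! ### The reflections `P`, `Q`, `R` in coordinates -/

theorem act_apply (g : Matrix (Fin 2) (Fin 2) ℝ) (h : g.det = -1) (z : ℍ) :
    act g h z = Matrix.GeneralLinearGroup.mkOfDetNeZero g (by rw [h]; norm_num) • z := rfl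

theorem coords_act (a b c d : ℝ) (h : (!![a, b; c, d] : Matrix (Fin 2) (Fin 2) ℝ).det = -1)
    (z : ℍ) :
    cp (act _ h z) = a ^ 2 * cp z + 2 * a * b * cq z + b ^ 2 * cr z ∧
    cq (act _ h z) = a * c * cp z + (a * d + b * c) * cq z + b * d * cr z ∧
    cr (act _ h z) = c ^ 2 * cp z + 2 * c * d * cq z + d ^ 2 * cr z := by
  have hdet : a * d - b * c = -1 := by simpa [Matrix.det_fin_two_of] using h
  set g := Matrix.GeneralLinearGroup.mkOfDetNeZero !![a, b; c, d] (by rw [h]; norm_num) with hg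
  have hgd : g.det.val = -1 := h
  have hn : Complex.normSq (denom g z) = (c * z.re + d) ^ 2 + (c * z.im) ^ 2 := by
    rw [Complex.normSq_apply]
    simp [denom, hg, Matrix.GeneralLinearGroup.mkOfDetNeZero]
    ring
  have hpos : 0 < (c * z.re + d) ^ 2 + (c * z.im) ^ 2 := by
    rw [← hn]; exact normSq_denom_pos g z.im_ne_zero
  have him : (act _ h z).im = z.im / ((c * z.re + d) ^ 2 + (c * z.im) ^ 2) := by
    rw [act_apply, im_smul_eq_div_normSq, hn, hgd]; simp
  have hre : (act _ h z).re = ((a * z.re + b) * (c * z.re + d) + a * c * z.im ^ 2) /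
      ((c * z.re + d) ^ 2 + (c * z.im) ^ 2) := by
    rw [act_apply, re_smul, Complex.div_re, hn]
    simp [num, denom, Matrix.GeneralLinearGroup.mkOfDetNeZero]
    field_simp
  have hz := z.im_pos.ne'
  generalize hD : (c * z.re + d) ^ 2 + (c * z.im) ^ 2 = D at *
  have hp' := hpos.ne'
  refine ⟨?_, ?_, ?_⟩
  · simp only [cp, cq, cr, him, hre]
    field_simp
    rw [← hD]
    linear_combination (-z.im ^ 2) * (a * d - b * c - 1) * hdet
  · simp only [cp, cq, cr, him, hre]
    field_simp
    ring
  · simp only [cp, cq, cr, him]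
    field_simp
    rw [← hD]
    ring

theorem coords_P (z : ℍ) : cp (P z) = cp z ∧ cq (P z) = -cq z ∧ cr (P z) = cr z := by
  obtain ⟨h1, h2, h3⟩ := coords_act 1 0 0 (-1) det_matP z
  refine ⟨h1.trans (by ring), h2.trans (by ring), h3.trans (by ring)⟩

theorem coords_Q (z : ℍ) : cp (Q z) = cr z ∧ cq (Q z) = cq z ∧ cr (Q z) = cp z := by
  obtain ⟨h1, h2, h3⟩ := coords_act 0 1 1 0 det_matQ z
  refine ⟨h1.trans (by ring), h2.trans (by ring), h3.trans (by ring)⟩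

/-- `sin (π / 7)`. -/
def sinA : ℝ := Real.sin (Real.pi / 7)

theorem cosA_sq : cosA ^ 2 = 1 - sinA ^ 2 := by
  have := Real.sin_sq_add_cos_sq (Real.pi / 7)
  unfold cosA sinA; linarith

theorem sqD_sq_eq : sqD ^ 2 = 1 - 4 * sinA ^ 2 := by
  rw [sqD_sq', cosA_sq]; ring

theorem cosA_pos : 0 < cosA := by
  apply Real.cos_pos_of_mem_Ioo
  constructor <;> linarith [Real.pi_pos]

theorem sinA_pos : 0 < sinA := by
  apply Real.sin_pos_of_pos_of_lt_pi <;> linarith [Real.pi_pos]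

theorem sinA_lt : sinA < 1 / 2 := by
  rw [← Real.sin_pi_div_six]
  apply Real.sin_lt_sin_of_lt_of_le_pi_div_two <;> linarith [Real.pi_pos]

theorem cosA_lt_one : cosA < 1 := by
  nlinarith [cosA_sq, sinA_pos, cosA_pos]

theorem sqD_pos : 0 < sqD := by
  have h : 0 < sqD ^ 2 := by nlinarith [sqD_sq_eq, sinA_pos, sinA_lt]
  have h2 : 0 ≤ sqD := Real.sqrt_nonneg _
  exact lt_of_le_of_ne h2 (by rintro h3; rw [← h3] at h; norm_num at h)

theorem sqD_lt_one : sqD < 1 := by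
  nlinarith [sqD_sq_eq, sinA_pos, sqD_pos]

/-- The linear functional that vanishes on the mirror of `R`, up to the factor `im z`. -/
def cf (z : ℍ) : ℝ := (1 + sqD) / 2 * cp z - 2 * cosA * cq z - (1 - sqD) / 2 * cr z

theorem coords_R (z : ℍ) : cp (R z) = cp z - (1 - sqD) / 2 * cf z ∧
    cq (R z) = cq z + cosA * cf z ∧ cr (R z) = cr z + (1 + sqD) / 2 * cf z := by
  obtain ⟨h1, h2, h3⟩ := coords_act cosA ((1 - sqD) / 2) ((1 + sqD) / 2) (-cosA) det_matR z
  have e1 := cosA_sq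
  have e2 := sqD_sq_eq
  have e : cosA ^ 2 = 1 - (1 - sqD) / 2 * ((1 + sqD) / 2) := by
    rw [e1]; linear_combination (-1/4) * e2
  refine ⟨h1.trans ?_, h2.trans ?_, h3.trans ?_⟩
  · unfold cf
    linear_combination cp z * e
  · unfold cf
    linear_combination cq z * e
  · unfold cf
    linear_combination cr z * e

theorem cf_R (z : ℍ) : cf (R z) = -cf z := by
  obtain ⟨h1, h2, h3⟩ := coords_R z
  have e1 := cosA_sq
  have e2 := sqD_sq_eq
  have : cf (R z) = (1 + sqD) / 2 * cp (R z) - 2 * cosA * cq (R z) - (1 - sqD) / 2 * cr (R z) := rfl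
  rw [this, h1, h2, h3]
  have h : (1 + sqD) / 2 * cp z - 2 * cosA * cq z - (1 - sqD) / 2 * cr z = cf z := rfl
  linear_combination h + (-2 * cf z) * e1 + cf z / 2 * e2

theorem isometry_P : Isometry P := isometry_iff_form.2 fun z w => by
  obtain ⟨h1, h2, h3⟩ := coords_P z
  obtain ⟨h4, h5, h6⟩ := coords_P w
  simp only [form, h1, h2, h3, h4, h5, h6]; ring

theorem isometry_Q : Isometry Q := isometry_iff_form.2 fun z w => by
  obtain ⟨h1, h2, h3⟩ := coords_Q z
  obtain ⟨h4, h5, h6⟩ := coords_Q w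
  simp only [form, h1, h2, h3, h4, h5, h6]; ring

theorem isometry_R : Isometry R := isometry_iff_form.2 fun z w => by
  obtain ⟨h1, h2, h3⟩ := coords_R z
  obtain ⟨h4, h5, h6⟩ := coords_R w
  have e1 := cosA_sq
  have e2 := sqD_sq_eq
  have hz : (1 + sqD) / 2 * cp z - 2 * cosA * cq z - (1 - sqD) / 2 * cr z = cf z := rfl
  have hw : (1 + sqD) / 2 * cp w - 2 * cosA * cq w - (1 - sqD) / 2 * cr w = cf w := rfl
  simp only [form, h1, h2, h3, h4, h5, h6]
  linear_combination (cf w / 2) * hz + cf z / 2 * hw - cf z * cf w * e1 + cf z * cf w / 4 * e2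

theorem form_P (z w : ℍ) : form (P z) w = form z w + 2 * cq z * cq w := by
  obtain ⟨h1, h2, h3⟩ := coords_P z
  simp only [form, h1, h2, h3]; ring

theorem form_Q (z w : ℍ) :
    form (Q z) w = form z w + (cr z - cp z) * (cr w - cp w) / 2 := by
  obtain ⟨h1, h2, h3⟩ := coords_Q z
  simp only [form, h1, h2, h3]; ring

theorem form_R (z w : ℍ) : form (R z) w = form z w + cf z * cf w / 2 := by
  obtain ⟨h1, h2, h3⟩ := coords_R z
  have hw : (1 + sqD) / 2 * cp w - 2 * cosA * cq w - (1 - sqD) / 2 * cr w = cf w := rfl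
  simp only [form, h1, h2, h3]
  linear_combination (cf z / 2) * hw

theorem P_apply_eq_iff {z : ℍ} : P z = z ↔ cq z = 0 := by
  obtain ⟨h1, h2, h3⟩ := coords_P z
  constructor
  · intro h; rw [h] at h2; linarith
  · intro h; exact coords_ext (by rw [h2, h]; simp) h3

theorem Q_apply_eq_iff {z : ℍ} : Q z = z ↔ cp z = cr z := by
  obtain ⟨h1, h2, h3⟩ := coords_Q z
  constructor
  · intro h; rw [h] at h1; exact h1
  · intro h; exact coords_ext h2 (by rw [h3, h])

theorem R_apply_eq_iff {z : ℍ} : R z = z ↔ cf z = 0 := by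
  obtain ⟨h1, h2, h3⟩ := coords_R z
  constructor
  · intro h; rw [h] at h2; have := cosA_pos; nlinarith
  · intro h; exact coords_ext (by rw [h2, h]; simp) (by rw [h3, h]; simp)

theorem P_mul_P : P * P = 1 := by
  ext1 z
  obtain ⟨h1, h2, h3⟩ := coords_P z
  obtain ⟨h4, h5, h6⟩ := coords_P (P z)
  exact coords_ext (by rw [Equiv.Perm.mul_apply, h5, h2]; simp)
    (by rw [Equiv.Perm.mul_apply, h6, h3]; simp)

theorem Q_mul_Q : Q * Q = 1 := by
  ext1 z
  obtain ⟨h1, h2, h3⟩ := coords_Q z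
  obtain ⟨h4, h5, h6⟩ := coords_Q (Q z)
  exact coords_ext (by rw [Equiv.Perm.mul_apply, h5, h2]; simp)
    (by rw [Equiv.Perm.mul_apply, h6, h1]; simp)

theorem R_mul_R : R * R = 1 := by
  ext1 z
  obtain ⟨h1, h2, h3⟩ := coords_R z
  obtain ⟨h4, h5, h6⟩ := coords_R (R z)
  have h := cf_R z
  exact coords_ext (by rw [Equiv.Perm.mul_apply, h5, h2, h]; simp)
    (by rw [Equiv.Perm.mul_apply, h6, h3, h]; simp)

end

section

/-! ### Relations in the triangle group -/

/-- The rotation `A = PQ` about the edge-centre. -/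
def rotA : Equiv.Perm ℍ := P * Q

/-- The rotation `B = QR` about the face-centre. -/
def rotB : Equiv.Perm ℍ := Q * R

/-- The rotation `C = RP` about the vertex. -/
def rotC : Equiv.Perm ℍ := R * P

/-- The real number `2 cos (π / 7)` is a root of `t³ - t² - 2t + 1`. -/
theorem cosA_cubic : 8 * cosA ^ 3 - 4 * cosA ^ 2 - 4 * cosA + 1 = 0 := by
  have h : Real.cos (3 * (Real.pi / 7)) = -Real.cos (2 * (2 * (Real.pi / 7))) := by
    rw [← Real.cos_pi_sub]; congr 1; ring
  rw [Real.cos_three_mul, Real.cos_two_mul, Real.cos_two_mul] at h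
  have h1 : Real.cos (Real.pi / 7) = cosA := rfl
  rw [h1] at h
  have h2 : (cosA + 1) * (8 * cosA ^ 3 - 4 * cosA ^ 2 - 4 * cosA + 1) = 0 := by
    linear_combination h
  rcases mul_eq_zero.1 h2 with h3 | h3
  · linarith [cosA_pos]
  · exact h3

theorem act_mul_act_pow {g g' : Matrix (Fin 2) (Fin 2) ℝ} (h : g.det = -1) (h' : g'.det = -1)
    (n : ℕ) (hn : (g * g') ^ n = -1) : (act g h * act g' h') ^ n = 1 := by
  set G := Matrix.GeneralLinearGroup.mkOfDetNeZero g (by rw [h]; norm_num) with hG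
  set G' := Matrix.GeneralLinearGroup.mkOfDetNeZero g' (by rw [h']; norm_num) with hG'
  have h1 : act g h = MulAction.toPermHom (GL (Fin 2) ℝ) ℍ G := rfl
  have h2 : act g' h' = MulAction.toPermHom (GL (Fin 2) ℝ) ℍ G' := rfl
  have h3 : (G * G') ^ n = -1 := Units.ext (by
    rw [Units.val_pow_eq_pow_val, Units.val_mul]; exact hn)
  rw [h1, h2, ← map_mul, ← map_pow, h3]
  ext1 z
  rw [MulAction.toPermHom_apply, MulAction.toPerm_apply, UpperHalfPlane.neg_smul, one_smul]
  rfl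

theorem sq_eq_of_det_eq_one {F : Type*} [CommRing F] (m : Matrix (Fin 2) (Fin 2) F)
    (hd : m.det = 1) : m * m = m.trace • m - 1 := by
  rw [Matrix.det_fin_two] at hd
  ext i j
  fin_cases i <;> fin_cases j <;>
    simp [Matrix.mul_apply, Fin.sum_univ_two, Matrix.trace_fin_two] <;>
    first | ring1 | linear_combination (-1 : F) * hd

theorem rotA_sq : rotA * rotA = 1 := by
  have := act_mul_act_pow det_matP det_matQ 2 (by
    rw [sq, sq_eq_of_det_eq_one _ (by simp [det_matP, det_matQ]), trace_matP_mul_matQ]; simp)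
  rw [sq] at this; exact this

theorem rotB_cube : rotB ^ 3 = 1 := act_mul_act_pow det_matQ det_matR 3 (by
  have h := sq_eq_of_det_eq_one (matQ * matR) (by simp [det_matQ, det_matR])
  rw [trace_matQ_mul_matR, Real.cos_pi_div_three] at h
  generalize matQ * matR = m at h
  norm_num at h
  rw [pow_succ, sq, h, sub_mul, h]; simp)

theorem rotC_pow_seven : rotC ^ 7 = 1 := act_mul_act_pow det_matR det_matP 7 (by
  have h := sq_eq_of_det_eq_one (matR * matP) (by simp [det_matP, det_matR])
  rw [trace_matR_mul_matP] at h
  have hc : 8 * (Real.cos (Real.pi / 7)) ^ 3 - 4 * (Real.cos (Real.pi / 7)) ^ 2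
    - 4 * (Real.cos (Real.pi / 7)) + 1 = 0 := cosA_cubic
  generalize Real.cos (Real.pi / 7) = c at h hc
  generalize matR * matP = m at h
  have h3 : m ^ 3 = (4 * c ^ 2 - 1) • m - (2 * c) • (1 : Matrix (Fin 2) (Fin 2) ℝ) := by
    rw [pow_succ, sq, h, sub_mul, smul_mul_assoc, h, one_mul, smul_sub, smul_smul]
    module
  have h6 : m ^ 6 = (32 * c ^ 5 - 32 * c ^ 3 + 6 * c) • m
      - (16 * c ^ 4 - 12 * c ^ 2 + 1) • (1 : Matrix (Fin 2) (Fin 2) ℝ) := by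
    rw [show 6 = 3 + 3 from rfl, pow_add, h3]
    simp only [sub_mul, mul_sub, smul_mul_assoc, mul_smul_comm, h, one_mul, mul_one]
    module
  rw [pow_succ, h6, sub_mul, smul_mul_assoc, smul_mul_assoc, h, one_mul]
  have e1 : (32 * c ^ 5 - 32 * c ^ 3 + 6 * c) * (2 * c) - (16 * c ^ 4 - 12 * c ^ 2 + 1) = 0 := by
    linear_combination (8 * c ^ 3 + 4 * c ^ 2 - 4 * c - 1) * hc
  have e2 : 32 * c ^ 5 - 32 * c ^ 3 + 6 * c = 1 := by
    linear_combination (4 * c ^ 2 + 2 * c - 1) * hc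
  rw [smul_sub, smul_smul, e2]
  have e3 : (16 * c ^ 4 - 12 * c ^ 2 + 1) = 2 * c := by rw [e2] at e1; linarith
  rw [e3]
  module)

theorem perm_apply_inv (g : Equiv.Perm ℍ) (z : ℍ) : g (g⁻¹ z) = z := g.apply_symm_apply z

theorem perm_inv_apply (g : Equiv.Perm ℍ) (z : ℍ) : g⁻¹ (g z) = z := g.symm_apply_apply z

theorem P_mul_P_mul (x : Equiv.Perm ℍ) : P * (P * x) = x := by rw [← mul_assoc, P_mul_P, one_mul]
theorem Q_mul_Q_mul (x : Equiv.Perm ℍ) : Q * (Q * x) = x := by rw [← mul_assoc, Q_mul_Q, one_mul]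
theorem R_mul_R_mul (x : Equiv.Perm ℍ) : R * (R * x) = x := by rw [← mul_assoc, R_mul_R, one_mul]
theorem P_inv : P⁻¹ = P := inv_eq_of_mul_eq_one_left P_mul_P
theorem Q_inv : Q⁻¹ = Q := inv_eq_of_mul_eq_one_left Q_mul_Q
theorem R_inv : R⁻¹ = R := inv_eq_of_mul_eq_one_left R_mul_R

theorem rotA_inv : rotA⁻¹ = rotA := inv_eq_of_mul_eq_one_left rotA_sq

theorem P_mul_Q_comm : P * Q = Q * P := by
  have h : (P * Q)⁻¹ = P * Q := rotA_inv
  rw [mul_inv_rev, P_inv, Q_inv] at h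
  exact h.symm

theorem rotB_inv : rotB⁻¹ = R * Q := by rw [rotB, mul_inv_rev, Q_inv, R_inv]
theorem rotC_inv : rotC⁻¹ = P * R := by rw [rotC, mul_inv_rev, P_inv, R_inv]

theorem rotA_mul_rotB_mul_rotC : rotA * rotB * rotC = 1 := by
  simp only [rotA, rotB, rotC, mul_assoc, Q_mul_Q_mul, R_mul_R_mul, P_mul_P]

theorem rotA_mem : rotA ∈ TriangleGroup := Subgroup.subset_closure (by simp [rotA])
theorem rotB_mem : rotB ∈ TriangleGroup := Subgroup.subset_closure (by simp [rotB])
theorem rotC_mem : rotC ∈ TriangleGroup := Subgroup.subset_closure (by simp [rotC])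

/-- A reflection conjugates a product of it with another reflection into its inverse. -/
theorem P_conj_rotC : P * rotC * P = rotC⁻¹ := by
  rw [rotC_inv, rotC]; simp only [mul_assoc, P_mul_P, mul_one]

theorem Q_conj_rotB : Q * rotB * Q = rotB⁻¹ := by
  rw [rotB_inv, rotB]; simp only [Q_mul_Q_mul]

theorem conj_pow_of_conj_inv {G : Type*} [Group G] {p c : G} (hp : p * p = 1)
    (h : p * c * p = c⁻¹) (m : ℤ) : c ^ (-m) * p * c ^ m = p * c ^ (2 * m) := by
  have hp' : p⁻¹ = p := inv_eq_of_mul_eq_one_left hp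
  have h1 : p * c ^ m * p⁻¹ = c ^ (-m) := by
    rw [← conj_zpow, hp', h, inv_zpow, zpow_neg]
  rw [← h1, two_mul, zpow_add]
  group

theorem R_eq_conj_Q : R = rotB * Q * rotB⁻¹ := by
  have h := conj_pow_of_conj_inv Q_mul_Q Q_conj_rotB (-1)
  have h3 : rotB ^ (2 * (-1) : ℤ) = rotB := by
    have : rotB ^ (3 : ℤ) = 1 := by exact_mod_cast rotB_cube
    calc rotB ^ (2 * (-1) : ℤ) = rotB ^ (1 : ℤ) * (rotB ^ (3 : ℤ))⁻¹ := by
          rw [← zpow_neg, ← zpow_add]; norm_num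
      _ = rotB := by rw [this]; simp
  rw [h3] at h
  rw [neg_neg, zpow_one, zpow_neg_one] at h
  rw [h, rotB, Q_mul_Q_mul]

theorem P_eq_conj_R : P = rotC ^ 3 * R * (rotC ^ 3)⁻¹ := by
  have hR : R * R = 1 := R_mul_R
  have hc : R * rotC * R = rotC⁻¹ := by
    rw [rotC_inv, rotC]; simp only [R_mul_R_mul]
  have h := conj_pow_of_conj_inv hR hc (-3)
  have h3 : rotC ^ (2 * (-3) : ℤ) = rotC := by
    have : rotC ^ (7 : ℤ) = 1 := by exact_mod_cast rotC_pow_seven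
    calc rotC ^ (2 * (-3) : ℤ) = rotC ^ (1 : ℤ) * (rotC ^ (7 : ℤ))⁻¹ := by
          rw [← zpow_neg, ← zpow_add]; norm_num
      _ = rotC := by rw [this]; simp
  rw [h3] at h
  rw [neg_neg, zpow_neg] at h
  have h4 : rotC ^ (3 : ℤ) = rotC ^ 3 := by norm_cast
  rw [h4] at h
  rw [h, rotC, R_mul_R_mul]

theorem P_eq_conj_Q : P = (rotC ^ 3 * rotB) * Q * (rotC ^ 3 * rotB)⁻¹ := by
  conv_lhs => rw [P_eq_conj_R, R_eq_conj_Q]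
  group

/-! ### The extended triangle group -/

/-- The extended triangle group, generated by the reflections `P`, `Q`, `R`. -/
def ExtGroup : Subgroup (Equiv.Perm ℍ) := Subgroup.closure {P, Q, R}

theorem P_mem : P ∈ ExtGroup := Subgroup.subset_closure (by simp)
theorem Q_mem : Q ∈ ExtGroup := Subgroup.subset_closure (by simp)
theorem R_mem : R ∈ ExtGroup := Subgroup.subset_closure (by simp)

theorem triangleGroup_le : TriangleGroup ≤ ExtGroup := by
  refine (Subgroup.closure_le _).2 ?_
  rintro x (rfl | rfl | rfl)
  · exact mul_mem P_mem Q_mem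
  · exact mul_mem Q_mem R_mem
  · exact mul_mem R_mem P_mem

/-- An element of the group generated by reflections `p`, `q`, `r` lies in the rotation subgroup,
up to multiplication by `p`. -/
theorem mem_or_mul_mem_of_mem_closure {G : Type*} [Group G] {S : Set G} {H : Subgroup G} {p : G}
    (hS : ∀ x ∈ S, x * x = 1 ∧ p * x ∈ H) {g : G}
    (hg : g ∈ Subgroup.closure S) : g ∈ H ∨ p * g ∈ H := by
  have step : ∀ x ∈ S, ∀ y : G, (y ∈ H ∨ p * y ∈ H) → (x * y ∈ H ∨ p * (x * y) ∈ H) := by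
    intro x hx y hy
    obtain ⟨hxx, hpx⟩ := hS x hx
    rcases hy with hy | hy
    · right; rw [← mul_assoc]; exact mul_mem hpx hy
    · left
      have h1 : x * y = (p * x)⁻¹ * (p * y) * (1 : G) := by
        have : x⁻¹ = x := inv_eq_of_mul_eq_one_left hxx
        rw [mul_inv_rev, this]; group
      rw [h1, mul_one]; exact mul_mem (inv_mem hpx) hy
  induction hg using Subgroup.closure_induction_left with
  | one => left; exact one_mem _
  | mul_left x hx y _ ih => exact step x hx y ih
  | inv_mul_cancel x hx y _ ih =>
    have : x⁻¹ = x := inv_eq_of_mul_eq_one_left (hS x hx).1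
    rw [this]; exact step x hx y ih

theorem mem_or_mul_mem {g : Equiv.Perm ℍ} (hg : g ∈ ExtGroup) :
    g ∈ TriangleGroup ∨ P * g ∈ TriangleGroup := by
  refine mem_or_mul_mem_of_mem_closure ?_ hg
  rintro x (rfl | rfl | rfl)
  · exact ⟨P_mul_P, by rw [P_mul_P]; exact one_mem _⟩
  · exact ⟨Q_mul_Q, rotA_mem⟩
  · exact ⟨R_mul_R, by rw [← rotC_inv]; exact inv_mem rotC_mem⟩

theorem conj_mem_triangleGroup {g x : Equiv.Perm ℍ} (hg : g ∈ ExtGroup) (hx : x ∈ TriangleGroup) :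
    g * x * g⁻¹ ∈ TriangleGroup := by
  have hP : ∀ y ∈ TriangleGroup, P * y * P ∈ TriangleGroup := by
    intro y hy
    rcases mem_or_mul_mem (mul_mem (mul_mem P_mem (triangleGroup_le hy)) P_mem) with h | h
    · exact h
    · have h2 : P ∈ TriangleGroup := by
        rw [mul_assoc, P_mul_P_mul] at h
        have := mul_mem (inv_mem hy) h
        rwa [inv_mul_cancel_left] at this
      exact mul_mem (mul_mem h2 hy) h2
  rcases mem_or_mul_mem hg with h | h
  · exact mul_mem (mul_mem h hx) (inv_mem h)
  · have := hP _ (mul_mem (mul_mem h hx) (inv_mem h))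
    rw [mul_inv_rev, P_inv] at this
    simpa only [mul_assoc, P_mul_P_mul, P_mul_P, mul_one] using this

theorem isometry_of_mem_extGroup {g : Equiv.Perm ℍ} (hg : g ∈ ExtGroup) : Isometry g := by
  have step : ∀ x ∈ ({P, Q, R} : Set (Equiv.Perm ℍ)), Isometry x ∧ x⁻¹ = x := by
    rintro x (rfl | rfl | rfl)
    · exact ⟨isometry_P, P_inv⟩
    · exact ⟨isometry_Q, Q_inv⟩
    · exact ⟨isometry_R, R_inv⟩
  induction hg using Subgroup.closure_induction_left with
  | one => exact isometry_id
  | mul_left x hx y _ ih => exact (step x hx).1.comp ih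
  | inv_mul_cancel x hx y _ ih => rw [(step x hx).2]; exact (step x hx).1.comp ih

/-- The elements of the triangle group are Möbius transformations of positive determinant. -/
theorem exists_matrix_of_mem {g : Equiv.Perm ℍ} (hg : g ∈ TriangleGroup) :
    ∃ m : GL (Fin 2) ℝ, 0 < m.det.val ∧ ∀ z : ℍ, g z = m • z := by
  have key : ∀ (m m' : Matrix (Fin 2) (Fin 2) ℝ) (h : m.det = -1) (h' : m'.det = -1),
      ∃ M : GL (Fin 2) ℝ, 0 < M.det.val ∧ ∀ z : ℍ, (act m h * act m' h') z = M • z := by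
    intro m m' h h'
    refine ⟨Matrix.GeneralLinearGroup.mkOfDetNeZero m (by rw [h]; norm_num) *
      Matrix.GeneralLinearGroup.mkOfDetNeZero m' (by rw [h']; norm_num), ?_, fun z => ?_⟩
    · rw [map_mul, Units.val_mul]
      have h1 : (Matrix.GeneralLinearGroup.det (Matrix.GeneralLinearGroup.mkOfDetNeZero m
        (by rw [h]; norm_num))).val = -1 := h
      have h2 : (Matrix.GeneralLinearGroup.det (Matrix.GeneralLinearGroup.mkOfDetNeZero m'
        (by rw [h']; norm_num))).val = -1 := h'
      rw [h1, h2]; norm_num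
    · rw [mul_smul]; rfl
  induction hg using Subgroup.closure_induction with
  | mem x hx =>
    rcases hx with rfl | rfl | rfl
    · exact key _ _ _ _
    · exact key _ _ _ _
    · exact key _ _ _ _
  | one => exact ⟨1, by simp, fun z => by simp⟩
  | mul x y _ _ hx hy =>
    obtain ⟨m, h1, h2⟩ := hx
    obtain ⟨m', h3, h4⟩ := hy
    refine ⟨m * m', ?_, fun z => ?_⟩
    · rw [map_mul, Units.val_mul]; exact mul_pos h1 h3
    · rw [Equiv.Perm.mul_apply, h4, h2, mul_smul]
  | inv x _ hx =>
    obtain ⟨m, h1, h2⟩ := hx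
    refine ⟨m⁻¹, ?_, fun z => ?_⟩
    · rw [map_inv, Units.val_inv_eq_inv_val]; exact inv_pos.2 h1
    · rw [Equiv.Perm.inv_eq_iff_eq, h2, smul_inv_smul]

/-- An element of the triangle group with two fixed points is the identity. -/
theorem eq_one_of_fixed {g : Equiv.Perm ℍ} (hg : g ∈ TriangleGroup) {z w : ℍ} (hzw : z ≠ w)
    (hz : g z = z) (hw : g w = w) : g = 1 := by
  obtain ⟨m, hm, hgm⟩ := exists_matrix_of_mem hg
  have key : ∀ u : ℍ, g u = u ↔ (m 1 1 - m 0 0 = -2 * m 1 0 * u.re ∧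
      m 0 1 = -m 1 0 * (u.re ^ 2 + u.im ^ 2)) := by
    intro u
    rw [hgm, UpperHalfPlane.ext_iff, coe_smul_of_det_pos hm, div_eq_iff (denom_ne_zero m u),
      Complex.ext_iff]
    have := u.im_pos.ne'
    simp only [num, denom, Complex.add_re, Complex.mul_re, Complex.ofReal_re, coe_re,
      Complex.ofReal_im, coe_im, Complex.add_im, Complex.mul_im]
    constructor
    · rintro ⟨h1, h2⟩
      have h3 : m 1 1 - m 0 0 = -2 * m 1 0 * u.re := by
        have : u.im * (m 1 1 - m 0 0 + 2 * m 1 0 * u.re) = 0 := by linear_combination -h2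
        rcases mul_eq_zero.1 this with h | h
        · contradiction
        · linarith
      refine ⟨h3, ?_⟩
      linear_combination h1 + u.re * h3
    · rintro ⟨h1, h2⟩
      constructor
      · linear_combination h2 - u.re * h1
      · linear_combination -u.im * h1
  obtain ⟨h1, h2⟩ := (key z).1 hz
  obtain ⟨h3, h4⟩ := (key w).1 hw
  have hc : m 1 0 = 0 := by
    by_contra hc
    have hre : z.re = w.re := by
      have : m 1 0 * (z.re - w.re) = 0 := by linear_combination (h1 - h3) / 2
      rcases mul_eq_zero.1 this with h | h
      · contradiction
      · linarith
    have him : z.im = w.im := by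
      have : m 1 0 * ((z.im - w.im) * (z.im + w.im)) = 0 := by
        rw [hre] at h2
        linear_combination h2 - h4
      have hp : z.im + w.im ≠ 0 := by linarith [z.im_pos, w.im_pos]
      rcases mul_eq_zero.1 this with h | h
      · contradiction
      · rcases mul_eq_zero.1 h with h | h
        · linarith
        · contradiction
    exact hzw (UpperHalfPlane.ext (Complex.ext hre him))
  ext1 u
  exact (key u).2 ⟨by rw [h1, hc]; ring, by rw [h2, hc]; ring⟩

end

section

/-! ### The triangle and its corners -/

theorem exists_vertex : ∃ z : ℍ, cp z = (1 - sqD) / 2 / sinA ∧ cq z = 0 ∧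
    cr z = (1 + sqD) / 2 / sinA := by
  have h := sinA_pos
  have h1 := sqD_pos
  refine exists_coords (by positivity) ?_
  have := h.ne'
  field_simp
  linear_combination -1 * sqD_sq_eq

/-- The vertex of the `(2,3,7)`-triangle. -/
def vertex : ℍ := exists_vertex.choose

theorem cp_vertex : cp vertex = (1 - sqD) / 2 / sinA := exists_vertex.choose_spec.1
theorem cq_vertex : cq vertex = 0 := exists_vertex.choose_spec.2.1
theorem cr_vertex : cr vertex = (1 + sqD) / 2 / sinA := exists_vertex.choose_spec.2.2

theorem exists_edgeCentre : ∃ z : ℍ, cp z = 1 ∧ cq z = 0 ∧ cr z = 1 :=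
  exists_coords one_pos (by norm_num)

/-- The edge-centre of the `(2,3,7)`-triangle, the point `i`. -/
def edgeCentre : ℍ := exists_edgeCentre.choose

theorem cp_edgeCentre : cp edgeCentre = 1 := exists_edgeCentre.choose_spec.1
theorem cq_edgeCentre : cq edgeCentre = 0 := exists_edgeCentre.choose_spec.2.1
theorem cr_edgeCentre : cr edgeCentre = 1 := exists_edgeCentre.choose_spec.2.2

theorem exists_faceCentre : ∃ z : ℍ, cp z = 2 * cosA / √3 ∧ cq z = sqD / √3 ∧
    cr z = 2 * cosA / √3 := by
  have h := cosA_pos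
  refine exists_coords (by positivity) ?_
  have h3 : √3 ^ 2 = (3 : ℝ) := Real.sq_sqrt (by norm_num)
  have : √3 ≠ 0 := by positivity
  field_simp
  rw [h3]
  linear_combination 4 * cosA_sq - sqD_sq_eq

/-- The face-centre of the `(2,3,7)`-triangle. -/
def faceCentre : ℍ := exists_faceCentre.choose

theorem cp_faceCentre : cp faceCentre = 2 * cosA / √3 := exists_faceCentre.choose_spec.1
theorem cq_faceCentre : cq faceCentre = sqD / √3 := exists_faceCentre.choose_spec.2.1
theorem cr_faceCentre : cr faceCentre = 2 * cosA / √3 := exists_faceCentre.choose_spec.2.2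

theorem P_vertex : P vertex = vertex := P_apply_eq_iff.2 cq_vertex

theorem R_vertex : R vertex = vertex := R_apply_eq_iff.2 (by
  unfold cf; rw [cp_vertex, cq_vertex, cr_vertex]; ring)

theorem P_edgeCentre : P edgeCentre = edgeCentre := P_apply_eq_iff.2 cq_edgeCentre

theorem Q_edgeCentre : Q edgeCentre = edgeCentre :=
  Q_apply_eq_iff.2 (by rw [cp_edgeCentre, cr_edgeCentre])

theorem Q_faceCentre : Q faceCentre = faceCentre :=
  Q_apply_eq_iff.2 (by rw [cp_faceCentre, cr_faceCentre])

theorem R_faceCentre : R faceCentre = faceCentre := R_apply_eq_iff.2 (by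
  unfold cf; rw [cp_faceCentre, cq_faceCentre, cr_faceCentre]; ring)

theorem eq_vertex {z : ℍ} (hP : P z = z) (hR : R z = z) : z = vertex := by
  rw [P_apply_eq_iff] at hP
  rw [R_apply_eq_iff, cf, hP] at hR
  have h := cp_mul_cr z
  rw [hP] at h
  have hk := sinA_pos
  have hs := sqD_pos
  have hr := cr_pos z
  refine coords_ext (by rw [hP, cq_vertex]) ?_
  rw [cr_vertex, eq_div_iff hk.ne']
  have e : (cr z * sinA) ^ 2 = ((1 + sqD) / 2) ^ 2 := by
    linear_combination (-(1 + sqD) / 2 * cr z) * hR + ((1 + sqD) / 2) ^ 2 * h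
      + cr z ^ 2 / 4 * sqD_sq_eq
  exact (sq_eq_sq₀ (by positivity) (by positivity)).1 e

theorem eq_edgeCentre {z : ℍ} (hP : P z = z) (hQ : Q z = z) : z = edgeCentre := by
  rw [P_apply_eq_iff] at hP
  rw [Q_apply_eq_iff] at hQ
  have h := cp_mul_cr z
  rw [hP, hQ] at h
  have hr := cr_pos z
  exact coords_ext (by rw [hP, cq_edgeCentre]) (by rw [cr_edgeCentre]; nlinarith)

theorem eq_faceCentre {z : ℍ} (hQ : Q z = z) (hR : R z = z) : z = faceCentre := by
  rw [Q_apply_eq_iff] at hQ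
  rw [R_apply_eq_iff, cf, hQ] at hR
  have h := cp_mul_cr z
  rw [hQ] at h
  have hc := cosA_pos
  have hs := sqD_pos
  have hr := cr_pos z
  have e1 : sqD * cr z = 2 * cosA * cq z := by linear_combination hR
  have e2 : cr z ^ 2 * 3 = (2 * cosA) ^ 2 := by
    linear_combination (4 * cosA ^ 2) * h - (sqD * cr z + 2 * cosA * cq z) * e1 -
      4 * cr z ^ 2 * cosA_sq + cr z ^ 2 * sqD_sq_eq
  have h3 : √3 ^ 2 = (3 : ℝ) := Real.sq_sqrt (by norm_num)
  have h30 : 0 < √(3 : ℝ) := by positivity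
  have e3 : cr z * √3 = 2 * cosA := by
    refine (sq_eq_sq₀ (by positivity) (by positivity)).1 ?_
    rw [mul_pow, h3, e2]
  refine coords_ext ?_ ?_
  · rw [cq_faceCentre, eq_div_iff h30.ne']
    have : 2 * cosA * (cq z * √3) = 2 * cosA * sqD := by
      linear_combination (-√3) * e1 + sqD * e3
    exact mul_left_cancel₀ (by positivity) this
  · rw [cr_faceCentre, eq_div_iff h30.ne', e3]

/-- The corner of the triangle with label `i`. -/
def cornerPt : Fin 3 → ℍ := ![vertex, edgeCentre, faceCentre]

theorem mem_corner_iff {i : Fin 3} {z : ℍ} : z ∈ corner i ↔ z = cornerPt i := by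
  fin_cases i
  · exact ⟨fun h => eq_vertex h.2 h.1, by rintro rfl; exact ⟨R_vertex, P_vertex⟩⟩
  · exact ⟨fun h => eq_edgeCentre h.1 h.2, by rintro rfl; exact ⟨P_edgeCentre, Q_edgeCentre⟩⟩
  · exact ⟨fun h => eq_faceCentre h.1 h.2, by rintro rfl; exact ⟨Q_faceCentre, R_faceCentre⟩⟩

/-- The closed `(2,3,7)`-triangle. -/
def InTri (z : ℍ) : Prop := 0 ≤ cq z ∧ cp z ≤ cr z ∧ 0 ≤ cf z

theorem cf_vertex : cf vertex = 0 := R_apply_eq_iff.1 R_vertex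
theorem cf_faceCentre : cf faceCentre = 0 := R_apply_eq_iff.1 R_faceCentre
theorem cf_edgeCentre : cf edgeCentre = sqD := by
  unfold cf; rw [cp_edgeCentre, cq_edgeCentre, cr_edgeCentre]; ring

theorem inTri_vertex : InTri vertex := by
  refine ⟨cq_vertex.ge, ?_, cf_vertex.ge⟩
  rw [cp_vertex, cr_vertex]
  have := sinA_pos
  gcongr
  linarith [sqD_pos]

theorem inTri_edgeCentre : InTri edgeCentre :=
  ⟨cq_edgeCentre.ge, by rw [cp_edgeCentre, cr_edgeCentre], cf_edgeCentre ▸ sqD_pos.le⟩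

theorem inTri_faceCentre : InTri faceCentre :=
  ⟨by rw [cq_faceCentre]; have := sqD_pos; positivity, by rw [cp_faceCentre, cr_faceCentre],
    cf_faceCentre.ge⟩

theorem inTri_cornerPt (i : Fin 3) : InTri (cornerPt i) := by
  fin_cases i
  · exact inTri_vertex
  · exact inTri_edgeCentre
  · exact inTri_faceCentre

theorem cq_faceCentre_pos : 0 < cq faceCentre := by
  rw [cq_faceCentre]; have := sqD_pos; positivity

theorem cp_lt_cr_vertex : cp vertex < cr vertex := by
  rw [cp_vertex, cr_vertex]
  have := sinA_pos
  gcongr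
  linarith [sqD_pos]

theorem cornerPt_injective : Function.Injective cornerPt := by
  have h01 : vertex ≠ edgeCentre := fun h => by
    have := cf_vertex; rw [h, cf_edgeCentre] at this; exact sqD_pos.ne' this
  have h02 : vertex ≠ faceCentre := fun h => by
    have := cq_vertex; rw [h] at this; exact cq_faceCentre_pos.ne' this
  have h12 : edgeCentre ≠ faceCentre := fun h => by
    have := cq_edgeCentre; rw [h] at this; exact cq_faceCentre_pos.ne' this
  intro i j hij
  fin_cases i <;> fin_cases j <;> first | rfl | exfalso
  · exact h01 hij
  · exact h02 hij
  · exact h01 hij.symm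
  · exact h12 hij
  · exact h02 hij.symm
  · exact h12 hij.symm

/-! ### Barycentric coordinates with respect to a face -/

/-- The second end of the edge on the imaginary axis that starts at `vertex`. -/
def vertex₁ : ℍ := Q vertex

/-- The third vertex of the face centred at `faceCentre`. -/
def vertex₂ : ℍ := R vertex₁

theorem coords_vertex₁ : cp vertex₁ = (1 + sqD) / 2 / sinA ∧ cq vertex₁ = 0 ∧
    cr vertex₁ = (1 - sqD) / 2 / sinA := by
  obtain ⟨h1, h2, h3⟩ := coords_Q vertex
  exact ⟨h1.trans cr_vertex, h2.trans cq_vertex, h3.trans cp_vertex⟩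

theorem coords_vertex₂ : cp vertex₂ = (1 - 2 * sinA ^ 2) / sinA ∧
    cq vertex₂ = cosA * sqD / sinA ∧ cr vertex₂ = (1 - 2 * sinA ^ 2) / sinA := by
  obtain ⟨h1, h2, h3⟩ := coords_R vertex₁
  obtain ⟨h4, h5, h6⟩ := coords_vertex₁
  have hk := sinA_pos.ne'
  have hf : cf vertex₁ = sqD / sinA := by
    unfold cf; rw [h4, h5, h6]; field_simp; ring
  rw [h4, hf] at h1
  rw [h5, hf] at h2
  rw [h6, hf] at h3
  refine ⟨h1.trans ?_, h2.trans ?_, h3.trans ?_⟩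
  · field_simp; linear_combination sqD_sq_eq
  · field_simp; ring
  · field_simp; linear_combination sqD_sq_eq

/-- Barycentric coordinate of `z` with respect to `vertex₂`. -/
def ga (z : ℍ) : ℝ := sinA * cq z / (cosA * sqD)

/-- Barycentric coordinate of `z` with respect to `vertex₁`. -/
def be (z : ℍ) : ℝ := ga z + sinA * cf z / sqD

/-- Barycentric coordinate of `z` with respect to `vertex`. -/
def al (z : ℍ) : ℝ := be z + sinA * (cr z - cp z) / sqD

theorem bary (z : ℍ) :
    cp z = al z * cp vertex + be z * cp vertex₁ + ga z * cp vertex₂ ∧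
    cq z = al z * cq vertex + be z * cq vertex₁ + ga z * cq vertex₂ ∧
    cr z = al z * cr vertex + be z * cr vertex₁ + ga z * cr vertex₂ := by
  obtain ⟨h4, h5, h6⟩ := coords_vertex₁
  obtain ⟨h1, h2, h3⟩ := coords_vertex₂
  rw [cp_vertex, cq_vertex, cr_vertex, h1, h2, h3, h4, h5, h6]
  have hk := sinA_pos.ne'
  have hs := sqD_pos.ne'
  have ha := cosA_pos.ne'
  refine ⟨?_, ?_, ?_⟩
  · simp only [al, be, ga, cf]
    field_simp
    linear_combination 8 * cq z * cosA_sq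
  · simp only [al, be, ga, cf]
    field_simp
    ring
  · simp only [al, be, ga, cf]
    field_simp
    linear_combination 8 * cq z * cosA_sq

theorem form_bary (z w : ℍ) :
    form z w = al z * form vertex w + be z * form vertex₁ w + ga z * form vertex₂ w := by
  obtain ⟨h1, h2, h3⟩ := bary z
  have e : form z w = (cp z * cr w + cr z * cp w) / 2 - cq z * cq w := rfl
  rw [e, h1, h2, h3]
  simp only [form]
  ring

/-- The hyperbolic cosine of the edge length of the tessellation `{3,7}`. -/
def coshEdge : ℝ := 1 / (2 * sinA ^ 2) - 1

theorem one_lt_coshEdge : 1 < coshEdge := by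
  have h1 := sinA_pos
  have h2 := sinA_lt
  unfold coshEdge
  have : 2 < 1 / (2 * sinA ^ 2) := by
    rw [lt_div_iff₀ (by positivity)]; nlinarith
  linarith

theorem form_vertex_vertex₁ : form vertex vertex₁ = coshEdge := by
  obtain ⟨h4, h5, h6⟩ := coords_vertex₁
  have hk := sinA_pos.ne'
  simp only [form, cp_vertex, cq_vertex, cr_vertex, h4, h5, h6, coshEdge]
  field_simp
  linear_combination 2 * sqD_sq_eq

theorem form_vertex_vertex₂ : form vertex vertex₂ = coshEdge := by
  rw [← form_vertex_vertex₁, vertex₂]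
  nth_rewrite 1 [← R_vertex]
  exact isometry_iff_form.1 isometry_R _ _

theorem Q_vertex₂ : Q vertex₂ = vertex₂ := by
  obtain ⟨h1, h2, h3⟩ := coords_vertex₂
  exact Q_apply_eq_iff.2 (h1.trans h3.symm)

theorem form_vertex₁_vertex₂ : form vertex₁ vertex₂ = coshEdge := by
  rw [← form_vertex_vertex₂, vertex₁, ← isometry_iff_form.1 isometry_Q vertex vertex₂, Q_vertex₂]

theorem eq_of_form_eq {z w : ℍ} (h0 : form z vertex = form w vertex)
    (h1 : form z vertex₁ = form w vertex₁) (h2 : form z vertex₂ = form w vertex₂) : z = w := by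
  have e1 : form z z = form z w := by
    rw [form_bary z z, form_bary z w, form_comm _ z, form_comm _ z, form_comm _ z, h0, h1, h2,
      form_comm w, form_comm w, form_comm w]
  by_contra h
  have := one_lt_form h
  rw [← e1, form_self] at this
  exact lt_irrefl _ this

theorem al_pos_of_inTri {z : ℍ} (hz : InTri z) :
    0 < al z ∧ be z ≤ al z ∧ ga z ≤ be z ∧ 0 ≤ ga z := by
  obtain ⟨h1, h2, h3⟩ := hz
  have hk := sinA_pos
  have hs := sqD_pos
  have ha := cosA_pos
  have e1 : 0 ≤ ga z := by unfold ga; positivity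
  have e2 : ga z ≤ be z := by
    have : 0 ≤ sinA * cf z / sqD := by positivity
    unfold be; linarith
  have e3 : be z ≤ al z := by
    have : 0 ≤ sinA * (cr z - cp z) / sqD := by
      have := sub_nonneg.2 h2
      positivity
    unfold al; linarith
  refine ⟨?_, e3, e2, e1⟩
  by_contra h
  have h0 : al z = 0 := by linarith
  have h4 : be z = 0 := by linarith
  have h5 : ga z = 0 := by linarith
  have := form_bary z z
  rw [h0, h4, h5, form_self] at this
  norm_num at this

theorem form_vertex_self_eqs (z : ℍ) :
    form z vertex = al z + (be z + ga z) * coshEdge ∧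
    form z vertex₁ = be z + (al z + ga z) * coshEdge ∧
    form z vertex₂ = ga z + (al z + be z) * coshEdge := by
  refine ⟨?_, ?_, ?_⟩
  · rw [form_bary, form_self, form_comm vertex₁, form_comm vertex₂, form_vertex_vertex₁,
      form_vertex_vertex₂]; ring
  · rw [form_bary, form_self, form_comm vertex₂, form_vertex_vertex₁,
      form_vertex₁_vertex₂]; ring
  · rw [form_bary, form_self, form_vertex_vertex₂, form_vertex₁_vertex₂]; ring

end

section

/-! ### The vertices nearest to a point of the triangle -/

/-- The vertices of the universal map. -/
def vertexSet : Set ℍ := {u | ∃ g ∈ TriangleGroup, g vertex = u}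

theorem vertex_mem : vertex ∈ vertexSet := ⟨1, one_mem _, rfl⟩

theorem triangleGroup_apply_mem {g : Equiv.Perm ℍ} (hg : g ∈ TriangleGroup) {u : ℍ}
    (hu : u ∈ vertexSet) : g u ∈ vertexSet := by
  obtain ⟨g', h1, rfl⟩ := hu
  exact ⟨g * g', mul_mem hg h1, rfl⟩

theorem P_apply_mem {u : ℍ} (hu : u ∈ vertexSet) : P u ∈ vertexSet := by
  obtain ⟨g', h1, rfl⟩ := hu
  refine ⟨P * g' * P⁻¹, conj_mem_triangleGroup P_mem h1, ?_⟩
  rw [P_inv, Equiv.Perm.mul_apply, Equiv.Perm.mul_apply, P_vertex]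

theorem extGroup_apply_mem {g : Equiv.Perm ℍ} (hg : g ∈ ExtGroup) {u : ℍ}
    (hu : u ∈ vertexSet) : g u ∈ vertexSet := by
  rcases mem_or_mul_mem hg with h | h
  · exact triangleGroup_apply_mem h hu
  · have := P_apply_mem (triangleGroup_apply_mem h hu)
    rwa [← Equiv.Perm.mul_apply, P_mul_P_mul] at this

theorem vertex₁_mem : vertex₁ ∈ vertexSet := extGroup_apply_mem Q_mem vertex_mem

theorem vertex₂_mem : vertex₂ ∈ vertexSet := extGroup_apply_mem R_mem vertex₁_mem

theorem vertex_ne_vertex₁ : vertex ≠ vertex₁ := fun h => by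
  have := form_vertex_vertex₁; rw [← h, form_self] at this; exact one_lt_coshEdge.ne this

theorem vertex_ne_vertex₂ : vertex ≠ vertex₂ := fun h => by
  have := form_vertex_vertex₂; rw [← h, form_self] at this; exact one_lt_coshEdge.ne this

theorem vertex₁_ne_vertex₂ : vertex₁ ≠ vertex₂ := fun h => by
  have := form_vertex₁_vertex₂; rw [← h, form_self] at this; exact one_lt_coshEdge.ne this

/-- Distinct vertices of the universal map have at least the distance of neighbours. -/
def VerticesSeparated : Prop :=
  ∀ u ∈ vertexSet, ∀ w ∈ vertexSet, u ≠ w → coshEdge ≤ form u w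

section Nearest

variable (hV : VerticesSeparated) {z u : ℍ} (hz : InTri z) (hu : u ∈ vertexSet)

include hV hz hu

theorem form_other_le (h0 : u ≠ vertex) (h1 : u ≠ vertex₁) (h2 : u ≠ vertex₂) :
    (al z + be z + ga z) * coshEdge ≤ form z u := by
  obtain ⟨ha, hb, hc, hd⟩ := al_pos_of_inTri hz
  rw [form_bary]
  have e0 := hV vertex vertex_mem u hu h0.symm
  have e1 := hV vertex₁ vertex₁_mem u hu h1.symm
  have e2 := hV vertex₂ vertex₂_mem u hu h2.symm
  have f0 := mul_le_mul_of_nonneg_left e0 ha.le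
  have f1 := mul_le_mul_of_nonneg_left e1 (hd.trans hc)
  have f2 := mul_le_mul_of_nonneg_left e2 hd
  linarith

theorem form_vertex_le : form z vertex ≤ form z u := by
  obtain ⟨ha, hb, hc, hd⟩ := al_pos_of_inTri hz
  obtain ⟨e0, e1, e2⟩ := form_vertex_self_eqs z
  have hce := one_lt_coshEdge
  by_cases h0 : u = vertex
  · rw [h0]
  by_cases h1 : u = vertex₁
  · rw [h1, e0, e1]; nlinarith
  by_cases h2 : u = vertex₂
  · rw [h2, e0, e2]; nlinarith
  have := form_other_le hV hz hu h0 h1 h2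
  rw [e0]; nlinarith

theorem form_vertex₁_le (h0 : u ≠ vertex) : form z vertex₁ ≤ form z u := by
  obtain ⟨ha, hb, hc, hd⟩ := al_pos_of_inTri hz
  obtain ⟨e0, e1, e2⟩ := form_vertex_self_eqs z
  have hce := one_lt_coshEdge
  by_cases h1 : u = vertex₁
  · rw [h1]
  by_cases h2 : u = vertex₂
  · rw [h2, e1, e2]; nlinarith
  have := form_other_le hV hz hu h0 h1 h2
  rw [e1]; nlinarith

theorem form_vertex₂_le (h0 : u ≠ vertex) (h1 : u ≠ vertex₁) : form z vertex₂ ≤ form z u := by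
  obtain ⟨ha, hb, hc, hd⟩ := al_pos_of_inTri hz
  obtain ⟨e0, e1, e2⟩ := form_vertex_self_eqs z
  have hce := one_lt_coshEdge
  by_cases h2 : u = vertex₂
  · rw [h2]
  have := form_other_le hV hz hu h0 h1 h2
  rw [e2]; nlinarith

theorem eq_vertex_of_form_le (hlt : be z < al z) (h : form z u ≤ form z vertex) : u = vertex := by
  obtain ⟨ha, hb, hc, hd⟩ := al_pos_of_inTri hz
  obtain ⟨e0, e1, e2⟩ := form_vertex_self_eqs z
  have hce := one_lt_coshEdge
  by_contra h0
  have := form_vertex₁_le hV hz hu h0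
  rw [e1] at this
  rw [e0] at h
  nlinarith

theorem eq_or_of_form_le (hlt : ga z < be z) (h : form z u ≤ form z vertex₁) :
    u = vertex ∨ u = vertex₁ := by
  obtain ⟨ha, hb, hc, hd⟩ := al_pos_of_inTri hz
  obtain ⟨e0, e1, e2⟩ := form_vertex_self_eqs z
  have hce := one_lt_coshEdge
  by_contra! h0
  have := form_vertex₂_le hV hz hu h0.1 h0.2
  rw [e2] at this
  rw [e1] at h
  nlinarith

theorem eq_or_or_of_form_le (hlt : 0 < ga z) (h : form z u ≤ form z vertex₂) :
    u = vertex ∨ u = vertex₁ ∨ u = vertex₂ := by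
  obtain ⟨e0, e1, e2⟩ := form_vertex_self_eqs z
  have hce := one_lt_coshEdge
  by_contra! h0
  have := form_other_le hV hz hu h0.1 h0.2.1 h0.2.2
  rw [e2] at h
  nlinarith

end Nearest

theorem form_pair_le (hV : VerticesSeparated) {z u u' : ℍ} (hz : InTri z) (hu : u ∈ vertexSet)
    (hu' : u' ∈ vertexSet) (hne : u ≠ u') :
    form z vertex + form z vertex₁ ≤ form z u + form z u' := by
  by_cases h0 : u = vertex
  · have := form_vertex₁_le hV hz hu' (by rw [← h0]; exact hne.symm)
    rw [h0]; linarith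
  · have := form_vertex₁_le hV hz hu h0
    have := form_vertex_le hV hz hu'
    linarith

theorem form_triple_le (hV : VerticesSeparated) {z u u' u'' : ℍ} (hz : InTri z)
    (hu : u ∈ vertexSet) (hu' : u' ∈ vertexSet) (hu'' : u'' ∈ vertexSet) (h1 : u ≠ u')
    (h2 : u ≠ u'') (h3 : u' ≠ u'') :
    form z vertex + form z vertex₁ + form z vertex₂ ≤ form z u + form z u' + form z u'' := by
  by_cases ha : u ≠ vertex ∧ u ≠ vertex₁
  · linarith [form_vertex₂_le hV hz hu ha.1 ha.2, form_pair_le hV hz hu' hu'' h3]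
  by_cases hb : u' ≠ vertex ∧ u' ≠ vertex₁
  · linarith [form_vertex₂_le hV hz hu' hb.1 hb.2, form_pair_le hV hz hu hu'' h2]
  have hc : u'' ≠ vertex ∧ u'' ≠ vertex₁ := by
    grind
  linarith [form_vertex₂_le hV hz hu'' hc.1 hc.2, form_pair_le hV hz hu hu' h1]

/-- The triangle is a strict fundamental domain: an isometry that permutes the vertices and maps a
point of the triangle into the triangle fixes that point. The reason is that the distances of a
point of the triangle from `vertex`, `vertex₁`, `vertex₂` are its three smallest distances from
vertices. -/
theorem eq_of_inTri (hV : VerticesSeparated) {t : Equiv.Perm ℍ} (ht : Isometry t)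
    (hmem : ∀ u ∈ vertexSet, t u ∈ vertexSet) (hmem' : ∀ u ∈ vertexSet, t⁻¹ u ∈ vertexSet)
    {z : ℍ} (hz : InTri z) (hz' : InTri (t z)) : t z = z := by
  have key : ∀ (s : Equiv.Perm ℍ) (_ : ∀ x y, form (s x) (s y) = form x y)
      (_ : ∀ u ∈ vertexSet, s⁻¹ u ∈ vertexSet) (x : ℍ) (_ : InTri x),
      form x vertex ≤ form (s x) vertex ∧
      form x vertex + form x vertex₁ ≤ form (s x) vertex + form (s x) vertex₁ ∧
      form x vertex + form x vertex₁ + form x vertex₂ ≤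
        form (s x) vertex + form (s x) vertex₁ + form (s x) vertex₂ := by
    intro s hs hm x hx
    have e : ∀ u, form (s x) u = form x (s⁻¹ u) := fun u => by
      rw [← hs x, perm_apply_inv]
    rw [e, e, e]
    have i := (s⁻¹).injective
    exact ⟨form_vertex_le hV hx (hm _ vertex_mem),
      form_pair_le hV hx (hm _ vertex_mem) (hm _ vertex₁_mem) (i.ne vertex_ne_vertex₁),
      form_triple_le hV hx (hm _ vertex_mem) (hm _ vertex₁_mem) (hm _ vertex₂_mem)
        (i.ne vertex_ne_vertex₁) (i.ne vertex_ne_vertex₂) (i.ne vertex₁_ne_vertex₂)⟩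
  have hf := isometry_iff_form.1 ht
  obtain ⟨a1, a2, a3⟩ := key t hf hmem' z hz
  obtain ⟨b1, b2, b3⟩ := key t⁻¹ (fun x y => by
    rw [← hf, perm_apply_inv, perm_apply_inv]) (by simpa using hmem) (t z) hz'
  rw [perm_inv_apply] at b1 b2 b3
  exact (eq_of_form_eq (by linarith) (by linarith) (by linarith)).symm

theorem exists_interior : ∃ o : ℍ, 0 < cq o ∧ cp o < cr o ∧ 0 < cf o := by
  have hs := sqD_pos
  have hs1 := sqD_lt_one
  have ha := cosA_lt_one
  have ha0 := cosA_pos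
  -- a point of the circle `|z|² = 1 / (1 + s)`, close to the imaginary axis
  have hm : sqD ^ 2 / 64 < 1 / (1 + sqD) := by
    rw [lt_div_iff₀ (by positivity)]; nlinarith
  set y := √(1 / (1 + sqD) - (sqD / 8) ^ 2) with hy
  have hy2 : y ^ 2 = 1 / (1 + sqD) - (sqD / 8) ^ 2 := Real.sq_sqrt (by nlinarith)
  have hy0 : 0 < y := Real.sqrt_pos.2 (by nlinarith)
  obtain ⟨o, h1, h2, h3⟩ := exists_coords (p := 1 / (1 + sqD) / y) (q := sqD / 8 / y) (r := 1 / y)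
    (by positivity) (by field_simp; rw [hy2]; field_simp)
  refine ⟨o, by rw [h2]; positivity, ?_, ?_⟩
  · rw [h1, h3]
    gcongr
    rw [div_lt_one (by positivity)]; linarith
  · unfold cf
    rw [h1, h2, h3]
    have : (1 + sqD) / 2 * (1 / (1 + sqD) / y) - 2 * cosA * (sqD / 8 / y) -
      (1 - sqD) / 2 * (1 / y) = (sqD * (2 - cosA) / 4) / y := by
      field_simp
      ring
    rw [this]
    have : 0 < 2 - cosA := by linarith
    positivity

/-- A point in the interior of the triangle. -/
def interiorPt : ℍ := exists_interior.choose

theorem cq_interiorPt : 0 < cq interiorPt := exists_interior.choose_spec.1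
theorem cp_interiorPt : cp interiorPt < cr interiorPt := exists_interior.choose_spec.2.1
theorem cf_interiorPt : 0 < cf interiorPt := exists_interior.choose_spec.2.2

theorem inTri_interiorPt : InTri interiorPt :=
  ⟨cq_interiorPt.le, cp_interiorPt.le, cf_interiorPt.le⟩

theorem bary_interiorPt : 0 < ga interiorPt ∧ ga interiorPt < be interiorPt ∧
    be interiorPt < al interiorPt := by
  have hk := sinA_pos
  have hs := sqD_pos
  have ha := cosA_pos
  have h1 := cq_interiorPt
  have h2 := sub_pos.2 cp_interiorPt
  have h3 := cf_interiorPt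
  refine ⟨by unfold ga; positivity, ?_, ?_⟩
  · have : 0 < sinA * cf interiorPt / sqD := by positivity
    rw [be]; linarith
  · have : 0 < sinA * (cr interiorPt - cp interiorPt) / sqD := by positivity
    rw [al]; linarith

/-- An isometry that permutes the vertices and maps an interior point of the triangle into the
triangle is the identity. -/
theorem eq_one_of_inTri_interiorPt (hV : VerticesSeparated) {t : Equiv.Perm ℍ} (ht : Isometry t)
    (hmem : ∀ u ∈ vertexSet, t u ∈ vertexSet) (hmem' : ∀ u ∈ vertexSet, t⁻¹ u ∈ vertexSet)
    (hz : InTri (t interiorPt)) : t = 1 := by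
  have ho := eq_of_inTri hV ht hmem hmem' inTri_interiorPt hz
  obtain ⟨h1, h2, h3⟩ := bary_interiorPt
  have hf := isometry_iff_form.1 ht
  have e : ∀ u, form interiorPt (t u) = form interiorPt u := fun u => by
    nth_rewrite 1 [← ho]; exact hf _ _
  have i := t.injective
  have t0 : t vertex = vertex :=
    eq_vertex_of_form_le hV inTri_interiorPt (hmem _ vertex_mem) h3 (e _).le
  have t1 : t vertex₁ = vertex₁ := by
    rcases eq_or_of_form_le hV inTri_interiorPt (hmem _ vertex₁_mem) h2 (e _).le with h | h
    · exact absurd (i (h.trans t0.symm)) vertex_ne_vertex₁.symm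
    · exact h
  have t2 : t vertex₂ = vertex₂ := by
    rcases eq_or_or_of_form_le hV inTri_interiorPt (hmem _ vertex₂_mem) h1 (e _).le with h | h | h
    · exact absurd (i (h.trans t0.symm)) vertex_ne_vertex₂.symm
    · exact absurd (i (h.trans t1.symm)) vertex₁_ne_vertex₂.symm
    · exact h
  ext1 z
  apply eq_of_form_eq
  · nth_rewrite 1 [← t0]; exact hf _ _
  · nth_rewrite 1 [← t1]; exact hf _ _
  · nth_rewrite 1 [← t2]; exact hf _ _

/-! ### Discrete groups of isometries that contain the triangle group -/

/-- A group of isometries of the hyperbolic plane that contains the triangle group and has locally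
finite orbits. -/
structure IsDiscreteOver (N : Subgroup (Equiv.Perm ℍ)) : Prop where
  isometry : ∀ t ∈ N, Isometry t
  le : TriangleGroup ≤ N
  finite : ∀ (z w : ℍ) (r : ℝ), {t | t ∈ N ∧ form (t z) w ≤ r}.Finite

theorem form_rotC (u : ℍ) :
    form (rotC u) u = 1 + 2 * (form u vertex ^ 2 - 1) * sinA ^ 2 := by
  have h1 : rotC u = R (P u) := rfl
  rw [h1, form_R, form_P]
  obtain ⟨e1, e2, e3⟩ := coords_P u
  have h := cp_mul_cr u
  have hk := sinA_pos.ne'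
  have hf : form u vertex = ((1 + sqD) / 2 * cp u + (1 - sqD) / 2 * cr u) / (2 * sinA) := by
    simp only [form, cp_vertex, cq_vertex, cr_vertex]
    field_simp
    ring
  rw [form_self, hf]
  simp only [cf, e1, e2, e3]
  field_simp
  linear_combination (-16 * cq u ^ 2) * cosA_sq - 16 * sinA ^ 2 * h
    + 4 * cp u * cr u * sqD_sq_eq

section Discrete

variable {N : Subgroup (Equiv.Perm ℍ)} (hN : IsDiscreteOver N)

include hN

/-- The images of `vertex` under a discrete group over the triangle group are as far from each other
as neighbouring vertices: of two images at minimal distance, rotate one about the other by `2π/7`. -/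
theorem IsDiscreteOver.coshEdge_le {t : Equiv.Perm ℍ} (ht : t ∈ N) (hne : t vertex ≠ vertex) :
    coshEdge ≤ form (t vertex) vertex := by
  set S : Set (Equiv.Perm ℍ) := {s | (s ∈ N ∧ form (s vertex) vertex ≤ form (t vertex) vertex) ∧
    s vertex ≠ vertex} with hS
  have hfin : S.Finite := (hN.finite vertex vertex (form (t vertex) vertex)).subset fun s hs => hs.1
  obtain ⟨s, ⟨⟨hs1, hs2⟩, hs3⟩, hmin⟩ := Set.exists_min_image S
    (fun s => form (s vertex) vertex) hfin ⟨t, ⟨ht, le_rfl⟩, hne⟩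
  refine le_trans ?_ hs2
  set β := form (s vertex) vertex with hβ
  have hβ1 : 1 < β := one_lt_form hs3
  have hr : form ((s⁻¹ * rotC * s) vertex) vertex = 1 + 2 * (β ^ 2 - 1) * sinA ^ 2 := by
    rw [hβ, ← form_rotC, ← isometry_iff_form.1 (hN.isometry s hs1)]
    simp [Equiv.Perm.mul_apply]
  have hk := sinA_pos
  have hmem : s⁻¹ * rotC * s ∈ N := mul_mem (mul_mem (inv_mem hs1) (hN.le rotC_mem)) hs1
  have hne' : (s⁻¹ * rotC * s) vertex ≠ vertex := fun h => by
    rw [h, form_self] at hr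
    have : 0 < (β ^ 2 - 1) * sinA ^ 2 := by
      have : 0 < β ^ 2 - 1 := by nlinarith
      positivity
    linarith
  have hle : β ≤ 1 + 2 * (β ^ 2 - 1) * sinA ^ 2 := by
    by_contra! hlt
    have := hmin _ ⟨⟨hmem, by rw [hr]; linarith⟩, hne'⟩
    simp only [hr] at this
    linarith
  unfold coshEdge
  have h2 : 1 ≤ (β + 1) * (2 * sinA ^ 2) := by
    by_contra! h
    have := mul_lt_mul_of_pos_left h (sub_pos.2 hβ1)
    linarith
  rw [sub_le_iff_le_add, div_le_iff₀ (by positivity)]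
  exact h2

theorem IsDiscreteOver.verticesSeparated : VerticesSeparated := by
  rintro u ⟨g, hg, rfl⟩ w ⟨g', hg', rfl⟩ hne
  have hm := mul_mem (inv_mem (hN.le hg')) (hN.le hg)
  have e : form (g vertex) (g' vertex) = form ((g'⁻¹ * g) vertex) vertex := by
    rw [← isometry_iff_form.1 (hN.isometry g' (hN.le hg')) ((g'⁻¹ * g) vertex),
      Equiv.Perm.mul_apply, perm_apply_inv]
  rw [e]
  refine hN.coshEdge_le hm fun h => hne ?_
  rwa [Equiv.Perm.mul_apply, Equiv.Perm.inv_eq_iff_eq] at h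

theorem IsDiscreteOver.finite_extGroup (z w : ℍ) (r : ℝ) :
    {t | t ∈ ExtGroup ∧ form (t z) w ≤ r}.Finite := by
  refine ((hN.finite z w r).union ((hN.finite z (P w) r).image (fun t => P * t))).subset ?_
  rintro t ⟨ht, hr⟩
  rcases mem_or_mul_mem ht with h | h
  · exact Or.inl ⟨hN.le h, hr⟩
  · refine Or.inr ⟨P * t, ⟨hN.le h, ?_⟩, P_mul_P_mul t⟩
    rw [Equiv.Perm.mul_apply, isometry_iff_form.1 isometry_P]
    exact hr

/-- Among the images of `z` under a group `K` generated by some of `P`, `Q`, `R` and an element `g`,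
one minimises the distance from an interior point of the triangle. -/
theorem IsDiscreteOver.exists_min {K : Subgroup (Equiv.Perm ℍ)} (hK : K ≤ ExtGroup) (z : ℍ) :
    ∃ d ∈ K, (P ∈ K → 0 ≤ cq (d z)) ∧ (Q ∈ K → cp (d z) ≤ cr (d z)) ∧ (R ∈ K → 0 ≤ cf (d z)) := by
  set S : Set (Equiv.Perm ℍ) := {s | s ∈ K ∧ form (s z) interiorPt ≤ form z interiorPt} with hS
  have hfin : S.Finite := (hN.finite_extGroup z interiorPt (form z interiorPt)).subset
    fun s hs => ⟨hK hs.1, hs.2⟩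
  obtain ⟨d, ⟨hd1, hd2⟩, hmin'⟩ := Set.exists_min_image S
    (fun s => form (s z) interiorPt) hfin ⟨1, one_mem _, le_rfl⟩
  have hmin : ∀ s ∈ K, form (d z) interiorPt ≤ form ((s * d) z) interiorPt := by
    intro s hs
    by_cases h : form ((s * d) z) interiorPt ≤ form z interiorPt
    · exact hmin' _ ⟨mul_mem hs hd1, h⟩
    · exact hd2.trans (not_le.1 h).le
  refine ⟨d, hd1, fun h => ?_, fun h => ?_, fun h => ?_⟩
  · have := hmin P h
    rw [Equiv.Perm.mul_apply, form_P] at this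
    have hq := cq_interiorPt
    by_contra! hlt
    nlinarith
  · have := hmin Q h
    rw [Equiv.Perm.mul_apply, form_Q] at this
    have hq := sub_pos.2 cp_interiorPt
    by_contra! hlt
    nlinarith
  · have := hmin R h
    rw [Equiv.Perm.mul_apply, form_R] at this
    have hq := cf_interiorPt
    by_contra! hlt
    nlinarith

/-- The triangle meets every orbit of the extended triangle group. -/
theorem IsDiscreteOver.exists_inTri (z : ℍ) : ∃ g ∈ ExtGroup, InTri (g z) := by
  obtain ⟨d, hd, h1, h2, h3⟩ := hN.exists_min le_rfl z
  exact ⟨d, hd, h1 P_mem, h2 Q_mem, h3 R_mem⟩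

theorem IsDiscreteOver.apply_vertex_mem {t : Equiv.Perm ℍ} (ht : t ∈ N) :
    t vertex ∈ vertexSet := by
  obtain ⟨g, hg, hz⟩ := hN.exists_inTri (t vertex)
  have hgi := isometry_iff_form.1 (isometry_of_mem_extGroup hg)
  have key : ∀ v ∈ vertexSet, g (t vertex) = v ∨ coshEdge ≤ form v (g (t vertex)) := by
    intro v hv
    by_cases h : g (t vertex) = v
    · exact Or.inl h
    right
    obtain ⟨n, hn, hn'⟩ := extGroup_apply_mem (inv_mem hg) hv
    have hv' : v = g (n vertex) := by rw [hn', perm_apply_inv]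
    have hne : (n⁻¹ * t) vertex ≠ vertex := fun h' => h (by
      rw [Equiv.Perm.mul_apply, Equiv.Perm.inv_eq_iff_eq] at h'
      rw [hv', h'])
    have hle := hN.coshEdge_le (mul_mem (inv_mem (hN.le hn)) ht) hne
    rw [form_comm, hv', hgi, ← isometry_iff_form.1 (hN.isometry _ (inv_mem (hN.le hn))),
      perm_inv_apply]
    exact hle
  have hmem : g (t vertex) ∈ vertexSet := by
    rcases key _ vertex_mem with h | h0
    · rw [h]; exact vertex_mem
    rcases key _ vertex₁_mem with h | h1
    · rw [h]; exact vertex₁_mem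
    rcases key _ vertex₂_mem with h | h2
    · rw [h]; exact vertex₂_mem
    exfalso
    set u := g (t vertex)
    obtain ⟨ha, hb, hc, hd⟩ := al_pos_of_inTri hz
    obtain ⟨e0, e1, e2⟩ := form_vertex_self_eqs u
    have hu := form_bary u u
    rw [form_self] at hu
    have f0 := mul_le_mul_of_nonneg_left h0 ha.le
    have f1 := mul_le_mul_of_nonneg_left h1 (hd.trans hc)
    have f2 := mul_le_mul_of_nonneg_left h2 hd
    rw [form_comm, e0] at h0
    rw [form_comm, e1] at h1
    rw [form_comm, e2] at h2
    have hce := one_lt_coshEdge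
    have g1 : (al u + be u + ga u) * coshEdge ≤ 1 := by linarith
    have g2 : 3 * coshEdge ≤ (al u + be u + ga u) * (1 + 2 * coshEdge) := by linarith
    have g3 := mul_le_mul_of_nonneg_right g1 (by linarith : 0 ≤ 1 + 2 * coshEdge)
    have g4 := mul_le_mul_of_nonneg_left g2 (by linarith : 0 ≤ coshEdge)
    have g5 : 0 < (coshEdge - 1) * (3 * coshEdge + 1) :=
      mul_pos (by linarith) (by linarith)
    linarith
  have := extGroup_apply_mem (inv_mem hg) hmem
  rwa [perm_inv_apply] at this

theorem IsDiscreteOver.apply_mem {t : Equiv.Perm ℍ} (ht : t ∈ N) {u : ℍ} (hu : u ∈ vertexSet) :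
    t u ∈ vertexSet := by
  obtain ⟨g, hg, rfl⟩ := hu
  exact hN.apply_vertex_mem (mul_mem ht (hN.le hg))

/-- The triangle group is maximal: discrete groups of isometries that contain it are contained in
the extended triangle group. -/
theorem IsDiscreteOver.le_extGroup : N ≤ ExtGroup := by
  intro t ht
  obtain ⟨g, hg, hz⟩ := hN.exists_inTri (t interiorPt)
  have h1 : g * t = 1 := by
    apply eq_one_of_inTri_interiorPt hN.verticesSeparated
    · exact (isometry_of_mem_extGroup hg).comp (hN.isometry t ht)
    · exact fun u hu => extGroup_apply_mem hg (hN.apply_mem ht hu)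
    · intro u hu
      rw [mul_inv_rev]
      exact hN.apply_mem (inv_mem ht) (extGroup_apply_mem (inv_mem hg) hu)
    · exact hz
  rw [eq_inv_of_mul_eq_one_right h1]
  exact inv_mem hg

theorem IsDiscreteOver.eq_of_extGroup {g : Equiv.Perm ℍ} (hg : g ∈ ExtGroup) {z : ℍ}
    (hz : InTri z) (hz' : InTri (g z)) : g z = z :=
  eq_of_inTri hN.verticesSeparated (isometry_of_mem_extGroup hg)
    (fun _ hu => extGroup_apply_mem hg hu) (fun _ hu => extGroup_apply_mem (inv_mem hg) hu) hz hz'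

theorem IsDiscreteOver.eq_one_of_extGroup {g : Equiv.Perm ℍ} (hg : g ∈ ExtGroup)
    (hz' : InTri (g interiorPt)) : g = 1 :=
  eq_one_of_inTri_interiorPt hN.verticesSeparated (isometry_of_mem_extGroup hg)
    (fun _ hu => extGroup_apply_mem hg hu) (fun _ hu => extGroup_apply_mem (inv_mem hg) hu) hz'

/-! ### Stabilizers -/

omit hN in
theorem P_notMem : P ∉ TriangleGroup := fun h => by
  have h1 := eq_one_of_fixed h (cornerPt_injective.ne (by decide : (0 : Fin 3) ≠ 1))
    P_vertex P_edgeCentre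
  have h2 : P faceCentre = faceCentre := by rw [h1]; rfl
  rw [P_apply_eq_iff] at h2
  exact cq_faceCentre_pos.ne' h2

theorem IsDiscreteOver.stabilizer_vertex {g : Equiv.Perm ℍ} (hg : g ∈ TriangleGroup)
    (hfix : g vertex = vertex) : g ∈ Subgroup.zpowers rotC := by
  set K : Subgroup (Equiv.Perm ℍ) := Subgroup.closure {P, R} with hK
  have hPK : P ∈ K := Subgroup.subset_closure (by simp)
  have hRK : R ∈ K := Subgroup.subset_closure (by simp)
  have hKE : K ≤ ExtGroup := Subgroup.closure_mono (by
    rintro x (rfl | rfl) <;> simp)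
  obtain ⟨d, hd, h1, -, h3⟩ := hN.exists_min hKE (g interiorPt)
  have hdv : d vertex = vertex := by
    have : K ≤ MulAction.stabilizer (Equiv.Perm ℍ) vertex := by
      rw [hK, Subgroup.closure_le]
      rintro x (rfl | rfl)
      · exact P_vertex
      · exact R_vertex
    exact this hd
  have hdg : d * g ∈ ExtGroup := mul_mem (hKE hd) (triangleGroup_le hg)
  have h2 : cp ((d * g) interiorPt) ≤ cr ((d * g) interiorPt) := by
    have hi := isometry_iff_form.1 (isometry_of_mem_extGroup hdg)
    have e0 : form ((d * g) interiorPt) vertex = form interiorPt vertex := by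
      rw [← hi interiorPt vertex]; simp [hfix, hdv]
    have e1 : form ((d * g) interiorPt) vertex₁ = form interiorPt ((d * g)⁻¹ vertex₁) := by
      rw [← hi interiorPt]; simp
    have hle := form_vertex_le hN.verticesSeparated inTri_interiorPt
      (extGroup_apply_mem (inv_mem hdg) vertex₁_mem)
    rw [← e0, ← e1, (form_vertex_self_eqs _).1, (form_vertex_self_eqs _).2.1] at hle
    have hce := one_lt_coshEdge
    have hle2 : be ((d * g) interiorPt) ≤ al ((d * g) interiorPt) := by nlinarith
    rw [al, le_add_iff_nonneg_right] at hle2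
    have hk := sinA_pos
    have hs := sqD_pos
    by_contra! hlt
    have : sinA * (cr ((d * g) interiorPt) - cp ((d * g) interiorPt)) / sqD < 0 :=
      div_neg_of_neg_of_pos (mul_neg_of_pos_of_neg hk (by linarith)) hs
    linarith
  have h5 := hN.eq_one_of_extGroup hdg ⟨h1 hPK, h2, h3 hRK⟩
  have hgK : g ∈ K := by
    rw [eq_inv_of_mul_eq_one_right h5]; exact inv_mem hd
  have hz : Subgroup.zpowers rotC ≤ TriangleGroup := by
    rw [Subgroup.zpowers_le]; exact rotC_mem
  rcases mem_or_mul_mem_of_mem_closure (H := Subgroup.zpowers rotC) (p := P) (by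
    rintro x (rfl | rfl)
    · exact ⟨P_mul_P, by rw [P_mul_P]; exact one_mem _⟩
    · exact ⟨R_mul_R, by rw [← rotC_inv]; exact inv_mem (Subgroup.mem_zpowers _)⟩) hgK with h | h
  · exact h
  · exfalso
    have := mul_mem (hz h) (inv_mem hg)
    rw [mul_inv_cancel_right] at this
    exact P_notMem this

omit hN in
theorem rotB_vertex : rotB vertex = vertex₁ := by
  rw [rotB, Equiv.Perm.mul_apply, R_vertex, vertex₁]

omit hN in
theorem rotB_inv_vertex : rotB⁻¹ vertex = vertex₂ := by
  rw [rotB_inv, Equiv.Perm.mul_apply, vertex₂, vertex₁]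

omit hN in
theorem rotB_faceCentre : rotB faceCentre = faceCentre := by
  rw [rotB, Equiv.Perm.mul_apply, R_faceCentre, Q_faceCentre]

omit hN in
theorem rotA_vertex : rotA vertex = vertex₁ := by
  rw [rotA, P_mul_Q_comm, Equiv.Perm.mul_apply, P_vertex, vertex₁]

omit hN in
theorem rotA_edgeCentre : rotA edgeCentre = edgeCentre := by
  rw [rotA, Equiv.Perm.mul_apply, Q_edgeCentre, P_edgeCentre]

omit hN in
theorem bary_edgeCentre : al edgeCentre = be edgeCentre ∧ ga edgeCentre < be edgeCentre := by
  have hk := sinA_pos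
  have hs := sqD_pos
  constructor
  · rw [al, cp_edgeCentre, cr_edgeCentre]; simp
  · rw [be, cf_edgeCentre]
    have : 0 < sinA * sqD / sqD := by positivity
    linarith

omit hN in
theorem bary_faceCentre : al faceCentre = be faceCentre ∧ be faceCentre = ga faceCentre := by
  constructor
  · rw [al, cp_faceCentre, cr_faceCentre]; simp
  · rw [be, cf_faceCentre]; simp

theorem IsDiscreteOver.stabilizer_edgeCentre {g : Equiv.Perm ℍ} (hg : g ∈ TriangleGroup)
    (hfix : g edgeCentre = edgeCentre) : g ∈ Subgroup.zpowers rotA := by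
  have hi := isometry_iff_form.1 (isometry_of_mem_extGroup (triangleGroup_le hg))
  have e : form edgeCentre (g vertex) = form edgeCentre vertex := by
    nth_rewrite 1 [← hfix]; exact hi _ _
  have hne : edgeCentre ≠ vertex := cornerPt_injective.ne (by decide : (1 : Fin 3) ≠ 0)
  have hle : form edgeCentre vertex ≤ form edgeCentre vertex₁ :=
    form_vertex_le hN.verticesSeparated inTri_edgeCentre vertex₁_mem
  rcases eq_or_of_form_le hN.verticesSeparated inTri_edgeCentre
    (triangleGroup_apply_mem hg vertex_mem) bary_edgeCentre.2 (e.le.trans hle) with h | h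
  · rw [eq_one_of_fixed hg hne hfix h]; exact one_mem _
  · have : rotA⁻¹ * g = 1 := by
      refine eq_one_of_fixed (mul_mem (inv_mem rotA_mem) hg) hne ?_ ?_
      · rw [Equiv.Perm.mul_apply, hfix, Equiv.Perm.inv_eq_iff_eq, rotA_edgeCentre]
      · rw [Equiv.Perm.mul_apply, h, Equiv.Perm.inv_eq_iff_eq, rotA_vertex]
    rw [← eq_inv_mul_iff_mul_eq, inv_inv, mul_one] at this
    rw [this]; exact Subgroup.mem_zpowers _

theorem IsDiscreteOver.stabilizer_faceCentre {g : Equiv.Perm ℍ} (hg : g ∈ TriangleGroup)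
    (hfix : g faceCentre = faceCentre) : g ∈ Subgroup.zpowers rotB := by
  have hi := isometry_iff_form.1 (isometry_of_mem_extGroup (triangleGroup_le hg))
  have e : form faceCentre (g vertex) = form faceCentre vertex := by
    nth_rewrite 1 [← hfix]; exact hi _ _
  have hne : faceCentre ≠ vertex := cornerPt_injective.ne (by decide : (2 : Fin 3) ≠ 0)
  have hle : form faceCentre vertex ≤ form faceCentre vertex₂ :=
    form_vertex_le hN.verticesSeparated inTri_faceCentre vertex₂_mem
  have hpos : 0 < ga faceCentre := by
    have := (al_pos_of_inTri inTri_faceCentre).1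
    rwa [bary_faceCentre.1, bary_faceCentre.2] at this
  have key : ∀ x ∈ Subgroup.zpowers rotB, x vertex = g vertex → g ∈ Subgroup.zpowers rotB := by
    intro x hx hxg
    have hz : Subgroup.zpowers rotB ≤ TriangleGroup := by
      rw [Subgroup.zpowers_le]; exact rotB_mem
    have hxf : x faceCentre = faceCentre := by
      have : Subgroup.zpowers rotB ≤ MulAction.stabilizer (Equiv.Perm ℍ) faceCentre := by
        rw [Subgroup.zpowers_le]; exact rotB_faceCentre
      exact this hx
    have : x⁻¹ * g = 1 := by
      refine eq_one_of_fixed (mul_mem (inv_mem (hz hx)) hg) hne ?_ ?_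
      · rw [Equiv.Perm.mul_apply, hfix, Equiv.Perm.inv_eq_iff_eq, hxf]
      · rw [Equiv.Perm.mul_apply, Equiv.Perm.inv_eq_iff_eq, hxg]
    rw [← eq_inv_mul_iff_mul_eq, inv_inv, mul_one] at this
    rw [this]; exact hx
  rcases eq_or_or_of_form_le hN.verticesSeparated inTri_faceCentre
    (triangleGroup_apply_mem hg vertex_mem) hpos (e.le.trans hle) with h | h | h
  · exact key 1 (one_mem _) h.symm
  · exact key _ (Subgroup.mem_zpowers _) (rotB_vertex.trans h.symm)
  · exact key _ (inv_mem (Subgroup.mem_zpowers _)) (rotB_inv_vertex.trans h.symm)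

/-- An orientation reversing element of the extended triangle group with a fixed point is conjugate
to the reflection `P`. -/
theorem IsDiscreteOver.exists_conj_eq_P {t : Equiv.Perm ℍ} (ht : t ∈ ExtGroup)
    (ht' : t ∉ TriangleGroup) {z : ℍ} (hz : t z = z) :
    ∃ g ∈ TriangleGroup, g * t * g⁻¹ = P := by
  suffices h : ∃ g ∈ ExtGroup, g * t * g⁻¹ = P by
    obtain ⟨g, hg, h⟩ := h
    rcases mem_or_mul_mem hg with hg' | hg'
    · exact ⟨g, hg', h⟩
    · refine ⟨P * g, hg', ?_⟩
      have : P * g * t * (P * g)⁻¹ = P * (g * t * g⁻¹) * P⁻¹ := by group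
      rw [this, h, mul_inv_cancel_right]
  obtain ⟨g, hg, hw⟩ := hN.exists_inTri z
  set w := g z with hwz
  set s := g * t * g⁻¹ with hs
  have hsE : s ∈ ExtGroup := mul_mem (mul_mem hg ht) (inv_mem hg)
  have hsT : s ∉ TriangleGroup := fun h => ht' (by
    have := conj_mem_triangleGroup (inv_mem hg) h
    rw [hs] at this
    convert this using 1
    group)
  have hsw : s w = w := by simp [hs, hwz, hz]
  have hPs : P * s ∈ TriangleGroup := (mem_or_mul_mem hsE).resolve_left hsT
  have hQs : Q * s ∈ TriangleGroup := by
    have : Q * s = rotA⁻¹ * (P * s) := by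
      rw [rotA, mul_inv_rev, P_inv, Q_inv, mul_assoc, P_mul_P_mul]
    rw [this]; exact mul_mem (inv_mem rotA_mem) hPs
  -- it suffices to find a conjugate of `s`
  suffices h : ∃ x ∈ ExtGroup, x * s * x⁻¹ = P by
    obtain ⟨x, hx, h⟩ := h
    refine ⟨x * g, mul_mem hx hg, ?_⟩
    rw [← h, hs]; group
  have hf := isometry_iff_form.1 (isometry_of_mem_extGroup hsE)
  have e : form w (s vertex) = form w vertex := by nth_rewrite 1 [← hsw]; exact hf _ _
  have hsv := extGroup_apply_mem hsE vertex_mem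
  have case0 : s vertex = vertex → ∃ x ∈ ExtGroup, x * s * x⁻¹ = P := by
    intro h
    have h1 := hN.stabilizer_vertex hPs (by rw [Equiv.Perm.mul_apply, h, P_vertex])
    obtain ⟨j, hj⟩ := Subgroup.mem_zpowers_iff.1 h1
    have h2 := conj_pow_of_conj_inv P_mul_P P_conj_rotC (4 * j)
    have h3 : rotC ^ (2 * (4 * j)) = rotC ^ j := by
      have : rotC ^ (7 : ℤ) = 1 := by exact_mod_cast rotC_pow_seven
      rw [show 2 * (4 * j) = j + 7 * j by ring, zpow_add, zpow_mul, this, one_zpow, mul_one]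
    rw [h3, hj, P_mul_P_mul] at h2
    refine ⟨rotC ^ (4 * j), triangleGroup_le (zpow_mem rotC_mem _), ?_⟩
    rw [← h2]; group
  have hQP : ∀ x ∈ ExtGroup, x * s * x⁻¹ = Q → ∃ x ∈ ExtGroup, x * s * x⁻¹ = P := by
    intro x hx h
    refine ⟨rotC ^ 3 * rotB * x, mul_mem (triangleGroup_le
      (mul_mem (pow_mem rotC_mem 3) rotB_mem)) hx, ?_⟩
    rw [P_eq_conj_Q, ← h]; group
  obtain ⟨ha, hb, hc, hd⟩ := al_pos_of_inTri hw
  have hk := sinA_pos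
  have hs' := sqD_pos
  rcases hb.lt_or_eq with hlt | heq
  · exact case0 (eq_vertex_of_form_le hN.verticesSeparated hw hsv hlt e.le)
  have hQw : Q w = w := by
    rw [al, left_eq_add, div_eq_zero_iff, mul_eq_zero] at heq
    rw [Q_apply_eq_iff]
    rcases heq with (h | h) | h <;> linarith
  rcases hc.lt_or_eq with hlt | heq'
  · have hle : form w vertex ≤ form w vertex₁ :=
      form_vertex_le hN.verticesSeparated hw vertex₁_mem
    rcases eq_or_of_form_le hN.verticesSeparated hw hsv hlt (e.le.trans hle) with h | h
    · exact case0 h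
    · have hne : w ≠ vertex := fun h' => vertex_ne_vertex₁ (by
        rw [vertex₁, ← h', hQw])
      have h1 : Q * s = 1 := eq_one_of_fixed hQs hne
        (by rw [Equiv.Perm.mul_apply, hsw, hQw])
        (by rw [Equiv.Perm.mul_apply, h, vertex₁, ← Equiv.Perm.mul_apply, Q_mul_Q]; rfl)
      refine hQP 1 (one_mem _) ?_
      rw [eq_inv_of_mul_eq_one_right h1, Q_inv]; simp
  · have hRw : R w = w := by
      rw [be, left_eq_add, div_eq_zero_iff, mul_eq_zero] at heq'
      rw [R_apply_eq_iff]
      rcases heq' with (h | h) | h <;> linarith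
    have hwf := eq_faceCentre hQw hRw
    have h1 := hN.stabilizer_faceCentre hQs (by
      rw [← hwf, Equiv.Perm.mul_apply, hsw, hQw])
    obtain ⟨j, hj⟩ := Subgroup.mem_zpowers_iff.1 h1
    have h2 := conj_pow_of_conj_inv Q_mul_Q Q_conj_rotB (2 * j)
    have h3 : rotB ^ (2 * (2 * j)) = rotB ^ j := by
      have : rotB ^ (3 : ℤ) = 1 := by exact_mod_cast rotB_cube
      rw [show 2 * (2 * j) = j + 3 * j by ring, zpow_add, zpow_mul, this, one_zpow, mul_one]
    rw [h3, hj, Q_mul_Q_mul] at h2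
    refine hQP (rotB ^ (2 * j)) (triangleGroup_le (zpow_mem rotB_mem _)) ?_
    rw [← h2]; group

end Discrete

end

section

/-! ### Isometries of bounded displacement -/

open Filter Topology Polynomial in
/-- An isometry of the hyperbolic plane that moves all points by a bounded distance is the identity.
The distances from two points `w₁`, `w₂` to a point that tends to the real boundary point `x` have a
limiting ratio, which is a ratio of two quadratic polynomials in `x` with the roots `w₁`, `conj w₁`
and `w₂`, `conj w₂`; as the isometry fixes `x`, these polynomials determine the images of `w₁` and
`w₂`. -/
theorem eq_of_bounded_displacement {s : ℍ → ℍ} (hs : Isometry s) {κ : ℝ}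
    (hκ : ∀ z, dist (s z) z ≤ κ) (w : ℍ) : s w = w := by
  have hform := isometry_iff_form.1 hs
  set L : ℝ → ℝ → ℍ → ℝ := fun x y w => (x ^ 2 + y ^ 2) * cr w + cp w - 2 * x * cq w with hL
  have hLform : ∀ z w : ℍ, 2 * form z w * z.im = L z.re z.im w := by
    intro z w
    have := z.im_pos.ne'
    simp only [hL, form]
    have e1 : cp z * z.im = z.re ^ 2 + z.im ^ 2 := by unfold cp; field_simp
    have e2 : cq z * z.im = z.re := by unfold cq; field_simp
    have e3 : cr z * z.im = 1 := by unfold cr; field_simp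
    linear_combination cr w * e1 + cp w * e3 - 2 * cq w * e2
  have key : ∀ (x : ℝ) (w₁ w₂ : ℍ), L x 0 w₁ * L x 0 (s w₂) = L x 0 w₂ * L x 0 (s w₁) := by
    intro x w₁ w₂
    set z : ℕ → ℍ := fun n => ⟨⟨x, 1 / ((n : ℝ) + 1)⟩, by
      change 0 < 1 / ((n : ℝ) + 1); positivity⟩ with hz
    have hre : ∀ n, (z n).re = x := fun n => rfl
    have him : ∀ n, (z n).im = 1 / ((n : ℝ) + 1) := fun n => rfl
    have hlim : Tendsto (fun n => (z n).im) atTop (𝓝 0) := tendsto_one_div_add_atTop_nhds_zero_nat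
    have hd : Tendsto (fun n => dist (s (z n) : ℂ) (z n)) atTop (𝓝 0) := by
      have h1 : Tendsto (fun n => (z n).im * (Real.exp κ - 1)) atTop (𝓝 0) := by
        simpa using hlim.mul_const (Real.exp κ - 1)
      refine squeeze_zero (fun n => dist_nonneg) (fun n => ?_) h1
      refine (dist_coe_le _ _).trans ?_
      have := (z n).im_pos
      gcongr
      exact hκ _
    have hzc : Tendsto (fun n => (z n : ℂ)) atTop (𝓝 (x : ℂ)) := by
      have : (fun n => (z n : ℂ)) = fun n => (x : ℂ) + ((z n).im : ℂ) * Complex.I := by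
        funext n
        apply Complex.ext <;> simp [hre]
      rw [this]
      have h2 : Tendsto (fun n => ((z n).im : ℂ)) atTop (𝓝 ((0 : ℝ) : ℂ)) :=
        (Complex.continuous_ofReal.tendsto 0).comp hlim
      simpa using (h2.mul_const Complex.I).const_add (x : ℂ)
    have hsz : Tendsto (fun n => (s (z n) : ℂ)) atTop (𝓝 (x : ℂ)) :=
      hzc.congr_dist (by simpa [dist_comm] using hd)
    have hsre : Tendsto (fun n => (s (z n)).re) atTop (𝓝 x) :=
      (Complex.continuous_re.tendsto _).comp hsz
    have hsim : Tendsto (fun n => (s (z n)).im) atTop (𝓝 0) :=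
      (Complex.continuous_im.tendsto _).comp hsz
    have hLlim : ∀ (u v : ℕ → ℝ) (w : ℍ), Tendsto u atTop (𝓝 x) → Tendsto v atTop (𝓝 0) →
        Tendsto (fun n => L (u n) (v n) w) atTop (𝓝 (L x 0 w)) := by
      intro u v w hu hv
      exact ((((hu.pow 2).add (hv.pow 2)).mul_const _).add_const _).sub
        ((hu.const_mul 2).mul_const _)
    have e1 := (hLlim (fun n => (z n).re) _ w₁ (tendsto_const_nhds) hlim).mul
      (hLlim _ _ (s w₂) hsre hsim)
    have e2 := (hLlim (fun n => (z n).re) _ w₂ (tendsto_const_nhds) hlim).mul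
      (hLlim _ _ (s w₁) hsre hsim)
    refine tendsto_nhds_unique e1 (e2.congr fun n => ?_)
    rw [← hLform, ← hLform, ← hLform, ← hLform, hform, hform]
    ring
  -- pass from real to complex arguments of the polynomials
  set q : ℍ → ℝ[X] := fun w => C (cr w) * X ^ 2 + C (cp w) - C (2 * cq w) * X with hq
  have hqeval : ∀ (w : ℍ) (x : ℝ), (q w).eval x = L x 0 w := by
    intro w x
    simp only [hq, hL, eval_sub, eval_add, eval_mul, eval_C, eval_pow, eval_X]
    ring
  have hroot : ∀ u w : ℍ, aeval (u : ℂ) (q w) = 0 ↔ u = w := by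
    intro u w
    have e : aeval (u : ℂ) (q w) = ((u : ℂ) - w) * ((u : ℂ) - (starRingEnd ℂ) w) / (w.im : ℂ) := by
      have h0 : (w.im : ℂ) ≠ 0 := by exact_mod_cast w.im_pos.ne'
      simp only [hq, map_sub, map_add, map_mul, aeval_C, map_pow, aeval_X, Complex.coe_algebraMap,
        cp, cq, cr]
      push_cast
      field_simp
      have h1 : ((w : ℂ)) = w.re + w.im * Complex.I := by
        apply Complex.ext <;> simp
      have h2 : (starRingEnd ℂ) (w : ℂ) = w.re - w.im * Complex.I := by
        apply Complex.ext <;> simp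
      rw [h2, h1]
      linear_combination ((w.im : ℂ) ^ 2) * Complex.I_sq
    rw [e, div_eq_zero_iff, mul_eq_zero, sub_eq_zero, sub_eq_zero]
    constructor
    · rintro ((h | h) | h)
      · exact UpperHalfPlane.ext h
      · exfalso
        have := congrArg Complex.im h
        simp only [coe_im, Complex.conj_im] at this
        linarith [u.im_pos, w.im_pos]
      · exact absurd (by exact_mod_cast h) w.im_pos.ne'
    · rintro rfl; exact Or.inl (Or.inl rfl)
  obtain ⟨w', hw'⟩ : ∃ w' : ℍ, w ≠ w' := by
    by_cases h : w = vertex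
    · exact ⟨vertex₁, h ▸ vertex_ne_vertex₁⟩
    · exact ⟨vertex, h⟩
  have hp : q w * q (s w') = q w' * q (s w) := by
    refine Polynomial.funext fun x => ?_
    rw [eval_mul, eval_mul, hqeval, hqeval, hqeval, hqeval, key]
  have h1 := congrArg (aeval (w : ℂ)) hp
  rw [map_mul, map_mul, (hroot w w).2 rfl, zero_mul] at h1
  rcases mul_eq_zero.1 h1.symm with h | h
  · exact absurd ((hroot _ _).1 h) hw'
  · exact ((hroot _ _).1 h).symm

/-! ### Normalizers of cocompact discrete groups -/

/-- The isometries of the hyperbolic plane that normalize `M`. -/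
def isoNormalizer (M : Subgroup (Equiv.Perm ℍ)) : Subgroup (Equiv.Perm ℍ) where
  carrier := {t | Isometry t ∧ ∀ m, m ∈ M ↔ t * m * t⁻¹ ∈ M}
  one_mem' := ⟨isometry_id, fun m => by simp⟩
  mul_mem' := by
    rintro s t ⟨h1, h2⟩ ⟨h3, h4⟩
    refine ⟨h1.comp h3, fun m => ?_⟩
    rw [h4, h2]
    simp only [mul_assoc, mul_inv_rev]
  inv_mem' := by
    rintro s ⟨h1, h2⟩
    refine ⟨isometry_iff_form.2 fun z w => ?_, fun m => ?_⟩
    · rw [← isometry_iff_form.1 h1, perm_apply_inv, perm_apply_inv]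
    · rw [h2 (s⁻¹ * m * s⁻¹⁻¹)]
      simp [mul_assoc]

/-- A group of isometries with compact quotient, whose elements `≠ 1` have displacement at least
`τ`. -/
structure IsCocompactFree (M : Subgroup (Equiv.Perm ℍ)) (τ : ℝ) (D : Set ℍ) : Prop where
  pos : 0 < τ
  isometry : ∀ m ∈ M, Isometry m
  displacement : ∀ m ∈ M, m ≠ 1 → ∀ z, τ ≤ dist z (m z)
  isCompact : IsCompact D
  covers : ∀ z, ∃ m ∈ M, m z ∈ D

/-- If `s` normalizes a cocompact free group `M` and moves the points of a fundamental set by little,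
then `s = 1`: every point is moved by `s` about as by exactly one element of `M`, which does not
depend on the point, by connectedness. -/
theorem IsCocompactFree.eq_one {M : Subgroup (Equiv.Perm ℍ)} {τ : ℝ} {D : Set ℍ}
    (hM : IsCocompactFree M τ D) {s : Equiv.Perm ℍ} (hs : s ∈ isoNormalizer M)
    (hD : ∀ z ∈ D, dist (s z) z < τ / 2) : s = 1 := by
  obtain ⟨hiso, hnorm⟩ := hs
  have hex : ∀ z, ∃ m ∈ M, dist (s z) (m z) < τ / 2 := by
    intro z
    obtain ⟨m, hm, hz⟩ := hM.covers z
    have hn : s * m⁻¹ * s⁻¹ ∈ M := (hnorm _).1 (M.inv_mem hm)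
    refine ⟨s * m⁻¹ * s⁻¹ * m, M.mul_mem hn hm, ?_⟩
    have e : s z = (s * m⁻¹ * s⁻¹) (s (m z)) := by simp [Equiv.Perm.mul_apply, perm_inv_apply]
    rw [e, Equiv.Perm.mul_apply (s * m⁻¹ * s⁻¹) m, (hM.isometry _ hn).dist_eq]
    exact hD _ hz
  have hopen : ∀ m ∈ M, IsOpen {z | dist (s z) (m z) < τ / 2} := fun m hm =>
    isOpen_lt (hiso.continuous.dist (hM.isometry m hm).continuous) continuous_const
  have hcompl : {z | dist (s z) z < τ / 2}ᶜ =
      ⋃ m ∈ {m | m ∈ M ∧ m ≠ 1}, {z | dist (s z) (m z) < τ / 2} := by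
    ext z
    simp only [Set.mem_compl_iff, Set.mem_ofPred_eq, Set.mem_iUnion, exists_prop]
    constructor
    · intro h
      obtain ⟨m, hm, hz⟩ := hex z
      refine ⟨m, ⟨hm, ?_⟩, hz⟩
      rintro rfl
      exact h hz
    · rintro ⟨m, ⟨hm, h1⟩, hz⟩ h
      have h2 := hM.displacement m hm h1 z
      have h3 := dist_triangle_left z (m z) (s z)
      linarith
  have hclopen : IsClopen {z | dist (s z) z < τ / 2} := by
    refine ⟨⟨?_⟩, hopen 1 M.one_mem⟩
    rw [hcompl]
    exact isOpen_biUnion fun m hm => hopen m hm.1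
  have hne : {z | dist (s z) z < τ / 2}.Nonempty := by
    obtain ⟨m, -, hz⟩ := hM.covers vertex
    exact ⟨_, hD _ hz⟩
  have huniv := hclopen.eq_univ hne
  ext1 z
  refine eq_of_bounded_displacement hiso (κ := τ / 2) (fun z => ?_) z
  have hz : z ∈ {z | dist (s z) z < τ / 2} := huniv ▸ Set.mem_univ z
  exact hz.le

/-- The isometric normalizer of a cocompact free group is discrete: infinitely many of its elements
with bounded displacement would, by the pigeonhole principle, include two that nearly agree on a
finite net in the fundamental set. -/
theorem IsCocompactFree.isDiscreteOver {M : Subgroup (Equiv.Perm ℍ)} {τ : ℝ} {D : Set ℍ}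
    (hM : IsCocompactFree M τ D) (hΓ : TriangleGroup ≤ isoNormalizer M) :
    IsDiscreteOver (isoNormalizer M) where
  isometry := fun t ht => ht.1
  le := hΓ
  finite := by
    intro z w r
    by_contra hinf
    have hτ := hM.pos
    obtain ⟨F, -, hFfin, hF⟩ := hM.isCompact.finite_cover_balls (e := τ / 8) (by linarith)
    have : Fintype F := hFfin.fintype
    set S := {t : Equiv.Perm ℍ | t ∈ isoNormalizer M ∧ form (t z) w ≤ r} with hS
    -- the restrictions of the elements of `S` to the net lie in a compact set
    have hdist : ∀ t ∈ S, dist (t z) w ≤ r := by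
      rintro t ⟨-, h⟩
      rw [← cosh_dist_eq_form] at h
      have h1 := Real.self_le_sinh_iff.2 (dist_nonneg (x := t z) (y := w))
      have h2 := Real.sinh_lt_cosh (dist (t z) w)
      linarith
    set f : Equiv.Perm ℍ → (F → ℍ) := fun t x => t x with hf
    set Kc : Set (F → ℍ) := Set.univ.pi fun x => Metric.closedBall w (dist (x : ℍ) z + r) with hK
    have hKc : IsCompact Kc := isCompact_univ_pi fun x => isCompact_closedBall _ _
    have hmaps : ∀ t ∈ S, f t ∈ Kc := by
      rintro t ht x -
      rw [Metric.mem_closedBall]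
      have h1 := dist_triangle (t x) (t z) w
      rw [ht.1.1.dist_eq] at h1
      have h2 := hdist t ht
      simp only [hf]
      linarith
    obtain ⟨C, -, hCfin, hC⟩ := hKc.finite_cover_balls (e := τ / 16) (by linarith)
    have hch : ∀ t, ∃ c, t ∈ S → c ∈ C ∧ f t ∈ Metric.ball c (τ / 16) := by
      intro t
      by_cases ht : t ∈ S
      · have := hC (hmaps t ht)
        simp only [Set.mem_iUnion, exists_prop] at this
        obtain ⟨c, h⟩ := this
        exact ⟨c, fun _ => h⟩
      · exact ⟨fun _ => w, fun h => absurd h ht⟩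
    choose c hc using hch
    obtain ⟨t, ht, t', ht', hne, hcc⟩ := Set.Infinite.exists_ne_map_eq_of_mapsTo
      (s := S) (t := C) (f := c) hinf (fun t ht => (hc t ht).1) hCfin
    apply hne
    have hs : t⁻¹ * t' ∈ isoNormalizer M := Subgroup.mul_mem _ (Subgroup.inv_mem _ ht.1) ht'.1
    have h1 : t⁻¹ * t' = 1 := by
      refine hM.eq_one hs fun y hy => ?_
      have := hF hy
      simp only [Set.mem_iUnion, exists_prop, Metric.mem_ball] at this
      obtain ⟨x, hx, hxy⟩ := this
      have e1 : dist (t x) (c t ⟨x, hx⟩) < τ / 16 :=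
        (dist_le_pi_dist (f t) (c t) ⟨x, hx⟩).trans_lt (hc t ht).2
      have e2 : dist (t' x) (c t' ⟨x, hx⟩) < τ / 16 :=
        (dist_le_pi_dist (f t') (c t') ⟨x, hx⟩).trans_lt (hc t' ht').2
      rw [← hcc] at e2
      have e3 : dist ((t⁻¹ * t') y) y = dist (t' y) (t y) := by
        rw [← ht.1.1.dist_eq, Equiv.Perm.mul_apply, perm_apply_inv]
      have e4 : dist (t' y) (t' x) < τ / 8 := by rwa [ht'.1.1.dist_eq]
      have e5 : dist (t x) (t y) < τ / 8 := by rwa [ht.1.1.dist_eq, dist_comm]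
      have e6 := dist_triangle4 (t' y) (t' x) (t x) (t y)
      have e7 := dist_triangle_right (t' x) (t x) (c t ⟨x, hx⟩)
      rw [e3]
      linarith
    exact (inv_mul_eq_one.1 h1)

end

section

/-! ### The deck group of a Hurwitz map -/

theorem isometry_of_mem_triangleGroup {g : Equiv.Perm ℍ} (hg : g ∈ TriangleGroup) : Isometry g :=
  isometry_of_mem_extGroup (triangleGroup_le hg)

namespace HurwitzMap

variable {X : Type*} [TopologicalSpace X] [ChartedSpace ℂ X]

/-- The subgroup `M` of a Hurwitz map on `ℍ / M`, as a group of permutations of `ℍ`. -/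
def deckGroup (h : HurwitzMap X) : Subgroup (Equiv.Perm ℍ) :=
  h.mapSubgroup.map TriangleGroup.subtype

variable (h : HurwitzMap X)

theorem mem_deckGroup {m : Equiv.Perm ℍ} :
    m ∈ h.deckGroup ↔ ∃ hm : m ∈ TriangleGroup, (⟨m, hm⟩ : TriangleGroup) ∈ h.mapSubgroup := by
  unfold deckGroup
  rw [Subgroup.mem_map]
  constructor
  · rintro ⟨x, hx, rfl⟩
    exact ⟨x.2, hx⟩
  · rintro ⟨hm, hx⟩
    exact ⟨_, hx, rfl⟩

theorem deckGroup_le : h.deckGroup ≤ TriangleGroup := fun _ hm => (h.mem_deckGroup.1 hm).1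

theorem coe_mem_deckGroup {m : TriangleGroup} : (m : Equiv.Perm ℍ) ∈ h.deckGroup ↔
    m ∈ h.mapSubgroup := by
  rw [mem_deckGroup]
  exact ⟨fun ⟨_, h⟩ => h, fun h => ⟨m.2, h⟩⟩

theorem proj_eq_iff_deckGroup {z w : ℍ} : h.proj z = h.proj w ↔ ∃ m ∈ h.deckGroup, m z = w := by
  rw [h.proj_eq_iff]
  constructor
  · rintro ⟨m, hm, rfl⟩
    exact ⟨m, h.coe_mem_deckGroup.2 hm, rfl⟩
  · rintro ⟨m, hm, rfl⟩
    obtain ⟨hm1, hm2⟩ := h.mem_deckGroup.1 hm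
    exact ⟨_, hm2, rfl⟩

theorem proj_apply {m : Equiv.Perm ℍ} (hm : m ∈ h.deckGroup) (z : ℍ) : h.proj (m z) = h.proj z :=
  (h.proj_eq_iff_deckGroup.2 ⟨m, hm, rfl⟩).symm

theorem isometry_of_mem {m : Equiv.Perm ℍ} (hm : m ∈ h.deckGroup) : Isometry m :=
  isometry_of_mem_triangleGroup (h.deckGroup_le hm)

theorem conj_mem_deckGroup {g m : Equiv.Perm ℍ} (hg : g ∈ TriangleGroup) (hm : m ∈ h.deckGroup) :
    g * m * g⁻¹ ∈ h.deckGroup := by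
  obtain ⟨hm1, hm2⟩ := h.mem_deckGroup.1 hm
  exact h.coe_mem_deckGroup.2 (h.normal.conj_mem _ hm2 ⟨g, hg⟩)

theorem triangleGroup_le_isoNormalizer : TriangleGroup ≤ isoNormalizer h.deckGroup := by
  intro g hg
  refine ⟨isometry_of_mem_triangleGroup hg, fun m => ⟨h.conj_mem_deckGroup hg, fun hm => ?_⟩⟩
  have := h.conj_mem_deckGroup (inv_mem hg) hm
  simpa [mul_assoc] using this

theorem isLocalHomeomorph : IsLocalHomeomorph h.proj := h.isLocalDiffeomorph.isLocalHomeomorph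

theorem continuous : Continuous h.proj := h.isLocalHomeomorph.continuous

theorem exists_injOn_ball (z : ℍ) : ∃ ε > 0, Set.InjOn h.proj (Metric.ball z ε) := by
  obtain ⟨e, hz, he⟩ := h.isLocalHomeomorph z
  obtain ⟨ε, hε, hb⟩ := Metric.isOpen_iff.1 e.open_source z hz
  refine ⟨ε, hε, fun x hx y hy hxy => e.injOn (hb hx) (hb hy) ?_⟩
  rwa [he] at hxy

/-- The deck group acts freely, because the projection is locally injective. -/
theorem eq_one_of_mem_of_fixed {m : Equiv.Perm ℍ} (hm : m ∈ h.deckGroup) {z : ℍ} (hz : m z = z) :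
    m = 1 := by
  obtain ⟨ε, hε, hinj⟩ := h.exists_injOn_ball z
  obtain ⟨w, hw, hne⟩ : ∃ w ∈ Metric.ball z ε, w ≠ z := by
    have h1 : Metric.ball z ε ∩ {z}ᶜ ∈ nhdsWithin z {z}ᶜ :=
      Filter.inter_mem (mem_nhdsWithin_of_mem_nhds (Metric.ball_mem_nhds z hε)) self_mem_nhdsWithin
    obtain ⟨w, hw⟩ := Filter.nonempty_of_mem h1
    exact ⟨w, hw.1, hw.2⟩
  have hmw : m w ∈ Metric.ball z ε := by
    rw [Metric.mem_ball, ← hz, (h.isometry_of_mem hm).dist_eq]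
    exact hw
  exact eq_one_of_fixed (h.deckGroup_le hm) hne.symm hz (hinj hmw hw (h.proj_apply hm w))

theorem exists_isCocompactFree [CompactSpace X] :
    ∃ τ D, IsCocompactFree h.deckGroup τ D := by
  choose ε hε hinj using h.exists_injOn_ball
  have hopen : IsOpenMap h.proj := h.isLocalHomeomorph.isOpenMap
  obtain ⟨F, hF⟩ := isCompact_univ.elim_finite_subcover
    (fun z => h.proj '' Metric.ball z (ε z / 2)) (fun z => hopen _ Metric.isOpen_ball) (by
      intro x _
      obtain ⟨z, rfl⟩ := h.surjective x
      exact Set.mem_iUnion.2 ⟨z, z, Metric.mem_ball_self (half_pos (hε z)), rfl⟩)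
  have hcov : ∀ z, ∃ i ∈ F, ∃ m ∈ h.deckGroup, m z ∈ Metric.ball i (ε i / 2) := by
    intro z
    have h1 := hF (Set.mem_univ (h.proj z))
    simp only [Set.mem_iUnion, exists_prop] at h1
    obtain ⟨i, hi, w, hw, hwz⟩ := h1
    obtain ⟨m, hm, rfl⟩ := h.proj_eq_iff_deckGroup.1 hwz.symm
    exact ⟨i, hi, m, hm, hw⟩
  obtain ⟨i₀, hi₀, -⟩ := hcov vertex
  obtain ⟨j, hj, hmin⟩ := F.exists_min_image ε ⟨i₀, hi₀⟩
  refine ⟨ε j / 2, ⋃ i ∈ F, Metric.closedBall i (ε i / 2), half_pos (hε j),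
    fun m hm => h.isometry_of_mem hm, ?_, F.isCompact_biUnion fun i _ => isCompact_closedBall _ _, ?_⟩
  · intro m hm hm1 z
    by_contra! hlt
    obtain ⟨i, hi, g, hg, hz⟩ := hcov z
    have hn : g * m * g⁻¹ ∈ h.deckGroup :=
      Subgroup.mul_mem _ (Subgroup.mul_mem _ hg hm) (Subgroup.inv_mem _ hg)
    have h1 : (g * m * g⁻¹) (g z) = g (m z) := by simp [Equiv.Perm.mul_apply, perm_inv_apply]
    have h2 : g (m z) ∈ Metric.ball i (ε i) := by
      rw [Metric.mem_ball] at hz ⊢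
      have h3 := dist_triangle_left (g (m z)) i (g z)
      rw [(h.isometry_of_mem hg).dist_eq] at h3
      have := hmin i hi
      linarith
    have h3 : g z ∈ Metric.ball i (ε i) := Metric.ball_subset_ball (by linarith [hε i]) hz
    have h4 : (g * m * g⁻¹) (g z) = g z := by
      rw [h1]
      refine hinj i h2 h3 ?_
      rw [h.proj_apply hg, h.proj_apply hg, h.proj_apply hm]
    have h5 := h.eq_one_of_mem_of_fixed hn h4
    exact hm1 (conj_eq_one_iff.1 h5)
  · intro z
    obtain ⟨i, hi, m, hm, hz⟩ := hcov z
    exact ⟨m, hm, Set.mem_biUnion hi (Metric.ball_subset_closedBall hz)⟩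

theorem isDiscreteOver [CompactSpace X] : IsDiscreteOver (isoNormalizer h.deckGroup) := by
  obtain ⟨τ, D, hM⟩ := h.exists_isCocompactFree
  exact hM.isDiscreteOver h.triangleGroup_le_isoNormalizer

theorem isCoveringMap [CompactSpace X] : IsCoveringMap h.proj := by
  obtain ⟨τ, D, hM⟩ := h.exists_isCocompactFree
  have : ContinuousConstSMul h.deckGroup ℍ := ⟨fun m => (h.isometry_of_mem m.2).continuous⟩
  suffices IsQuotientCoveringMap h.proj h.deckGroup from this.isCoveringMap
  refine
    { toIsQuotientMap :=
        h.isLocalHomeomorph.isOpenMap.isQuotientMap h.continuous h.surjective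
      apply_eq_iff_mem_orbit := ?_
      disjoint := fun z => ⟨Metric.ball z (τ / 2), Metric.ball_mem_nhds z (half_pos hM.pos), ?_⟩ }
  · intro z w
    rw [eq_comm, h.proj_eq_iff_deckGroup, MulAction.mem_orbit_iff]
    exact ⟨fun ⟨m, hm, hz⟩ => ⟨⟨m, hm⟩, hz⟩, fun ⟨m, hz⟩ => ⟨m, m.2, hz⟩⟩
  · rintro m ⟨_, ⟨w, hw, rfl⟩, hw'⟩
    by_contra hne
    have h1 := hM.displacement m m.2 (fun h => hne (Subtype.ext h)) w
    have h2 : dist ((m : Equiv.Perm ℍ) w) z < τ / 2 := hw'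
    have h3 := dist_triangle_right w ((m : Equiv.Perm ℍ) w) z
    have h4 : dist w z < τ / 2 := hw
    linarith

/-- Two continuous lifts of the same map that agree at one point are equal. -/
theorem eq_of_proj_eq [CompactSpace X] {A : Type*} [TopologicalSpace A] [PreconnectedSpace A]
    {f g : A → ℍ} (hf : Continuous f) (hg : Continuous g) (hfg : ∀ z, h.proj (f z) = h.proj (g z))
    (a : A) (ha : f a = g a) : f = g :=
  h.isCoveringMap.eq_of_comp_eq hf hg (funext hfg) a ha

theorem mem_deckGroup_of_proj_eq [CompactSpace X] {e : Equiv.Perm ℍ} (he : Continuous e)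
    (hp : ∀ z, h.proj (e z) = h.proj z) : e ∈ h.deckGroup := by
  obtain ⟨m, hm, hz⟩ := h.proj_eq_iff_deckGroup.1 (hp vertex).symm
  have : ⇑m = ⇑e := h.eq_of_proj_eq (h.isometry_of_mem hm).continuous he
    (fun z => by rw [h.proj_apply hm, hp]) _ hz
  rwa [← DFunLike.coe_injective this]

/-- A homeomorphism of `X` lifts to a homeomorphism between the universal coverings that belong to
two Hurwitz maps on `X`. -/
theorem exists_lift [CompactSpace X] (h' : HurwitzMap X) {S S' : X → X} (hS : Continuous S)
    (hS' : Continuous S') (hSS' : ∀ x, S' (S x) = x) (hS'S : ∀ x, S (S' x) = x) {z₀ w₀ : ℍ}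
    (h0 : h'.proj w₀ = S (h.proj z₀)) :
    ∃ t : Equiv.Perm ℍ, Continuous t ∧ Continuous t.symm ∧ t z₀ = w₀ ∧
      (∀ z, h'.proj (t z) = S (h.proj z)) ∧ ∀ z, h.proj (t.symm z) = S' (h'.proj z) := by
  obtain ⟨F, ⟨hF0, hF⟩, -⟩ := h'.isCoveringMap.existsUnique_continuousMap_lifts
    ⟨S ∘ h.proj, hS.comp h.continuous⟩ z₀ w₀ h0
  obtain ⟨G, ⟨hG0, hG⟩, -⟩ := h.isCoveringMap.existsUnique_continuousMap_lifts
    ⟨S' ∘ h'.proj, hS'.comp h'.continuous⟩ w₀ z₀ (by simp [h0, hSS'])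
  have hF' : ∀ z, h'.proj (F z) = S (h.proj z) := congrFun hF
  have hG' : ∀ z, h.proj (G z) = S' (h'.proj z) := congrFun hG
  have hGF : G ∘ F = id := h.eq_of_proj_eq (G.continuous.comp F.continuous) continuous_id
    (fun z => by simp [hF', hG', hSS']) z₀ (by simp [hF0, hG0])
  have hFG : F ∘ G = id := h'.eq_of_proj_eq (F.continuous.comp G.continuous) continuous_id
    (fun z => by simp [hF', hG', hS'S]) w₀ (by simp [hF0, hG0])
  exact ⟨⟨F, G, congrFun hGF, congrFun hFG⟩, F.continuous, G.continuous, hF0, hF', hG'⟩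

theorem mem_iff_conj_mem [CompactSpace X] (h' : HurwitzMap X) {S S' : X → X}
    (hSS' : ∀ x, S' (S x) = x) (hS'S : ∀ x, S (S' x) = x) {t : Equiv.Perm ℍ}
    (ht : Continuous t) (ht' : Continuous t.symm) (h1 : ∀ z, h'.proj (t z) = S (h.proj z))
    (h2 : ∀ z, h.proj (t.symm z) = S' (h'.proj z)) (m : Equiv.Perm ℍ) :
    m ∈ h.deckGroup ↔ t * m * t⁻¹ ∈ h'.deckGroup := by
  constructor
  · intro hm
    refine h'.mem_deckGroup_of_proj_eq (ht.comp ((h.isometry_of_mem hm).continuous.comp ht')) ?_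
    intro z
    change h'.proj (t (m (t.symm z))) = _
    rw [h1, h.proj_apply hm, h2, hS'S]
  · intro hm
    have hc : Continuous m := by
      have := ht'.comp ((h'.isometry_of_mem hm).continuous.comp ht)
      convert this using 1
      funext z
      simp
    refine h.mem_deckGroup_of_proj_eq hc fun z => ?_
    have h3 := h'.proj_apply hm (t z)
    rw [Equiv.Perm.mul_apply, perm_inv_apply, Equiv.Perm.mul_apply, h1, h1] at h3
    rw [← hSS' (h.proj (m z)), h3, hSS']

end HurwitzMap

end

section

/-! ### The Schwarz–Pick lemma -/

/-- The inverse Cayley transform of the unit disc onto the upper half plane, with centre `w`. -/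
def invCayley (w : ℍ) (ζ : ℂ) : ℂ := (w - (starRingEnd ℂ) w * ζ) / (1 - ζ)

theorem invCayley_im (w : ℍ) {ζ : ℂ} (h : ζ ≠ 1) :
    (invCayley w ζ).im = w.im * (1 - ‖ζ‖ ^ 2) / Complex.normSq (1 - ζ) := by
  have h1 : Complex.normSq (1 - ζ) ≠ 0 := by
    rw [ne_eq, Complex.normSq_eq_zero, sub_eq_zero]
    exact h.symm
  rw [invCayley, Complex.div_im, Complex.sq_norm]
  field_simp
  simp only [Complex.normSq_apply, Complex.sub_im, Complex.sub_re, Complex.mul_im, Complex.mul_re,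
    Complex.conj_re, Complex.conj_im, Complex.one_re, Complex.one_im, coe_re, coe_im]
  ring

theorem dist_div_dist_conj_lt_one (z w : ℍ) :
    dist (z : ℂ) w / dist (z : ℂ) ((starRingEnd ℂ) w) < 1 := by
  rw [← tanh_half_dist]
  exact Real.tanh_lt_one _

/-- A holomorphic self-map of the upper half plane does not increase distances. -/
theorem dist_le_dist_of_holomorphic {f : ℍ → ℍ}
    (hf : ∀ z : ℍ, DifferentiableAt ℂ (fun z => (f (ofComplex z) : ℂ)) z) (z w : ℍ) :
    dist (f z) (f w) ≤ dist z w := by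
  have hsub : ∀ z w : ℍ, (z : ℂ) - (starRingEnd ℂ) w ≠ 0 := by
    intro z w h0
    have := congrArg Complex.im h0
    simp only [Complex.sub_im, coe_im, Complex.conj_im, Complex.zero_im] at this
    linarith [z.im_pos, w.im_pos]
  have hone : ∀ ζ ∈ Metric.ball (0 : ℂ) 1, ζ ≠ 1 := by
    rintro ζ hζ rfl
    simp at hζ
  have hpos : ∀ ζ ∈ Metric.ball (0 : ℂ) 1, 0 < (invCayley w ζ).im := by
    intro ζ hζ
    rw [invCayley_im w (hone ζ hζ)]
    have h1 : ‖ζ‖ < 1 := by simpa using hζ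
    have h2 : 0 < Complex.normSq (1 - ζ) :=
      Complex.normSq_pos.2 (sub_ne_zero.2 (hone ζ hζ).symm)
    have := w.im_pos
    have h3 : 0 < 1 - ‖ζ‖ ^ 2 := by nlinarith [norm_nonneg ζ]
    positivity
  set g : ℂ → ℂ := fun ζ => f (ofComplex (invCayley w ζ)) with hg
  set F : ℂ → ℂ := fun ζ => (g ζ - f w) / (g ζ - (starRingEnd ℂ) (f w)) with hF
  have hdiff : DifferentiableOn ℂ F (Metric.ball 0 1) := by
    intro ζ hζ
    have h1 : DifferentiableAt ℂ (invCayley w) ζ := by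
      unfold invCayley
      refine DifferentiableAt.div (by fun_prop) (by fun_prop) (sub_ne_zero.2 (hone ζ hζ).symm)
    have h2 : DifferentiableAt ℂ g ζ :=
      DifferentiableAt.comp (g := fun z => (f (ofComplex z) : ℂ)) ζ
        (hf ⟨invCayley w ζ, hpos ζ hζ⟩) h1
    refine (DifferentiableAt.div (h2.sub_const _) (h2.sub_const _) ?_).differentiableWithinAt
    exact hsub _ _
  have hnorm : ∀ ζ, ‖F ζ‖ < 1 := by
    intro ζ
    have := dist_div_dist_conj_lt_one (f (ofComplex (invCayley w ζ))) (f w)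
    rwa [dist_eq_norm, dist_eq_norm, ← norm_div] at this
  have hw : invCayley w 0 = w := by simp [invCayley]
  have hF0 : F 0 = 0 := by simp [hF, hg, hw, ofComplex_apply]
  set ζ : ℂ := ((z : ℂ) - w) / ((z : ℂ) - (starRingEnd ℂ) w) with hζ
  have hζ1 : ‖ζ‖ < 1 := by
    have := dist_div_dist_conj_lt_one z w
    rwa [dist_eq_norm, dist_eq_norm, ← norm_div] at this
  have hz : invCayley w ζ = z := by
    have h1 := hsub z w
    have h2 := hsub w w
    have h3 : 1 - ζ ≠ 0 := sub_ne_zero.2 (hone ζ (by simpa using hζ1)).symm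
    rw [invCayley, div_eq_iff h3, hζ]
    field_simp
    ring
  have h1 := Complex.norm_le_norm_of_mapsTo_ball hdiff
    (fun ζ _ => by simpa using (hnorm ζ).le) hF0 hζ1
  have h2 : F ζ = ((f z : ℂ) - f w) / ((f z : ℂ) - (starRingEnd ℂ) (f w)) := by
    simp [hF, hg, hz, ofComplex_apply]
  rw [h2, hζ, norm_div, norm_div, ← dist_eq_norm, ← dist_eq_norm, ← dist_eq_norm, ← dist_eq_norm,
    ← tanh_half_dist, ← tanh_half_dist] at h1
  have h3 := Real.artanh_le_artanh (Real.neg_one_lt_tanh _) (Real.tanh_lt_one _) h1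
  rw [Real.artanh_tanh, Real.artanh_tanh] at h3
  linarith

theorem coe_P (z : ℍ) : (P z : ℂ) = -(starRingEnd ℂ) (z : ℂ) := by
  let w : ℍ := ⟨-(starRingEnd ℂ) (z : ℂ), by simpa using z.im_pos⟩
  have hre : w.re = -z.re := by
    change (-(starRingEnd ℂ) (z : ℂ)).re = _
    simp
  have him : w.im = z.im := by
    change (-(starRingEnd ℂ) (z : ℂ)).im = _
    simp
  have h : P z = w := by
    refine coords_ext ?_ ?_
    · rw [(coords_P z).2.1, cq, cq, hre, him]; ring
    · rw [(coords_P z).2.2, cr, cr, him]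
  rw [h]

theorem deriv_eq_zero_of_differentiableAt_conj {f : ℂ → ℂ} {z : ℂ} (h : DifferentiableAt ℂ f z)
    (h' : DifferentiableAt ℂ (fun ζ => (starRingEnd ℂ) (f ζ)) z) : deriv f z = 0 := by
  have h1 : HasFDerivAt (fun ζ => (starRingEnd ℂ) (f ζ)) ((Complex.conjCLE : ℂ →L[ℝ] ℂ).comp
      ((fderiv ℂ f z).restrictScalars ℝ)) z :=
    (Complex.conjCLE : ℂ →L[ℝ] ℂ).hasFDerivAt.comp z (h.hasFDerivAt.restrictScalars ℝ)
  have h2 := h1.unique (h'.hasFDerivAt.restrictScalars ℝ)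
  have e1 := DFunLike.congr_fun h2 1
  have e2 := DFunLike.congr_fun h2 Complex.I
  have e3 : ∀ g : ℂ → ℂ, fderiv ℂ g z Complex.I = Complex.I * fderiv ℂ g z 1 := by
    intro g
    simp
  simp only [ContinuousLinearMap.comp_apply, ContinuousLinearMap.coe_restrictScalars', e3] at e1 e2
  rw [← e1] at e2
  have e4 : (starRingEnd ℂ) (Complex.I * fderiv ℂ f z 1)
      = Complex.I * (starRingEnd ℂ) (fderiv ℂ f z 1) := e2
  rw [map_mul, Complex.conj_I] at e4
  have e5 : Complex.I * (starRingEnd ℂ) (fderiv ℂ f z 1) = 0 := by linear_combination -e4 / 2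
  rcases mul_eq_zero.1 e5 with h | h
  · exact absurd h Complex.I_ne_zero
  · rw [← fderiv_apply_one_eq_deriv]
    simpa using h

theorem sq_mem_triangleGroup {g : Equiv.Perm ℍ} (hg : g ∈ ExtGroup) : g * g ∈ TriangleGroup := by
  rcases mem_or_mul_mem hg with h | h
  · exact mul_mem h h
  · have h1 := mul_mem (conj_mem_triangleGroup P_mem h) h
    rw [P_inv] at h1
    convert h1 using 1
    simp only [mul_assoc, P_mul_P_mul]

/-! ### Lifts of conformal and anticonformal maps -/

namespace HurwitzMap

variable {X : Type*} [TopologicalSpace X] [ChartedSpace ℂ X]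

/-- A lift of the identity between the universal coverings of two Hurwitz maps is holomorphic. -/
theorem differentiableAt_of_proj_eq (h h' : HurwitzMap X) {F : ℍ → ℍ} (hF : Continuous F)
    (hp : ∀ z, h'.proj (F z) = h.proj z) (z : ℍ) :
    DifferentiableAt ℂ (fun ζ => (F (ofComplex ζ) : ℂ)) z := by
  have hl := h'.isLocalDiffeomorph (F z)
  refine (mdifferentiableAt_iff (f := fun w => (F w : ℂ))).1 ?_
  refine (mdifferentiable_coe (F z)).comp z ?_
  have h1 : MDifferentiableAt 𝓘(ℂ) 𝓘(ℂ) (hl.localInverse ∘ h.proj) z := by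
    refine MDifferentiableAt.comp z ?_ ((h.isLocalDiffeomorph z).mdifferentiableAt (by simp))
    rw [← hp]
    exact hl.localInverse_mdifferentiableAt (by simp)
  refine h1.congr_of_eventuallyEq ?_
  filter_upwards [hF.continuousAt.preimage_mem_nhds
    (hl.localInverse.open_target.mem_nhds hl.localInverse_mem_target)] with w hw
  rw [Function.comp_apply, ← hp, hl.localInverse_left_inv hw]

/-- A lift of an antiholomorphic map is antiholomorphic. -/
theorem differentiableAt_conj_of_isAntiholomorphic [IsManifold 𝓘(ℂ) ω X] (h h' : HurwitzMap X)
    {T : X → X} (hT : IsAntiholomorphic T) {t : ℍ → ℍ} (ht : Continuous t)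
    (hp : ∀ z, h'.proj (t z) = T (h.proj z)) (z : ℍ) :
    DifferentiableAt ℂ (fun ζ => (starRingEnd ℂ) (t (ofComplex ζ) : ℂ)) z := by
  have : IsManifold 𝓘(ℂ) 1 X := IsManifold.of_le (n := ω) le_top
  have hl := h'.isLocalDiffeomorph (t z)
  set c₀ := chartAt ℂ (h.proj z) with hc₀
  set c₁ := chartAt ℂ (T (h.proj z)) with hc₁
  have hv : DifferentiableAt ℂ (fun ζ => c₀ (h.proj (ofComplex ζ))) z := by
    refine (mdifferentiableAt_iff (f := fun w => c₀ (h.proj w))).1 ?_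
    exact ((mdifferentiable_chart (h.proj z)).mdifferentiableAt (mem_chart_source ℂ _)).comp z
      ((h.isLocalDiffeomorph z).mdifferentiableAt (by simp))
  have hG := hT.2 (h.proj z)
  have hψ : DifferentiableAt ℂ (fun ζ => (hl.localInverse (c₁.symm ζ) : ℂ))
      (c₁ (T (h.proj z))) := by
    refine mdifferentiableAt_iff_differentiableAt.1 ?_
    have h1 : MDifferentiableAt 𝓘(ℂ) 𝓘(ℂ) c₁.symm (c₁ (T (h.proj z))) :=
      (mdifferentiable_chart (T (h.proj z))).mdifferentiableAt_symm (mem_chart_target ℂ _)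
    have h2 : c₁.symm (c₁ (T (h.proj z))) = h'.proj (t z) := by
      rw [c₁.left_inv (mem_chart_source ℂ _), hp]
    have h3 : MDifferentiableAt 𝓘(ℂ) 𝓘(ℂ) hl.localInverse (c₁.symm (c₁ (T (h.proj z)))) := by
      rw [h2]
      exact hl.localInverse_mdifferentiableAt (by simp)
    exact (mdifferentiable_coe _).comp _ (h3.comp _ h1)
  have hψ' := DifferentiableAt.conj_conj hψ
  have hz : c₀ (h.proj (ofComplex (z : ℂ))) = c₀ (h.proj z) := by rw [ofComplex_apply]
  have hGv : DifferentiableAt ℂ (fun ζ => (starRingEnd ℂ)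
      (c₁ (T (c₀.symm (c₀ (h.proj (ofComplex ζ))))))) z :=
    DifferentiableAt.comp (g := fun ζ => (starRingEnd ℂ) (c₁ (T (c₀.symm ζ)))) (z : ℂ)
      (by rw [hz]; exact hG) hv
  have hall := DifferentiableAt.comp (g := (starRingEnd ℂ) ∘
    (fun ζ => (hl.localInverse (c₁.symm ζ) : ℂ)) ∘ (starRingEnd ℂ)) (z : ℂ) (by
      rw [hz, c₀.left_inv (mem_chart_source ℂ _)]
      exact hψ') hGv
  refine hall.congr_of_eventuallyEq ?_
  have hcont : ContinuousAt (fun ζ : ℂ => (ofComplex ζ : ℍ)) z :=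
    (mdifferentiableAt_ofComplex z.im_pos).continuousAt
  have n1 : ∀ᶠ w in nhds z, h.proj w ∈ c₀.source :=
    h.continuous.continuousAt.preimage_mem_nhds (c₀.open_source.mem_nhds (mem_chart_source ℂ _))
  have n2 : ∀ᶠ w in nhds z, T (h.proj w) ∈ c₁.source :=
    (hT.1.comp h.continuous).continuousAt.preimage_mem_nhds
      (c₁.open_source.mem_nhds (mem_chart_source ℂ _))
  have n3 : ∀ᶠ w in nhds z, t w ∈ hl.localInverse.target :=
    ht.continuousAt.preimage_mem_nhds
      (hl.localInverse.open_target.mem_nhds hl.localInverse_mem_target)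
  have n := n1.and (n2.and n3)
  have hcont' : Filter.Tendsto (fun ζ : ℂ => (ofComplex ζ : ℍ)) (nhds (z : ℂ)) (nhds z) := by
    have := hcont.tendsto
    rwa [ofComplex_apply] at this
  filter_upwards [hcont'.eventually n] with ζ hζ
  obtain ⟨m1, m2, m3⟩ := hζ
  simp only [Function.comp_apply, Complex.conj_conj]
  rw [c₀.left_inv m1, c₁.left_inv m2, ← hp, hl.localInverse_left_inv m3]

/-- A lift of the identity between the universal coverings of two Hurwitz maps on the same surface
conjugates the triangle group into itself: it maps it into the isometric normalizer of the second
deck group, which is contained in the extended triangle group, and the triangle group is generated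
by elements of odd order. -/
theorem conj_mem_of_proj_eq [CompactSpace X] (h h' : HurwitzMap X) {φ : Equiv.Perm ℍ}
    (hφ : Isometry φ) (hφ' : Isometry φ.symm)
    (hM : ∀ m, m ∈ h.deckGroup ↔ φ * m * φ⁻¹ ∈ h'.deckGroup) {x : Equiv.Perm ℍ}
    (hx : x ∈ TriangleGroup) : φ * x * φ⁻¹ ∈ TriangleGroup := by
  have hext : ∀ x ∈ TriangleGroup, φ * x * φ⁻¹ ∈ ExtGroup := by
    intro x hx
    refine h'.isDiscreteOver.le_extGroup ⟨hφ.comp ((isometry_of_mem_triangleGroup hx).comp hφ'), ?_⟩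
    intro m
    have e1 := hM (φ⁻¹ * m * φ)
    have e2 := (h.triangleGroup_le_isoNormalizer hx).2 (φ⁻¹ * m * φ)
    have e3 := hM (x * (φ⁻¹ * m * φ) * x⁻¹)
    have e4 : φ * (φ⁻¹ * m * φ) * φ⁻¹ = m := by group
    rw [e4] at e1
    rw [← e1, e2, e3]
    simp only [mul_inv_rev, inv_inv, mul_assoc]
  have hodd : ∀ x ∈ TriangleGroup, ∀ k : ℕ, x ^ (2 * k) = x → φ * x * φ⁻¹ ∈ TriangleGroup := by
    intro x hx k hk
    have := pow_mem (sq_mem_triangleGroup (hext x hx)) k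
    rwa [← pow_two, ← pow_mul, conj_pow, hk] at this
  have hB := hodd rotB rotB_mem 2 (by
    rw [show 2 * 2 = 3 + 1 by rfl, pow_succ, rotB_cube, one_mul])
  have hC := hodd rotC rotC_mem 4 (by
    rw [show 2 * 4 = 7 + 1 by rfl, pow_succ, rotC_pow_seven, one_mul])
  have hA : φ * rotA * φ⁻¹ ∈ TriangleGroup := by
    have e1 : rotA = (rotB * rotC)⁻¹ := by
      rw [eq_inv_iff_mul_eq_one, ← mul_assoc, rotA_mul_rotB_mul_rotC]
    have e2 : φ * rotA * φ⁻¹ = ((φ * rotB * φ⁻¹) * (φ * rotC * φ⁻¹))⁻¹ := by rw [e1]; group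
    rw [e2]
    exact inv_mem (mul_mem hB hC)
  have hle : TriangleGroup ≤ TriangleGroup.comap (MulAut.conj φ).toMonoidHom := by
    unfold TriangleGroup
    rw [Subgroup.closure_le]
    rintro y (rfl | rfl | rfl)
    · exact hA
    · exact hB
    · exact hC
  exact hle hx

/-- The groups `Γ / M` that belong to two Hurwitz maps on the same surface are isomorphic. -/
theorem nonempty_quotient_mulEquiv [CompactSpace X] (h h' : HurwitzMap X) :
    Nonempty ((TriangleGroup ⧸ h.mapSubgroup) ≃* (TriangleGroup ⧸ h'.mapSubgroup)) := by
  obtain ⟨w, hw⟩ := h'.surjective (h.proj vertex)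
  obtain ⟨φ, hc, hc', -, h1, h2⟩ := h.exists_lift h' (S := id) (S' := id) continuous_id
    continuous_id (fun _ => rfl) (fun _ => rfl) hw
  have d1 := fun z w => dist_le_dist_of_holomorphic (h.differentiableAt_of_proj_eq h' hc h1) z w
  have d2 := fun z w => dist_le_dist_of_holomorphic (h'.differentiableAt_of_proj_eq h hc' h2) z w
  have i1 : Isometry φ := Isometry.of_dist_eq fun z w => le_antisymm (d1 z w) (by
    simpa using d2 (φ z) (φ w))
  have i2 : Isometry φ.symm := Isometry.of_dist_eq fun z w => le_antisymm (d2 z w) (by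
    simpa using d1 (φ.symm z) (φ.symm w))
  have hM := h.mem_iff_conj_mem h' (S := id) (S' := id) (fun _ => rfl) (fun _ => rfl) hc hc' h1 h2
  have hM' := h'.mem_iff_conj_mem h (S := id) (S' := id) (fun _ => rfl) (fun _ => rfl) hc' hc h2 h1
  have c1 := fun x hx => h.conj_mem_of_proj_eq h' i1 i2 hM (x := x) hx
  have c2 := fun x hx => h'.conj_mem_of_proj_eq h (φ := φ⁻¹) i2 i1 hM' (x := x) hx
  let e : TriangleGroup ≃* TriangleGroup :=
    { toFun := fun x => ⟨φ * x * φ⁻¹, c1 x x.2⟩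
      invFun := fun x => ⟨φ⁻¹ * x * φ, by simpa using c2 x x.2⟩
      left_inv := fun x => Subtype.ext (by simp [mul_assoc])
      right_inv := fun x => Subtype.ext (by simp [mul_assoc])
      map_mul' := fun x y => Subtype.ext (by simp [mul_assoc]) }
  refine ⟨QuotientGroup.congr _ _ e ?_⟩
  ext x
  rw [Subgroup.mem_map]
  constructor
  · rintro ⟨y, hy, rfl⟩
    exact h'.coe_mem_deckGroup.1 ((hM y).1 (h.coe_mem_deckGroup.2 hy))
  · intro hx
    refine ⟨e.symm x, h.coe_mem_deckGroup.1 ((hM _).2 ?_), e.apply_symm_apply x⟩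
    change φ * (φ⁻¹ * x * φ) * φ⁻¹ ∈ _
    rw [show φ * (φ⁻¹ * x * φ) * φ⁻¹ = x by group]
    exact h'.coe_mem_deckGroup.2 hx

theorem dist_le_dist_of_isAntiholomorphic [IsManifold 𝓘(ℂ) ω X] (h : HurwitzMap X)
    {T : X → X} (hT : IsAntiholomorphic T) {t : ℍ → ℍ} (ht : Continuous t)
    (hp : ∀ z, h.proj (t z) = T (h.proj z)) (z w : ℍ) : dist (t z) (t w) ≤ dist z w := by
  have hd : ∀ z : ℍ, DifferentiableAt ℂ (fun ζ => (P (t (ofComplex ζ)) : ℂ)) z := by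
    intro z
    simp only [coe_P]
    exact (h.differentiableAt_conj_of_isAntiholomorphic h hT ht hp z).neg
  have := dist_le_dist_of_holomorphic (f := fun z => P (t z)) hd z w
  rwa [(isometry_of_mem_extGroup P_mem).dist_eq] at this

/-- A lift of an antiholomorphic map does not belong to the triangle group, whose elements are
holomorphic. -/
theorem notMem_triangleGroup_of_isAntiholomorphic [IsManifold 𝓘(ℂ) ω X] (h : HurwitzMap X)
    {T : X → X} (hT : IsAntiholomorphic T) {t : Equiv.Perm ℍ} (ht : Continuous t)
    (hp : ∀ z, h.proj (t z) = T (h.proj z)) : t ∉ TriangleGroup := by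
  intro hΓ
  obtain ⟨m, hm, htm⟩ := exists_matrix_of_mem hΓ
  have h1 := h.differentiableAt_conj_of_isAntiholomorphic h hT ht hp vertex
  simp only [htm] at h1
  have h2 := (hasStrictDerivAt_smul hm vertex).hasDerivAt.differentiableAt
  exact deriv_smul_ne_zero hm vertex (deriv_eq_zero_of_differentiableAt_conj h2 h1)

/-- A symmetry of the surface that fixes the image of a point lifts to an isometry that fixes the
point and normalizes the deck group; this lift is conjugate to the reflection `P` in the triangle
group. -/
theorem exists_conj_lift_eq_P [CompactSpace X] [IsManifold 𝓘(ℂ) ω X] (h : HurwitzMap X)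
    {T : X → X} (hT : IsSymmetry T) {x : X} (hx : T x = x) :
    ∃ t : Equiv.Perm ℍ, ∃ z, h.proj z = x ∧ t z = z ∧ (∀ z, h.proj (t z) = T (h.proj z)) ∧
      t ∈ isoNormalizer h.deckGroup ∧ ∃ g ∈ TriangleGroup, g * t * g⁻¹ = P := by
  obtain ⟨z, rfl⟩ := h.surjective x
  obtain ⟨t, hc, hc', htz, h1, h2⟩ := h.exists_lift h (S := T) (S' := T) hT.2.1 hT.2.1 hT.1 hT.1
    (z₀ := z) (w₀ := z) hx.symm
  have d1 := h.dist_le_dist_of_isAntiholomorphic hT.2 hc h1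
  have d2 := h.dist_le_dist_of_isAntiholomorphic hT.2 hc' h2
  have i1 : Isometry t := Isometry.of_dist_eq fun z w => le_antisymm (d1 z w) (by
    simpa using d2 (t z) (t w))
  have hN : t ∈ isoNormalizer h.deckGroup := ⟨i1, h.mem_iff_conj_mem h hT.1 hT.1 hc hc' h1 h2⟩
  exact ⟨t, z, rfl, htz, h1, hN, h.isDiscreteOver.exists_conj_eq_P
    (h.isDiscreteOver.le_extGroup hN)
    (h.notMem_triangleGroup_of_isAntiholomorphic hT.2 hc h1) htz⟩

end HurwitzMap

end

section

/-! ### The axis of the reflection `P` -/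

/-- The imaginary axis, which is the set of fixed points of `P`, parametrized by arc length. -/
def ax (x : ℝ) : ℍ := ⟨Complex.I * Real.exp x, by simp [Complex.exp_ofReal_re, Real.exp_pos]⟩

theorem ax_im (x : ℝ) : (ax x).im = Real.exp x := by
  change (Complex.I * Real.exp x : ℂ).im = _
  simp [Complex.exp_ofReal_re]

theorem ax_re (x : ℝ) : (ax x).re = 0 := by
  change (Complex.I * Real.exp x : ℂ).re = _
  simp [Complex.exp_ofReal_im]

theorem cp_ax (x : ℝ) : cp (ax x) = Real.exp x := by
  rw [cp, ax_im, ax_re]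
  field_simp
  simp

theorem cq_ax (x : ℝ) : cq (ax x) = 0 := by rw [cq, ax_re, zero_div]

theorem cr_ax (x : ℝ) : cr (ax x) = Real.exp (-x) := by rw [cr, ax_im, Real.exp_neg, one_div]

theorem form_ax (x y : ℝ) : form (ax x) (ax y) = Real.cosh (x - y) := by
  rw [form, cp_ax, cp_ax, cr_ax, cr_ax, cq_ax, Real.cosh_eq, neg_sub, Real.exp_sub, Real.exp_sub,
    Real.exp_neg, Real.exp_neg]
  ring

theorem dist_ax (x y : ℝ) : dist (ax x) (ax y) = |x - y| := by
  have h := cosh_dist_eq_form (ax x) (ax y)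
  rw [form_ax, ← Real.cosh_abs (x - y)] at h
  exact Real.cosh_injOn (Set.mem_Ici.2 dist_nonneg) (Set.mem_Ici.2 (abs_nonneg _)) h

theorem isometry_ax : Isometry ax := Isometry.of_dist_eq fun x y => by
  rw [dist_ax, Real.dist_eq]

theorem ax_injective : Function.Injective ax := isometry_ax.injective

theorem P_ax (x : ℝ) : P (ax x) = ax x := P_apply_eq_iff.2 (cq_ax x)

theorem eq_ax {z : ℍ} (h : P z = z) : z = ax (Real.log z.im) := by
  refine coords_ext ?_ ?_
  · rw [P_apply_eq_iff.1 h, cq_ax]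
  · rw [cr_ax, Real.exp_neg, Real.exp_log z.im_pos, cr, one_div]

theorem edgeCentre_eq_ax : edgeCentre = ax 0 := coords_ext (by rw [cq_edgeCentre, cq_ax])
  (by rw [cr_edgeCentre, cr_ax]; simp)

/-- If an isometry maps two points of the triangle to the axis, then the segment of the axis between
the images consists of images of points of the triangle. -/
theorem exists_inTri_of_mem_Icc {g : Equiv.Perm ℍ} (hg : g ∈ ExtGroup) {z₁ z₂ : ℍ}
    (h₁ : InTri z₁) (h₂ : InTri z₂) {a b x : ℝ} (ha : g z₁ = ax a) (hb : g z₂ = ax b) (hab : a < b)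
    (hx : x ∈ Set.Icc a b) : ∃ y, InTri y ∧ g y = ax x := by
  refine ⟨g⁻¹ (ax x), ?_, perm_apply_inv _ _⟩
  have hs : 0 < Real.sinh (b - a) := Real.sinh_pos_iff.2 (by linarith)
  have hα : 0 ≤ Real.sinh (b - x) / Real.sinh (b - a) :=
    div_nonneg (Real.sinh_nonneg_iff.2 (by linarith [hx.2])) hs.le
  have hβ : 0 ≤ Real.sinh (x - a) / Real.sinh (b - a) :=
    div_nonneg (Real.sinh_nonneg_iff.2 (by linarith [hx.1])) hs.le
  obtain ⟨e1, e2, e3⟩ := Isometry.map_combination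
    (isometry_of_mem_extGroup (inv_mem hg)) (g⁻¹).surjective (z := ax x) (z₁ := ax a) (z₂ := ax b)
    (α := Real.sinh (b - x) / Real.sinh (b - a)) (β := Real.sinh (x - a) / Real.sinh (b - a))
    (by
      rw [cp_ax, cp_ax, cp_ax]
      field_simp
      simp only [Real.sinh_eq, neg_sub, Real.exp_sub]
      field_simp
      ring)
    (by simp [cq_ax])
    (by
      rw [cr_ax, cr_ax, cr_ax]
      field_simp
      simp only [Real.sinh_eq, neg_sub, Real.exp_sub, Real.exp_neg]
      field_simp
      ring)
  rw [← ha, ← hb, perm_inv_apply, perm_inv_apply] at e1 e2 e3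
  obtain ⟨p1, p2, p3⟩ := h₁
  obtain ⟨q1, q2, q3⟩ := h₂
  simp only [InTri, cf] at *
  rw [e1, e2, e3]
  refine ⟨by positivity, ?_, ?_⟩
  · have := mul_le_mul_of_nonneg_left p2 hα
    have := mul_le_mul_of_nonneg_left q2 hβ
    linarith
  · have := mul_nonneg hα p3
    have := mul_nonneg hβ q3
    linarith

theorem rotC_ne_one : rotC ≠ 1 := by
  intro h
  have h1 : rotC edgeCentre = edgeCentre := by rw [h]; rfl
  rw [rotC, Equiv.Perm.mul_apply, P_edgeCentre] at h1
  have h2 := eq_vertex P_edgeCentre h1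
  exact absurd (cornerPt_injective (a₁ := 1) (a₂ := 0) h2) (by decide)

theorem rotB_ne_one : rotB ≠ 1 := by
  intro h
  have h1 : rotB vertex = vertex := by rw [h]; rfl
  rw [rotB, Equiv.Perm.mul_apply, R_vertex] at h1
  have h2 := eq_edgeCentre P_vertex h1
  exact absurd (cornerPt_injective (a₁ := 0) (a₂ := 1) h2) (by decide)

theorem rotA_ne_one : rotA ≠ 1 := by
  intro h
  have h1 : rotA vertex = vertex := by rw [h]; rfl
  rw [rotA, P_mul_Q_comm, Equiv.Perm.mul_apply, P_vertex] at h1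
  have h2 := eq_edgeCentre P_vertex h1
  exact absurd (cornerPt_injective (a₁ := 0) (a₂ := 1) h2) (by decide)

theorem rotC_pow_three_ne_one : rotC ^ 3 ≠ 1 := by
  intro h
  apply rotC_ne_one
  have h7 := rotC_pow_seven
  rw [show 7 = 3 * 2 + 1 by rfl, pow_succ, pow_mul, h, one_pow, one_mul] at h7
  exact h7

theorem rotC_pow_three_vertex : (rotC ^ 3) vertex = vertex := by
  simp [pow_succ, Equiv.Perm.mul_apply, rotC, P_vertex, R_vertex]

theorem rotC_pow_three_mem : rotC ^ 3 ∈ TriangleGroup := pow_mem rotC_mem 3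

theorem rotC_pow_three_mul_rotB_mem : rotC ^ 3 * rotB ∈ TriangleGroup :=
  mul_mem rotC_pow_three_mem rotB_mem

/-- The position of the vertex of the triangle on the axis. -/
def x₁ : ℝ := Real.log vertex.im

/-- The position of the face-centre next to the vertex on the axis. -/
def x₂ : ℝ := Real.log ((rotC ^ 3) faceCentre).im

/-- The position of the edge-centre next to this face-centre on the axis. -/
def x₃ : ℝ := Real.log ((rotC ^ 3 * rotB) edgeCentre).im

theorem vertex_eq_ax : vertex = ax x₁ := eq_ax P_vertex

theorem rotC_pow_three_faceCentre : (rotC ^ 3) faceCentre = ax x₂ := by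
  refine eq_ax ?_
  rw [P_eq_conj_R, Equiv.Perm.mul_apply, perm_inv_apply, Equiv.Perm.mul_apply _ R, R_faceCentre]

theorem rotC_pow_three_mul_rotB_edgeCentre : (rotC ^ 3 * rotB) edgeCentre = ax x₃ := by
  refine eq_ax ?_
  rw [P_eq_conj_Q, Equiv.Perm.mul_apply, perm_inv_apply, Equiv.Perm.mul_apply _ Q, Q_edgeCentre]

theorem x₁_neg : x₁ < 0 := by
  have h := cp_lt_cr_vertex
  rw [vertex_eq_ax, cp_ax, cr_ax, Real.exp_lt_exp] at h
  linarith

variable {N : Subgroup (Equiv.Perm ℍ)}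

theorem IsDiscreteOver.x₂_lt_x₁ (hN : IsDiscreteOver N) : x₂ < x₁ := by
  have hg := triangleGroup_le rotC_pow_three_mem
  have hv := rotC_pow_three_vertex.trans vertex_eq_ax
  by_contra! hle
  rcases hle.eq_or_lt with h | h
  · have h1 : (rotC ^ 3) faceCentre = (rotC ^ 3) vertex := by
      rw [rotC_pow_three_faceCentre, hv, h]
    exact absurd (cornerPt_injective (a₁ := 2) (a₂ := 0) ((rotC ^ 3).injective h1)) (by decide)
  · obtain ⟨y, hy, hyx⟩ := exists_inTri_of_mem_Icc hg inTri_vertex inTri_faceCentre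
      (x := min x₂ 0) hv rotC_pow_three_faceCentre h ⟨le_min h.le x₁_neg.le, min_le_left _ _⟩
    obtain ⟨y', hy', hyx'⟩ := exists_inTri_of_mem_Icc (one_mem _) inTri_vertex inTri_edgeCentre
      (x := min x₂ 0) vertex_eq_ax edgeCentre_eq_ax x₁_neg ⟨le_min h.le x₁_neg.le, min_le_right _ _⟩
    have h1 : (rotC ^ 3) y = y' := by rw [hyx, ← hyx']; rfl
    have h2 := hN.eq_of_extGroup hg hy (h1 ▸ hy')
    refine rotC_pow_three_ne_one (eq_one_of_fixed rotC_pow_three_mem ?_ h2 rotC_pow_three_vertex)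
    rintro rfl
    rw [hyx, vertex_eq_ax] at h2
    have := ax_injective h2
    have := lt_min h x₁_neg
    linarith

theorem IsDiscreteOver.x₃_lt_x₂ (hN : IsDiscreteOver N) : x₃ < x₂ := by
  have hg := triangleGroup_le rotC_pow_three_mem
  have hg' := triangleGroup_le rotC_pow_three_mul_rotB_mem
  have hf : (rotC ^ 3 * rotB) faceCentre = ax x₂ := by
    rw [Equiv.Perm.mul_apply, rotB_faceCentre, rotC_pow_three_faceCentre]
  have h21 := hN.x₂_lt_x₁
  by_contra! hle
  rcases hle.eq_or_lt with h | h
  · have h1 : (rotC ^ 3 * rotB) faceCentre = (rotC ^ 3 * rotB) edgeCentre := by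
      rw [rotC_pow_three_mul_rotB_edgeCentre, hf, h]
    exact absurd (cornerPt_injective (a₁ := 2) (a₂ := 1) ((rotC ^ 3 * rotB).injective h1))
      (by decide)
  · have hlt : x₂ < min x₁ x₃ := lt_min h21 h
    obtain ⟨y, hy, hyx⟩ := exists_inTri_of_mem_Icc hg inTri_faceCentre inTri_vertex
      (x := min x₁ x₃) rotC_pow_three_faceCentre (rotC_pow_three_vertex.trans vertex_eq_ax)
      h21 ⟨hlt.le, min_le_left _ _⟩
    obtain ⟨y', hy', hyx'⟩ := exists_inTri_of_mem_Icc hg' inTri_faceCentre inTri_edgeCentre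
      (x := min x₁ x₃) hf rotC_pow_three_mul_rotB_edgeCentre h ⟨hlt.le, min_le_right _ _⟩
    have h1 : rotB y' = y := by
      apply (rotC ^ 3).injective
      rw [hyx, ← hyx']; rfl
    have h2 := hN.eq_of_extGroup (triangleGroup_le rotB_mem) hy' (h1 ▸ hy)
    refine rotB_ne_one (eq_one_of_fixed rotB_mem ?_ h2 rotB_faceCentre)
    rintro rfl
    rw [hf] at hyx'
    exact hlt.ne (ax_injective hyx')

/-! ### Isometries that preserve the axis -/

theorem exists_apply_ax {g : Equiv.Perm ℍ} (hg : P * g = g * P) (x : ℝ) : ∃ y, g (ax x) = ax y := by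
  refine ⟨_, eq_ax ?_⟩
  rw [← Equiv.Perm.mul_apply, hg, Equiv.Perm.mul_apply, P_ax]

/-- A rotation `≠ 1` about a point of the axis that preserves the axis is a half-turn. -/
theorem apply_ax_of_fixed {g : Equiv.Perm ℍ} (hg : g ∈ TriangleGroup) (h1 : g ≠ 1)
    (hP : P * g = g * P) {c : ℝ} (hc : g (ax c) = ax c) (x : ℝ) : g (ax x) = ax (2 * c - x) := by
  obtain ⟨y, hy⟩ := exists_apply_ax hP x
  by_cases hx : x = c
  · rw [hx, hc]; congr 1; ring
  · have h2 := (isometry_of_mem_triangleGroup hg).dist_eq (ax x) (ax c)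
    rw [hy, hc, dist_ax, dist_ax] at h2
    rcases abs_eq_abs.1 h2 with h | h
    · refine absurd (eq_one_of_fixed hg (fun h' => hx (ax_injective h')) (z := ax x) ?_ hc) h1
      rw [hy]; congr 1; linarith
    · rw [hy]; congr 1; linarith

/-- An isometry without fixed points on the axis that preserves the axis translates it. -/
theorem exists_translation {g : Equiv.Perm ℍ} (hg : g ∈ TriangleGroup)
    (h1 : ∀ x, g (ax x) = ax x → g = 1) (hP : P * g = g * P) :
    ∃ d, ∀ x, g (ax x) = ax (x + d) := by
  by_cases hg1 : g = 1
  · exact ⟨0, fun x => by rw [hg1]; simp⟩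
  choose σ hσ using exists_apply_ax hP
  have hd : ∀ x y, |σ x - σ y| = |x - y| := by
    intro x y
    have h2 := (isometry_of_mem_triangleGroup hg).dist_eq (ax x) (ax y)
    rwa [hσ, hσ, dist_ax, dist_ax] at h2
  have hne : ∀ x, σ x ≠ x := fun x h => hg1 (h1 x (by rw [hσ, h]))
  refine ⟨σ 0, fun x => ?_⟩
  rw [hσ]
  congr 1
  have hm : σ (σ 0 / 2) = σ 0 + σ 0 / 2 := by
    rcases abs_eq_abs.1 (hd (σ 0 / 2) 0) with h | h
    · linarith
    · exact absurd (by linarith) (hne (σ 0 / 2))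
  rcases abs_eq_abs.1 (hd x 0) with h | h
  · linarith
  · have h3 := hd x (σ 0 / 2)
    rw [hm] at h3
    rcases abs_eq_abs.1 h3 with h4 | h4
    · linarith
    · exact absurd (by linarith) (hne 0)

theorem rotA_ax (x : ℝ) : rotA (ax x) = ax (-x) := by
  have h := apply_ax_of_fixed rotA_mem rotA_ne_one (c := 0) (by
    rw [rotA, mul_assoc, ← P_mul_Q_comm]) (by
    rw [← edgeCentre_eq_ax, rotA_edgeCentre]) x
  rw [h]; congr 1; ring

/-- The half-turn about the edge-centre at `x₃`. -/
def rotA' : Equiv.Perm ℍ := rotC ^ 3 * rotB * rotA * (rotC ^ 3 * rotB)⁻¹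

theorem rotA'_mem : rotA' ∈ TriangleGroup :=
  mul_mem (mul_mem rotC_pow_three_mul_rotB_mem rotA_mem) (inv_mem rotC_pow_three_mul_rotB_mem)

theorem P_mul_rotA' : P * rotA' = rotA' * P := by
  have h : Q * rotA = rotA * Q := by rw [rotA, ← mul_assoc, ← P_mul_Q_comm]
  rw [rotA', P_eq_conj_Q]
  generalize rotC ^ 3 * rotB = u
  calc u * Q * u⁻¹ * (u * rotA * u⁻¹) = u * (Q * rotA) * u⁻¹ := by group
    _ = u * (rotA * Q) * u⁻¹ := by rw [h]
    _ = _ := by group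

theorem rotA'_ax (x : ℝ) : rotA' (ax x) = ax (2 * x₃ - x) := by
  refine apply_ax_of_fixed rotA'_mem ?_ P_mul_rotA' ?_ x
  · intro h
    exact rotA_ne_one (conj_eq_one_iff.1 h)
  · rw [rotA', ← rotC_pow_three_mul_rotB_edgeCentre, Equiv.Perm.mul_apply, perm_inv_apply,
      Equiv.Perm.mul_apply, rotA_edgeCentre]

/-- The translation `A C³ B A B⁻¹ C⁻³` along the axis, a product of two half-turns. Its powers are
the elements of the triangle group that translate the axis. -/
def axisTranslation : Equiv.Perm ℍ := rotA * rotA'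

theorem axisTranslation_mem : axisTranslation ∈ TriangleGroup := mul_mem rotA_mem rotA'_mem

theorem P_mul_axisTranslation : P * axisTranslation = axisTranslation * P := by
  have h : P * rotA = rotA * P := by rw [rotA, mul_assoc, ← P_mul_Q_comm]
  rw [axisTranslation, ← mul_assoc, h, mul_assoc, P_mul_rotA', mul_assoc]

/-- The translation length of `axisTranslation`. -/
def translationLength : ℝ := -2 * x₃

theorem axisTranslation_ax (x : ℝ) : axisTranslation (ax x) = ax (x + translationLength) := by
  rw [axisTranslation, Equiv.Perm.mul_apply, rotA'_ax, rotA_ax, translationLength]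
  congr 1
  ring

theorem axisTranslation_zpow_ax (n : ℤ) (x : ℝ) :
    (axisTranslation ^ n) (ax x) = ax (x + n * translationLength) := by
  induction n with
  | zero => simp
  | succ n ih =>
    rw [zpow_add_one, (Commute.zpow_self axisTranslation n).eq, Equiv.Perm.mul_apply, ih,
      axisTranslation_ax]
    push_cast
    congr 1
    ring
  | pred n ih =>
    rw [zpow_sub_one, ((Commute.refl axisTranslation).zpow_left _).inv_right.eq,
      Equiv.Perm.mul_apply, ih, Equiv.Perm.inv_eq_iff_eq, axisTranslation_ax]
    push_cast
    congr 1
    ring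

theorem IsDiscreteOver.translationLength_pos (hN : IsDiscreteOver N) : 0 < translationLength := by
  have := hN.x₂_lt_x₁
  have := hN.x₃_lt_x₂
  have := x₁_neg
  unfold translationLength
  linarith

/-! ### The geometric points on the axis -/

theorem apply_mem_universalGeometricPoint {g : Equiv.Perm ℍ} (hg : g ∈ TriangleGroup) {z : ℍ}
    {i : Fin 3} : g z ∈ universalGeometricPoint i ↔ z ∈ universalGeometricPoint i := by
  constructor
  · rintro ⟨g', hg', h⟩
    exact ⟨g' * g, mul_mem hg' hg, h⟩
  · rintro ⟨g', hg', h⟩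
    exact ⟨g' * g⁻¹, mul_mem hg' (inv_mem hg), by
      rwa [Equiv.Perm.mul_apply, perm_inv_apply]⟩

theorem cornerPt_mem (i : Fin 3) : cornerPt i ∈ universalGeometricPoint i :=
  ⟨1, one_mem _, mem_corner_iff.2 rfl⟩

theorem IsDiscreteOver.eq_cornerPt (hN : IsDiscreteOver N) {z : ℍ} (hz : InTri z) {i : Fin 3}
    (h : z ∈ universalGeometricPoint i) : z = cornerPt i := by
  obtain ⟨g, hg, h⟩ := h
  rw [mem_corner_iff] at h
  rw [← h]
  exact (hN.eq_of_extGroup (triangleGroup_le hg) hz (h ▸ inTri_cornerPt i)).symm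

/-- The geometric points on the segment of the axis between two corners of an image of the
triangle are these two corners. -/
theorem IsDiscreteOver.mem_universalGeometricPoint_iff (hN : IsDiscreteOver N) {g : Equiv.Perm ℍ}
    (hg : g ∈ TriangleGroup) {i₁ i₂ i : Fin 3} {a b x : ℝ} (ha : g (cornerPt i₁) = ax a)
    (hb : g (cornerPt i₂) = ax b) (hab : a < b) (hx : x ∈ Set.Icc a b)
    (hi : ∀ i, i ≠ i₁ → i ≠ i₂ → P (g (cornerPt i)) ≠ g (cornerPt i)) :
    ax x ∈ universalGeometricPoint i ↔ (x = a ∧ i = i₁) ∨ (x = b ∧ i = i₂) := by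
  constructor
  · intro h
    obtain ⟨y, hy, hyx⟩ := exists_inTri_of_mem_Icc (triangleGroup_le hg) (inTri_cornerPt i₁)
      (inTri_cornerPt i₂) ha hb hab hx
    have h1 := hN.eq_cornerPt hy ((apply_mem_universalGeometricPoint hg).1 (hyx ▸ h))
    by_cases e1 : i = i₁
    · left
      refine ⟨ax_injective ?_, e1⟩
      rw [← hyx, h1, e1, ha]
    by_cases e2 : i = i₂
    · right
      refine ⟨ax_injective ?_, e2⟩
      rw [← hyx, h1, e2, hb]
    refine absurd ?_ (hi i e1 e2)
    rw [← h1, hyx, P_ax]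
  · rintro (⟨rfl, rfl⟩ | ⟨rfl, rfl⟩)
    · rw [← ha, apply_mem_universalGeometricPoint hg]
      exact cornerPt_mem _
    · rw [← hb, apply_mem_universalGeometricPoint hg]
      exact cornerPt_mem _

theorem cornerPt_zero : cornerPt 0 = vertex := rfl
theorem cornerPt_one : cornerPt 1 = edgeCentre := rfl
theorem cornerPt_two : cornerPt 2 = faceCentre := rfl

theorem IsDiscreteOver.mem_iff_of_mem_Icc (hN : IsDiscreteOver N) {x : ℝ} (hx : x ∈ Set.Icc x₃ 0)
    (i : Fin 3) : ax x ∈ universalGeometricPoint i ↔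
      (x = x₃ ∧ i = 1) ∨ (x = x₂ ∧ i = 2) ∨ (x = x₁ ∧ i = 0) ∨ (x = 0 ∧ i = 1) := by
  have h1 := x₁_neg
  have h2 := hN.x₂_lt_x₁
  have h3 := hN.x₃_lt_x₂
  rcases le_or_gt x x₂ with h | h
  · rw [hN.mem_universalGeometricPoint_iff rotC_pow_three_mul_rotB_mem (i₁ := 1) (i₂ := 2)
      (by rw [cornerPt_one, rotC_pow_three_mul_rotB_edgeCentre]) (by
        rw [cornerPt_two, Equiv.Perm.mul_apply, rotB_faceCentre, rotC_pow_three_faceCentre]) h3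
      ⟨hx.1, h⟩]
    · have e1 : x ≠ x₁ := by linarith
      have e2 : x ≠ 0 := by linarith
      simp only [e1, e2, false_and, or_false]
    · intro i hi1 hi2
      obtain rfl : i = 0 := by omega
      rw [P_eq_conj_Q, Equiv.Perm.mul_apply, perm_inv_apply, Equiv.Perm.mul_apply _ Q]
      intro hq
      have := eq_edgeCentre P_vertex ((rotC ^ 3 * rotB).injective hq)
      exact absurd (cornerPt_injective (a₁ := 0) (a₂ := 1) this) (by decide)
  rcases le_or_gt x x₁ with h' | h'
  · rw [hN.mem_universalGeometricPoint_iff rotC_pow_three_mem (i₁ := 2) (i₂ := 0)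
      (by rw [cornerPt_two, rotC_pow_three_faceCentre])
      (by rw [cornerPt_zero, rotC_pow_three_vertex, vertex_eq_ax]) h2 ⟨h.le, h'⟩]
    · have e1 : x ≠ x₃ := by linarith
      have e2 : x ≠ 0 := by linarith
      simp only [e1, e2, false_and, or_false, false_or]
    · intro i hi1 hi2
      obtain rfl : i = 1 := by omega
      rw [P_eq_conj_R, Equiv.Perm.mul_apply, perm_inv_apply, Equiv.Perm.mul_apply _ R]
      intro hq
      have := eq_vertex P_edgeCentre ((rotC ^ 3).injective hq)
      exact absurd (cornerPt_injective (a₁ := 1) (a₂ := 0) this) (by decide)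
  · rw [hN.mem_universalGeometricPoint_iff (one_mem _) (i₁ := 0) (i₂ := 1)
      vertex_eq_ax edgeCentre_eq_ax h1 ⟨h'.le, hx.2⟩]
    · have e1 : x ≠ x₃ := by linarith
      have e2 : x ≠ x₂ := by linarith
      simp only [e1, e2, false_and, false_or]
    · intro i hi1 hi2 hP
      obtain rfl : i = 2 := by omega
      have := P_apply_eq_iff.1 hP
      exact cq_faceCentre_pos.ne' this

/-- The positions on the axis of the geometric points in a period. -/
def basePos : Fin 6 → ℝ := ![x₃, x₂, x₁, 0, -x₁, -x₂]

/-- The labels of the geometric points in a period of the axis. -/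
def baseLabel : Fin 6 → Fin 3 := ![1, 2, 0, 1, 0, 2]

/-- The residue modulo `6`. -/
def residue (j : ℤ) : Fin 6 := ((j : ZMod 6) : Fin 6)

/-- The positions of all geometric points on the axis, in ascending order. -/
def axisPos (j : ℤ) : ℝ := basePos (residue j) + (j / 6 : ℤ) * translationLength

/-- The labels of all geometric points on the axis, in ascending order. -/
def axisLabel (j : ℤ) : Fin 3 := baseLabel (residue j)

theorem residue_add (q : ℤ) (r : Fin 6) : residue (6 * q + (r : ℕ)) = r := by
  have h6 : (6 : ZMod 6) = 0 := rfl
  unfold residue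
  push_cast
  rw [h6, zero_mul, zero_add]
  exact ZMod.natCast_zmod_val (n := 6) r

theorem exists_eq_six_mul_add (j : ℤ) : ∃ (q : ℤ) (r : Fin 6), j = 6 * q + (r : ℕ) :=
  ⟨j / 6, ⟨(j % 6).toNat, by omega⟩, by simp only; omega⟩

theorem axisLabel_add (q : ℤ) (r : Fin 6) : axisLabel (6 * q + (r : ℕ)) = baseLabel r := by
  rw [axisLabel, residue_add]

theorem axisPos_add (q : ℤ) (r : Fin 6) :
    axisPos (6 * q + (r : ℕ)) = basePos r + q * translationLength := by
  rw [axisPos, residue_add]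
  congr 3
  omega

theorem axisLabel_add_six_mul (j q : ℤ) : axisLabel (j + 6 * q) = axisLabel j := by
  obtain ⟨q', r, rfl⟩ := exists_eq_six_mul_add j
  rw [axisLabel_add, show 6 * q' + ((r : ℕ) : ℤ) + 6 * q = 6 * (q' + q) + (r : ℕ) by ring,
    axisLabel_add]

theorem axisPos_add_six_mul (j q : ℤ) :
    axisPos (j + 6 * q) = axisPos j + q * translationLength := by
  obtain ⟨q', r, rfl⟩ := exists_eq_six_mul_add j
  rw [axisPos_add, show 6 * q' + ((r : ℕ) : ℤ) + 6 * q = 6 * (q' + q) + (r : ℕ) by ring,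
    axisPos_add]
  push_cast
  ring

theorem IsDiscreteOver.axisPos_strictMono (hN : IsDiscreteOver N) : StrictMono axisPos := by
  have h1 := x₁_neg
  have h2 := hN.x₂_lt_x₁
  have h3 := hN.x₃_lt_x₂
  refine strictMono_int_of_lt_succ fun j => ?_
  obtain ⟨q, r, rfl⟩ := exists_eq_six_mul_add j
  rw [axisPos_add]
  by_cases hr : r = 5
  · subst hr
    have := axisPos_add (q + 1) 0
    rw [show 6 * q + (((5 : Fin 6) : ℕ) : ℤ) + 1 = 6 * (q + 1) + (((0 : Fin 6) : ℕ) : ℤ) by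
      simp
      ring, this]
    simp only [basePos, translationLength]
    push_cast
    simp
    linarith
  · have := axisPos_add q (r + 1)
    rw [show 6 * q + ((r : ℕ) : ℤ) + 1 = 6 * q + (((r + 1 : Fin 6) : ℕ) : ℤ) by
      fin_cases r <;> simp_all <;> ring, this]
    simp only [basePos]
    fin_cases r <;> simp_all <;> linarith

theorem mem_of_neg {x : ℝ} {i : Fin 3} :
    ax (-x) ∈ universalGeometricPoint i ↔ ax x ∈ universalGeometricPoint i := by
  rw [← rotA_ax, apply_mem_universalGeometricPoint rotA_mem]

theorem mem_add_iff {x : ℝ} (q : ℤ) {i : Fin 3} :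
    ax (x + q * translationLength) ∈ universalGeometricPoint i ↔
      ax x ∈ universalGeometricPoint i := by
  rw [← axisTranslation_zpow_ax,
    apply_mem_universalGeometricPoint (zpow_mem axisTranslation_mem q)]

/-- The geometric points on the axis. -/
theorem IsDiscreteOver.ax_mem_iff (hN : IsDiscreteOver N) {x : ℝ} {i : Fin 3} :
    ax x ∈ universalGeometricPoint i ↔ ∃ j, axisPos j = x ∧ axisLabel j = i := by
  have h1 := x₁_neg
  have h2 := hN.x₂_lt_x₁
  have h3 := hN.x₃_lt_x₂
  have hl := hN.translationLength_pos
  have hbase : ∀ y ∈ Set.Ico x₃ (-x₃), ∀ i, ax y ∈ universalGeometricPoint i ↔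
      ∃ r, basePos r = y ∧ baseLabel r = i := by
    intro y hy i
    have e : (∃ r, basePos r = y ∧ baseLabel r = i) ↔ (x₃ = y ∧ 1 = i) ∨ (x₂ = y ∧ 2 = i) ∨
        (x₁ = y ∧ 0 = i) ∨ (0 = y ∧ 1 = i) ∨ (-x₁ = y ∧ 0 = i) ∨ (-x₂ = y ∧ 2 = i) := by
      simp [Fin.exists_fin_succ, basePos, baseLabel]
    rw [e]
    rcases le_or_gt y 0 with h | h
    · rw [hN.mem_iff_of_mem_Icc ⟨hy.1, h⟩]
      have e1 : -x₁ ≠ y := by linarith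
      have e2 : -x₂ ≠ y := by linarith
      simp only [e1, e2, false_and, or_false, @eq_comm _ y, @eq_comm _ i]
    · rw [← mem_of_neg, hN.mem_iff_of_mem_Icc ⟨by linarith [hy.2], by linarith⟩]
      have e1 : x₃ ≠ y := by linarith
      have e2 : x₂ ≠ y := by linarith
      have e3 : x₁ ≠ y := by linarith
      have e4 : 0 ≠ y := by linarith
      have e5 : -y ≠ x₃ := by linarith [hy.2]
      have e6 : -y ≠ 0 := by linarith
      simp only [e1, e2, e3, e4, e5, e6, false_and, or_false, false_or, neg_eq_iff_eq_neg]
      rw [or_comm, @eq_comm _ x₁, @eq_comm _ x₂, neg_eq_iff_eq_neg, neg_eq_iff_eq_neg,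
        @eq_comm _ 0 i, @eq_comm _ 2 i]
  have hfloor : ∃ q : ℤ, x - q * translationLength ∈ Set.Ico x₃ (-x₃) := by
    refine ⟨⌊(x - x₃) / translationLength⌋, ?_, ?_⟩
    · have := Int.floor_le ((x - x₃) / translationLength)
      rw [le_div_iff₀ hl] at this
      linarith
    · have := Int.lt_floor_add_one ((x - x₃) / translationLength)
      rw [div_lt_iff₀ hl] at this
      simp only [translationLength] at *
      linarith
  obtain ⟨q, hq⟩ := hfloor
  have hx : x = (x - q * translationLength) + q * translationLength := by ring
  constructor
  · intro h
    rw [hx, mem_add_iff, hbase _ hq] at h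
    obtain ⟨r, hr, hi⟩ := h
    refine ⟨6 * q + (r : ℕ), ?_, by rw [axisLabel_add, hi]⟩
    rw [axisPos_add, hr, ← hx]
  · rintro ⟨j, rfl, rfl⟩
    obtain ⟨q', r, rfl⟩ := exists_eq_six_mul_add j
    rw [axisPos_add, axisLabel_add, mem_add_iff, hbase]
    · exact ⟨r, rfl, rfl⟩
    · unfold basePos
      fin_cases r <;> refine ⟨?_, ?_⟩ <;> simp <;> linarith

/-- An element of the triangle group that translates the axis is a power of `axisTranslation`,
because it preserves the labels. -/
theorem IsDiscreteOver.eq_zpow_of_translation (hN : IsDiscreteOver N) {g : Equiv.Perm ℍ}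
    (hg : g ∈ TriangleGroup) {d : ℝ} (hd : ∀ x, g (ax x) = ax (x + d)) :
    ∃ n : ℤ, g = axisTranslation ^ n ∧ d = n * translationLength := by
  have h1 := x₁_neg
  have h2 := hN.x₂_lt_x₁
  have h3 := hN.x₃_lt_x₂
  have hmem : ∀ x i, ax (x + d) ∈ universalGeometricPoint i ↔ ax x ∈ universalGeometricPoint i := by
    intro x i
    rw [← hd, apply_mem_universalGeometricPoint hg]
  have h0 := (hmem x₃ 1).2 ((hN.mem_iff_of_mem_Icc ⟨le_rfl, by linarith⟩ 1).2 (by simp))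
  rw [hN.ax_mem_iff] at h0
  obtain ⟨j, hj, hj1⟩ := h0
  obtain ⟨q, r, rfl⟩ := exists_eq_six_mul_add j
  rw [axisLabel_add] at hj1
  rw [axisPos_add] at hj
  obtain rfl | rfl : r = 0 ∨ r = 3 := by
    revert hj1
    unfold baseLabel
    fin_cases r <;> simp
  · have hdq : d = q * translationLength := by
      simp only [basePos, Matrix.cons_val_zero] at hj
      linarith
    refine ⟨q, ?_, hdq⟩
    have hfix : ∀ x, ((axisTranslation ^ q)⁻¹ * g) (ax x) = ax x := by
      intro x
      rw [Equiv.Perm.mul_apply, hd, hdq, ← axisTranslation_zpow_ax, perm_inv_apply]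
    have := eq_one_of_fixed (mul_mem (inv_mem (zpow_mem axisTranslation_mem q)) hg)
      (fun h => h1.ne (ax_injective h)) (hfix x₁) (hfix 0)
    exact (inv_mul_eq_one.1 this).symm
  · exfalso
    have hdq : d = -x₃ + q * translationLength := by
      have : basePos 3 = 0 := rfl
      rw [this] at hj
      linarith
    have key : ∀ x ∈ Set.Ioo x₃ 0, ∀ i, ax x ∈ universalGeometricPoint i →
        ax (x₃ - x) ∈ universalGeometricPoint i := by
      intro x hx i hi
      rw [← hmem, hdq, ← add_assoc, mem_add_iff, ← mem_of_neg] at hi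
      convert hi using 2
      ring
    have k2 := key x₂ ⟨h3, by linarith⟩ 2 ((hN.mem_iff_of_mem_Icc ⟨h3.le, by linarith⟩ 2).2 (by simp))
    have k1 := key x₁ ⟨by linarith, h1⟩ 0 ((hN.mem_iff_of_mem_Icc ⟨by linarith, h1.le⟩ 0).2 (by simp))
    rw [hN.mem_iff_of_mem_Icc ⟨by linarith, by linarith⟩] at k1 k2
    simp only [Fin.isValue, and_true, and_false, or_false, false_or, Fin.reduceEq, zero_ne_one] at k1 k2
    linarith

end

section

/-! ### The image of the axis on the surface -/

namespace HurwitzMap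

variable {X : Type*} [TopologicalSpace X] [ChartedSpace ℂ X] (h : HurwitzMap X)

theorem finite_quotient [CompactSpace X] : Finite (TriangleGroup ⧸ h.mapSubgroup) := by
  classical
  obtain ⟨τ, D, hM⟩ := h.exists_isCocompactFree
  obtain ⟨r, hr⟩ := hM.isCompact.isBounded.subset_closedBall vertex
  have hfin := h.isDiscreteOver.finite vertex vertex (Real.cosh r)
  set S := {t | t ∈ isoNormalizer h.deckGroup ∧ form (t vertex) vertex ≤ Real.cosh r} with hS
  have : Finite S := hfin
  let f : S → TriangleGroup ⧸ h.mapSubgroup := fun t =>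
    if ht : (t : Equiv.Perm ℍ) ∈ TriangleGroup then
      QuotientGroup.mk (⟨t, ht⟩ : TriangleGroup) else 1
  refine Finite.of_surjective f fun q => ?_
  obtain ⟨g, rfl⟩ := QuotientGroup.mk_surjective q
  obtain ⟨m, hm, hmD⟩ := hM.covers ((g : Equiv.Perm ℍ) vertex)
  have hmg : m * g ∈ TriangleGroup := mul_mem (h.deckGroup_le hm) g.2
  refine ⟨⟨m * g, h.triangleGroup_le_isoNormalizer hmg, ?_⟩, ?_⟩
  · rw [← cosh_dist_eq_form]
    have h1 : dist ((m * g) vertex) vertex ≤ r := hr hmD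
    exact Real.cosh_le_cosh.2 (by
      rwa [abs_of_nonneg dist_nonneg, abs_of_nonneg (dist_nonneg.trans h1)])
  · simp only [f, hmg, dite_true]
    obtain ⟨hm1, hm2⟩ := h.mem_deckGroup.1 hm
    change ((((⟨m, hm1⟩ : TriangleGroup) * g : TriangleGroup)) : TriangleGroup ⧸ h.mapSubgroup) = _
    rw [QuotientGroup.mk_mul, (QuotientGroup.eq_one_iff _).2 hm2, one_mul]

/-- The order of `axisTranslation` modulo the deck group. -/
def translationOrder : ℕ :=
  orderOf ((⟨axisTranslation, axisTranslation_mem⟩ : TriangleGroup) : TriangleGroup ⧸ h.mapSubgroup)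

theorem translationOrder_pos [CompactSpace X] : 0 < h.translationOrder :=
  have := h.finite_quotient
  orderOf_pos _

theorem axisTranslation_zpow_mem (n : ℤ) :
    axisTranslation ^ n ∈ h.deckGroup ↔ (h.translationOrder : ℤ) ∣ n := by
  rw [translationOrder, orderOf_dvd_iff_zpow_eq_one, ← QuotientGroup.mk_zpow,
    QuotientGroup.eq_one_iff, ← h.coe_mem_deckGroup]
  rfl

/-- The length of the closed curve that is the image of the axis. -/
def axisPeriod : ℝ := h.translationOrder * translationLength

theorem axisPeriod_pos [CompactSpace X] : 0 < h.axisPeriod :=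
  mul_pos (by exact_mod_cast h.translationOrder_pos) h.isDiscreteOver.translationLength_pos

/-- The image on the surface of the geodesic that `g` makes from the axis. -/
def axisCurve (g : Equiv.Perm ℍ) (x : ℝ) : X := h.proj (g (ax x))

theorem continuous_axisCurve {g : Equiv.Perm ℍ} (hg : g ∈ TriangleGroup) :
    Continuous (h.axisCurve g) :=
  h.continuous.comp ((isometry_of_mem_triangleGroup hg).continuous.comp isometry_ax.continuous)

theorem inv_mul_mul_mem_deckGroup {g m : Equiv.Perm ℍ} (hg : g ∈ TriangleGroup)
    (hm : m ∈ h.deckGroup) : g⁻¹ * m * g ∈ h.deckGroup := by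
  simpa using h.conj_mem_deckGroup (inv_mem hg) hm

theorem axisCurve_eq_iff [CompactSpace X] (hP : P ∈ isoNormalizer h.deckGroup) {g : Equiv.Perm ℍ}
    (hg : g ∈ TriangleGroup) {x x' : ℝ} :
    h.axisCurve g x = h.axisCurve g x' ↔ ∃ n : ℤ, x' = x + n * h.axisPeriod := by
  unfold axisCurve
  rw [h.proj_eq_iff_deckGroup]
  constructor
  · rintro ⟨m, hm, hmx⟩
    have hm' := h.inv_mul_mul_mem_deckGroup hg hm
    set m' := g⁻¹ * m * g with hm'_def
    have hx : m' (ax x) = ax x' := by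
      rw [hm'_def, Equiv.Perm.mul_apply, Equiv.Perm.mul_apply, hmx, perm_inv_apply]
    have hPm : P * m' * P⁻¹ ∈ h.deckGroup := (hP.2 m').1 hm'
    have hcomm : P * m' = m' * P := by
      have h1 : m'⁻¹ * (P * m' * P⁻¹) = 1 := by
        refine h.eq_one_of_mem_of_fixed (mul_mem (inv_mem hm') hPm) (z := ax x) ?_
        rw [P_inv, Equiv.Perm.mul_apply, Equiv.Perm.mul_apply _ P, P_ax, Equiv.Perm.mul_apply, hx,
          P_ax, ← hx, perm_inv_apply]
      rw [inv_mul_eq_one, eq_mul_inv_iff_mul_eq] at h1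
      exact h1.symm
    obtain ⟨d, hd⟩ := exists_translation (h.deckGroup_le hm')
      (fun y hy => h.eq_one_of_mem_of_fixed hm' hy) hcomm
    obtain ⟨n, hn, hdn⟩ := h.isDiscreteOver.eq_zpow_of_translation (h.deckGroup_le hm') hd
    rw [hn, h.axisTranslation_zpow_mem] at hm'
    obtain ⟨k, rfl⟩ := hm'
    refine ⟨k, ?_⟩
    rw [hd] at hx
    rw [← ax_injective hx, hdn, axisPeriod]
    push_cast
    ring
  · rintro ⟨n, rfl⟩
    refine ⟨g * axisTranslation ^ ((h.translationOrder : ℤ) * n) * g⁻¹,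
      h.conj_mem_deckGroup hg ((h.axisTranslation_zpow_mem _).2 (dvd_mul_right _ _)), ?_⟩
    rw [Equiv.Perm.mul_apply, perm_inv_apply, Equiv.Perm.mul_apply, axisTranslation_zpow_ax,
      axisPeriod]
    push_cast
    congr 3
    ring

theorem axisCurve_mem_geometricPoint {g : Equiv.Perm ℍ} (hg : g ∈ TriangleGroup) {x : ℝ}
    {i : Fin 3} : h.axisCurve g x ∈ h.geometricPoint i ↔ ax x ∈ universalGeometricPoint i := by
  constructor
  · rintro ⟨y, hy, hyx⟩
    obtain ⟨m, hm, hmy⟩ := h.proj_eq_iff_deckGroup.1 hyx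
    rwa [← apply_mem_universalGeometricPoint hg, ← hmy,
      apply_mem_universalGeometricPoint (h.deckGroup_le hm)]
  · intro hx
    exact ⟨_, (apply_mem_universalGeometricPoint hg).2 hx, rfl⟩

theorem isCompact_range_axisCurve [CompactSpace X] (hP : P ∈ isoNormalizer h.deckGroup)
    {g : Equiv.Perm ℍ} (hg : g ∈ TriangleGroup) : IsCompact (Set.range (h.axisCurve g)) := by
  have hpos := h.axisPeriod_pos
  have e : Set.range (h.axisCurve g) = h.axisCurve g '' Set.Icc 0 h.axisPeriod := by
    refine subset_antisymm ?_ (Set.image_subset_range _ _)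
    rintro _ ⟨x, rfl⟩
    refine ⟨x - ⌊x / h.axisPeriod⌋ * h.axisPeriod, ⟨?_, ?_⟩, ?_⟩
    · have := Int.floor_le (x / h.axisPeriod)
      rw [le_div_iff₀ hpos] at this
      linarith
    · have := Int.lt_floor_add_one (x / h.axisPeriod)
      rw [div_lt_iff₀ hpos] at this
      linarith
    · rw [h.axisCurve_eq_iff hP hg]
      exact ⟨⌊x / h.axisPeriod⌋, by ring⟩
  rw [e]
  exact isCompact_Icc.image (h.continuous_axisCurve hg)

/-! ### Mirrors are images of the axis -/

/-- The component of the fixed point set of a symmetry that contains the image of a fixed point of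
a lift is the image of the fixed point set of this lift. -/
theorem connectedComponentIn_eq [CompactSpace X] [T2Space X] (hP : P ∈ isoNormalizer h.deckGroup)
    {T : X → X} {g : Equiv.Perm ℍ} (hg : g ∈ TriangleGroup)
    (hT : ∀ z, h.proj ((g * P * g⁻¹) z) = T (h.proj z)) (x : ℝ) :
    connectedComponentIn (Function.fixedPoints T) (h.axisCurve g x) =
      Set.range (h.axisCurve g) := by
  have hfix : ∀ y, h.axisCurve g y ∈ Function.fixedPoints T := by
    intro y
    change T (h.proj _) = h.proj _
    rw [← hT, Equiv.Perm.mul_apply, perm_inv_apply, Equiv.Perm.mul_apply, P_ax]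
  have htiso : Isometry (g * P * g⁻¹) := isometry_of_mem_extGroup
    (mul_mem (mul_mem (triangleGroup_le hg) P_mem) (inv_mem (triangleGroup_le hg)))
  have hrange : ∀ z, (g * P * g⁻¹) z = z → h.proj z ∈ Set.range (h.axisCurve g) := by
    intro z hz
    have h1 : P (g⁻¹ z) = g⁻¹ z := by
      apply g.injective
      rw [perm_apply_inv]
      exact hz
    refine ⟨Real.log (g⁻¹ z).im, ?_⟩
    rw [axisCurve, ← eq_ax h1, perm_apply_inv]
  refine subset_antisymm ?_ ?_
  · -- the image of the axis is open in the fixed point set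
    have hopen : ∃ u : Set X, IsOpen u ∧ Set.range (h.axisCurve g) ⊆ u ∧
        u ∩ Function.fixedPoints T ⊆ Set.range (h.axisCurve g) := by
      choose ε hε hinj using h.exists_injOn_ball
      refine ⟨⋃ y : ℝ, h.proj '' Metric.ball (g (ax y)) (ε (g (ax y))),
        isOpen_iUnion fun y => h.isLocalHomeomorph.isOpenMap _ Metric.isOpen_ball, ?_, ?_⟩
      · rintro _ ⟨y, rfl⟩
        exact Set.mem_iUnion.2 ⟨y, _, Metric.mem_ball_self (hε _), rfl⟩
      · rintro p ⟨hp, hpT⟩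
        obtain ⟨y, z, hz, rfl⟩ := Set.mem_iUnion.1 hp
        refine hrange z (hinj _ ?_ hz ?_)
        · have h1 : (g * P * g⁻¹) (g (ax y)) = g (ax y) := by
            rw [Equiv.Perm.mul_apply, perm_inv_apply, Equiv.Perm.mul_apply, P_ax]
          rw [Metric.mem_ball]
          nth_rewrite 1 [← h1]
          rw [htiso.dist_eq]
          exact hz
        · rw [hT]
          exact hpT
    obtain ⟨u, hu, hu1, hu2⟩ := hopen
    have hcl : IsClosed (Set.range (h.axisCurve g)) :=
      (h.isCompact_range_axisCurve hP hg).isClosed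
    have hsub := connectedComponentIn_subset (Function.fixedPoints T) (h.axisCurve g x)
    have hx := mem_connectedComponentIn (hfix x)
    have hpre : IsPreconnected (connectedComponentIn (Function.fixedPoints T) (h.axisCurve g x)) :=
      isPreconnected_connectedComponentIn
    have hor := isPreconnected_iff_subset_of_disjoint.1 hpre u (Set.range (h.axisCurve g))ᶜ hu
      hcl.isOpen_compl
      (fun p _ => by
        by_cases hp : p ∈ Set.range (h.axisCurve g)
        · exact Or.inl (hu1 hp)
        · exact Or.inr hp)
      (by
        rw [Set.eq_empty_iff_forall_notMem]
        rintro p ⟨hp, hpu, hpn⟩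
        exact hpn (hu2 ⟨hpu, hsub hp⟩))
    rcases hor with h1 | h1
    · exact fun p hp => hu2 ⟨h1 hp, hsub hp⟩
    · exact absurd ⟨x, rfl⟩ (h1 hx)
  · refine IsPreconnected.subset_connectedComponentIn
      (isPreconnected_range (h.continuous_axisCurve hg)) ⟨x, rfl⟩ ?_
    rintro _ ⟨y, rfl⟩
    exact hfix y

theorem exists_of_isMirror [CompactSpace X] [T2Space X] [IsManifold 𝓘(ℂ) ω X] {L : Set X}
    (hL : IsMirror L) : P ∈ isoNormalizer h.deckGroup ∧
      ∃ g ∈ TriangleGroup, L = Set.range (h.axisCurve g) := by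
  obtain ⟨T, hT, x, hx, rfl⟩ := hL
  obtain ⟨t, z, rfl, htz, htT, htN, g, hg, hgt⟩ := h.exists_conj_lift_eq_P hT hx
  have hP : P ∈ isoNormalizer h.deckGroup := by
    have hg' := h.triangleGroup_le_isoNormalizer hg
    rw [← hgt]
    exact mul_mem (mul_mem hg' htN) (inv_mem hg')
  have ht : t = g⁻¹ * P * g⁻¹⁻¹ := by rw [← hgt]; group
  refine ⟨hP, g⁻¹, inv_mem hg, ?_⟩
  have hPz : P (g z) = g z := by
    rw [← hgt, Equiv.Perm.mul_apply, perm_inv_apply, Equiv.Perm.mul_apply, htz]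
  have hz : h.proj z = h.axisCurve g⁻¹ (Real.log (g z).im) := by
    rw [axisCurve, ← eq_ax hPz, perm_inv_apply]
  rw [hz, h.connectedComponentIn_eq hP (inv_mem hg) (fun z => by rw [← ht, htT])]

/-- If `P` normalizes the deck group, then it induces a symmetry of the surface. -/
theorem exists_isSymmetry [CompactSpace X] [IsManifold 𝓘(ℂ) ω X]
    (hP : P ∈ isoNormalizer h.deckGroup) :
    ∃ T : X → X, IsSymmetry T ∧ ∀ z, h.proj (P z) = T (h.proj z) := by
  have : IsManifold 𝓘(ℂ) 1 X := IsManifold.of_le (n := ω) le_top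
  set T : X → X := fun x => h.proj (P (Function.surjInv h.surjective x)) with hTdef
  have hT : ∀ z, h.proj (P z) = T (h.proj z) := by
    intro z
    obtain ⟨m, hm, hmz⟩ := h.proj_eq_iff_deckGroup.1
      (Function.surjInv_eq h.surjective (h.proj z))
    have h1 := h.proj_apply ((hP.2 m).1 hm) (P (Function.surjInv h.surjective (h.proj z)))
    rw [Equiv.Perm.mul_apply, perm_inv_apply, Equiv.Perm.mul_apply, hmz] at h1
    exact h1
  have hPc : Continuous P := (isometry_of_mem_extGroup P_mem).continuous
  have hTc : Continuous T := by
    rw [(h.isLocalHomeomorph.isOpenMap.isQuotientMap h.continuous h.surjective).continuous_iff]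
    have : T ∘ h.proj = h.proj ∘ P := funext fun z => (hT z).symm
    rw [this]
    exact h.continuous.comp hPc
  refine ⟨T, ⟨?_, hTc, ?_⟩, hT⟩
  · intro x
    obtain ⟨z, rfl⟩ := h.surjective x
    rw [← hT z, ← hT (P z), ← Equiv.Perm.mul_apply, P_mul_P, Equiv.Perm.one_apply]
  · intro x
    obtain ⟨z, rfl⟩ := h.surjective x
    have hl := h.isLocalDiffeomorph z
    set c₀ := chartAt ℂ (h.proj z) with hc₀
    set c₁ := chartAt ℂ (T (h.proj z)) with hc₁
    -- `F` is the projection near `P z` and `v` is an inverse of the projection near `z`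
    have hF : DifferentiableAt ℂ (fun ζ => c₁ (h.proj (ofComplex ζ))) (P z : ℂ) := by
      refine (UpperHalfPlane.mdifferentiableAt_iff (f := fun w => c₁ (h.proj w))).1 ?_
      have h1 : MDifferentiableAt 𝓘(ℂ) 𝓘(ℂ) c₁ (h.proj (P z)) := by
        rw [hT]
        exact (mdifferentiable_chart _).mdifferentiableAt (mem_chart_source ℂ _)
      exact h1.comp (P z) ((h.isLocalDiffeomorph (P z)).mdifferentiableAt (by simp))
    have hv : DifferentiableAt ℂ (fun ζ => (hl.localInverse (c₀.symm ζ) : ℂ))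
        (c₀ (h.proj z)) := by
      refine mdifferentiableAt_iff_differentiableAt.1 ?_
      have h1 : MDifferentiableAt 𝓘(ℂ) 𝓘(ℂ) c₀.symm (c₀ (h.proj z)) :=
        (mdifferentiable_chart (h.proj z)).mdifferentiableAt_symm (mem_chart_target ℂ _)
      have h3 : MDifferentiableAt 𝓘(ℂ) 𝓘(ℂ) hl.localInverse (c₀.symm (c₀ (h.proj z))) := by
        rw [c₀.left_inv (mem_chart_source ℂ _)]
        exact hl.localInverse_mdifferentiableAt (by simp)
      exact (mdifferentiable_coe _).comp _ (h3.comp _ h1)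
    have hz : hl.localInverse (c₀.symm (c₀ (h.proj z))) = z := by
      rw [c₀.left_inv (mem_chart_source ℂ _), hl.localInverse_left_inv hl.localInverse_mem_target]
    have hFn : DifferentiableAt ℂ (fun ζ => c₁ (h.proj (ofComplex (-ζ))))
        ((starRingEnd ℂ) (z : ℂ)) := by
      refine DifferentiableAt.comp (g := fun ζ => c₁ (h.proj (ofComplex ζ))) _ ?_
        differentiableAt_id.neg
      rw [coe_P] at hF
      exact hF
    have hall := DifferentiableAt.comp (g := (starRingEnd ℂ) ∘
      (fun ζ => c₁ (h.proj (ofComplex (-ζ)))) ∘ (starRingEnd ℂ)) (c₀ (h.proj z)) (by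
        rw [hz]
        have := DifferentiableAt.conj_conj hFn
        rwa [Complex.conj_conj] at this) hv
    refine hall.congr_of_eventuallyEq ?_
    have hcont : ContinuousAt c₀.symm (c₀ (h.proj z)) :=
      c₀.continuousAt_symm (mem_chart_target ℂ _)
    have n1 : ∀ᶠ y in nhds (c₀.symm (c₀ (h.proj z))), y ∈ hl.localInverse.source := by
      rw [c₀.left_inv (mem_chart_source ℂ _)]
      exact hl.localInverse.open_source.mem_nhds hl.localInverse_mem_source
    filter_upwards [hcont.eventually n1] with ζ hζ
    simp only [Function.comp_apply]
    rw [← coe_P, ofComplex_apply, hT, hl.localInverse_right_inv hζ]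

theorem isMirror_range_axisCurve [CompactSpace X] [T2Space X] [IsManifold 𝓘(ℂ) ω X]
    (hP : P ∈ isoNormalizer h.deckGroup) : IsMirror (Set.range (h.axisCurve 1)) := by
  obtain ⟨T, hT, hPT⟩ := h.exists_isSymmetry hP
  have h1 : ∀ z, h.proj ((1 * P * 1⁻¹) z) = T (h.proj z) := by simpa using hPT
  refine ⟨T, hT, h.axisCurve 1 0, ?_, (h.connectedComponentIn_eq hP (one_mem _) h1 0).symm⟩
  change T (h.proj _) = h.proj _
  rw [← hPT]
  congr 1
  exact P_ax 0

end HurwitzMap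

end

section

/-! ### Reparametrizations of a periodic curve -/

/-- A continuous map of the line that induces an injective map from the circle of length `1` to the
circle of length `Λ` is monotone or antitone. -/
theorem strictMono_or_strictAnti_of_periodic {φ : ℝ → ℝ} (hφ : Continuous φ) {Λ : ℝ} (hΛ : 0 < Λ)
    (h : ∀ s s', (∃ n : ℤ, φ s' = φ s + n * Λ) ↔ ∃ n : ℤ, s = s' + n) :
    StrictMono φ ∨ StrictAnti φ := by
  have h1 : ∀ s, ∃ n : ℤ, φ (s + 1) = φ s + n * Λ := fun s => (h _ _).2 ⟨-1, by push_cast; ring⟩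
  choose n hn using h1
  have hcont : Continuous n := by
    rw [Int.isClosedEmbedding_coe_real.isInducing.continuous_iff]
    have e : ((↑) : ℤ → ℝ) ∘ n = fun s => (φ (s + 1) - φ s) / Λ := by
      funext s
      rw [Function.comp_apply, hn, add_sub_cancel_left, mul_div_cancel_right₀ _ hΛ.ne']
    rw [e]
    fun_prop
  have hconst : ∀ s, n s = n 0 := fun s => PreconnectedSpace.constant inferInstance hcont
  -- if `φ` were periodic, it would take the same value at two opposite points of the circle
  have hn0 : n 0 ≠ 0 := by
    intro h0
    have hper : ∀ s, φ (s + 1) = φ s := fun s => by rw [hn, hconst, h0]; simp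
    have hψ : Continuous fun s => φ (s + 1 / 2) - φ s := by fun_prop
    have hanti : φ ((1 / 2 : ℝ) + 1 / 2) - φ (1 / 2) = -(φ (0 + 1 / 2) - φ 0) := by
      have := hper 0
      norm_num at this ⊢
      linarith
    obtain ⟨s, hs⟩ : ∃ s, φ (s + 1 / 2) - φ s = 0 := by
      rcases le_total 0 (φ (0 + 1 / 2) - φ 0) with h2 | h2
      · exact mem_range_of_exists_le_of_exists_ge hψ ⟨1 / 2, by simp only [hanti]; linarith⟩ ⟨0, h2⟩
      · exact mem_range_of_exists_le_of_exists_ge hψ ⟨0, h2⟩ ⟨1 / 2, by simp only [hanti]; linarith⟩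
    obtain ⟨k, hk⟩ := (h s (s + 1 / 2)).1 ⟨0, by simp; linarith⟩
    have h3 : (2 * k + 1 : ℝ) = 0 := by linarith
    have h4 : (2 * k + 1 : ℤ) = 0 := by exact_mod_cast h3
    omega
  have hnat : ∀ (k : ℕ) s, φ (s + k) = φ s + k * n 0 * Λ := by
    intro k
    induction k with
    | zero => simp
    | succ k ih =>
      intro s
      push_cast
      rw [← add_assoc, hn, hconst, ih]
      ring
  refine hφ.strictMono_of_inj fun s s' hss => ?_
  obtain ⟨k, hk⟩ := (h s s').1 ⟨0, by simp [hss]⟩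
  have hk0 : k = 0 := by
    have hz : ((k.natAbs : ℝ) * n 0) * Λ = 0 := by
      rcases Int.natAbs_eq k with h2 | h2
      · have h3 := hnat k.natAbs s'
        have h4 : (k : ℝ) = k.natAbs := by rw [← Int.cast_natCast, ← h2]
        rw [← h4, ← hk, hss, h4] at h3
        linarith
      · have h3 := hnat k.natAbs s
        have h4 : (k : ℝ) = -k.natAbs := by rw [← Int.cast_natCast, ← Int.cast_neg, ← h2]
        have h5 : s + k.natAbs = s' := by rw [h4] at hk; linarith
        rw [h5, ← hss] at h3
        linarith
    rcases mul_eq_zero.1 hz with h2 | h2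
    · rcases mul_eq_zero.1 h2 with h3 | h3
      · have : k.natAbs = 0 := by exact_mod_cast h3
        exact Int.natAbs_eq_zero.1 this
      · exact absurd (by exact_mod_cast h3) hn0
    · exact absurd h2 hΛ.ne'
  rw [hk, hk0]
  simp

theorem apply_add_one_of_strictMono {φ : ℝ → ℝ} (hφ : Continuous φ) (hmono : StrictMono φ) {Λ : ℝ}
    (hΛ : 0 < Λ) (h : ∀ s s', (∃ n : ℤ, φ s' = φ s + n * Λ) ↔ ∃ n : ℤ, s = s' + n) (s : ℝ) :
    φ (s + 1) = φ s + Λ := by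
  obtain ⟨d, hd⟩ := (h s (s + 1)).2 ⟨-1, by push_cast; ring⟩
  have hd1 : 1 ≤ d := by
    have h1 := hmono (lt_add_one s)
    rw [hd] at h1
    have h2 : (0 : ℝ) < d := by
      by_contra! hneg
      nlinarith
    exact_mod_cast h2
  have hd1' : (1 : ℝ) ≤ d := by exact_mod_cast hd1
  obtain ⟨s', hs', hφs'⟩ := intermediate_value_Icc (lt_add_one s).le hφ.continuousOn
    (show φ s + Λ ∈ Set.Icc (φ s) (φ (s + 1)) from ⟨by linarith, by rw [hd]; nlinarith⟩)
  obtain ⟨k, hk⟩ := (h s s').1 ⟨1, by rw [hφs']; simp⟩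
  have e : s' = s + 1 := by
    have h0 : s < s' := hmono.lt_iff_lt.1 (by rw [hφs']; linarith)
    have h2 : (-1 : ℝ) ≤ k := by linarith [hs'.2]
    have h3 : (k : ℝ) < 0 := by linarith
    have h4 : (-1 : ℤ) ≤ k := by exact_mod_cast h2
    have h5 : k < 0 := by exact_mod_cast h3
    have h6 : k = -1 := by omega
    rw [h6] at hk
    push_cast at hk
    linarith
  rw [← e, hφs']

/-! ### The patterns of the mirrors -/

theorem getElem?_flatten_replicate {α : Type*} (u : List α) (N i : ℕ) (hi : i < N * u.length) :
    (List.replicate N u).flatten[i]? = u[i % u.length]? := by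
  induction N generalizing i with
  | zero => simp at hi
  | succ N ih =>
    rw [List.replicate_succ, List.flatten_cons, List.getElem?_append]
    split_ifs with h
    · rw [Nat.mod_eq_of_lt h]
    · push Not at h
      rw [ih _ (by rw [Nat.succ_mul] at hi; omega), ← Nat.mod_eq_sub_mod h]

theorem length_flatten_replicate {α : Type*} (u : List α) (N : ℕ) :
    (List.replicate N u).flatten.length = N * u.length := by
  simp

theorem residue_eq_iff (j : ℤ) (r : Fin 6) : residue j = r ↔ j % 6 = (r : ℕ) := by
  obtain ⟨q, r', rfl⟩ := exists_eq_six_mul_add j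
  rw [residue_add, Int.mul_add_emod_self_left, Int.emod_eq_of_lt (by omega) (by omega),
    Fin.ext_iff]
  omega

/-- The labels along the axis have the minimal period `6`. -/
theorem six_dvd_of_axisLabel_periodic {k₀ : ℤ} {p : ℕ}
    (h : ∀ j : ℕ, axisLabel (k₀ + (j + p : ℕ)) = axisLabel (k₀ + j)) : 6 ∣ p := by
  have key : ∀ r s : Fin 6, (∀ j : Fin 6, baseLabel (r + (j + s)) = baseLabel (r + j)) → s = 0 := by
    unfold baseLabel
    decide
  have hres : ∀ a b : ℤ, residue (a + b) = residue a + residue b := by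
    intro a b
    change ((((a + b : ℤ) : ZMod 6)) : ZMod 6) = _
    rw [Int.cast_add]
    rfl
  have hs := key (residue k₀) (residue p) fun j => by
    have := h j
    unfold axisLabel at this
    have e : residue ((j : ℕ) : ℤ) = j := by
      have := residue_add 0 j
      rwa [mul_zero, zero_add] at this
    rw [hres, hres, Nat.cast_add, hres, e] at this
    exact this
  have := (residue_eq_iff _ _).1 hs
  simp only [Fin.val_zero] at this
  omega

/-- The word that is read in one period of the axis. -/
def baseWord : List (Fin 3) := [1, 2, 0, 1, 0, 2]

theorem baseWord_getElem? (i : ℕ) (hi : i < 6) : baseWord[i]? = some (axisLabel i) := by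
  have := axisLabel_add 0 ⟨i, hi⟩
  rw [mul_zero, zero_add] at this
  rw [this]
  interval_cases i <;> rfl

theorem eq_flatten_take {u : List (Fin 3)} {p : ℕ} (hp : p ∣ u.length) (hp0 : 0 < p)
    (h : ∀ i, i < u.length → u[i]? = u[i % p]?) :
    u = (List.replicate (u.length / p) (u.take p)).flatten := by
  rcases Nat.eq_zero_or_pos u.length with h0 | hpos
  · rw [h0]
    simpa using h0
  have hle : p ≤ u.length := Nat.le_of_dvd hpos hp
  have htake : (u.take p).length = p := by simp [hle]
  have hlen : u.length / p * (u.take p).length = u.length := by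
    rw [htake, Nat.div_mul_cancel hp]
  apply List.ext_getElem?
  intro i
  rcases lt_or_ge i u.length with hi | hi
  · rw [getElem?_flatten_replicate _ _ _ (by rwa [hlen]), htake, List.getElem?_take,
      if_pos (Nat.mod_lt _ hp0), h i hi]
  · rw [List.getElem?_eq_none hi, List.getElem?_eq_none]
    rwa [length_flatten_replicate, hlen]

theorem isPrimitiveWord_baseWord : IsPrimitiveWord baseWord := by
  intro v k hv
  have hlen : 6 = k * v.length := by
    have := congrArg List.length hv
    rwa [length_flatten_replicate] at this
  have h6 : 6 ∣ v.length := by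
    refine six_dvd_of_axisLabel_periodic (k₀ := 0) fun j => ?_
    have e : ∀ i : ℕ, axisLabel (0 + (i : ℕ)) = axisLabel ((i % 6 : ℕ) : ℤ) := by
      intro i
      rw [zero_add, ← axisLabel_add_six_mul ((i % 6 : ℕ) : ℤ) ((i / 6 : ℕ) : ℤ)]
      congr 1
      omega
    have e2 : ∀ i : ℕ, some (axisLabel ((i % 6 : ℕ) : ℤ)) = v[i % v.length]? := by
      intro i
      have hi : i % 6 < 6 := Nat.mod_lt _ (by norm_num)
      rw [← baseWord_getElem? _ hi, hv, getElem?_flatten_replicate _ _ _ (by rwa [← hlen]),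
        Nat.mod_mod_of_dvd _ (Dvd.intro_left k hlen.symm)]
    rw [e, e]
    apply Option.some_injective
    rw [e2, e2, Nat.add_mod_right]
  obtain ⟨c, hc⟩ := h6
  rw [hc] at hlen
  have : k * c = 1 := by nlinarith
  exact Nat.eq_one_of_mul_eq_one_right this

/-- A primitive word whose `N`-th power is read along `6 * K` consecutive geometric points of the
axis has length `6`, so that `N = K`. -/
theorem eq_of_isPrimitiveWord {u : List (Fin 3)} (hu : IsPrimitiveWord u) {N K : ℕ} (hK : 0 < K)
    (hlen : N * u.length = 6 * K) {k₀ : ℤ}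
    (h : ∀ i, i < 6 * K → (List.replicate N u).flatten[i]? = some (axisLabel (k₀ + i))) :
    N = K := by
  have hN : 0 < N := by
    rcases Nat.eq_zero_or_pos N with h0 | h0
    · rw [h0] at hlen; omega
    · exact h0
  have hpos : 0 < u.length := by
    rcases Nat.eq_zero_or_pos u.length with h0 | h0
    · rw [h0] at hlen; omega
    · exact h0
  have hall : ∀ i : ℕ, u[i % u.length]? = some (axisLabel (k₀ + i)) := by
    intro i
    have hi : i % (6 * K) < 6 * K := Nat.mod_lt _ (by omega)
    have h1 := h _ hi
    rw [getElem?_flatten_replicate _ _ _ (by rwa [hlen]),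
      Nat.mod_mod_of_dvd _ (Dvd.intro_left N hlen)] at h1
    rw [h1, ← axisLabel_add_six_mul (k₀ + ((i % (6 * K) : ℕ) : ℤ)) (K * ((i / (6 * K) : ℕ) : ℤ))]
    congr 2
    have := Nat.mod_add_div i (6 * K)
    have h2 : ((i % (6 * K) : ℕ) : ℤ) + 6 * K * ((i / (6 * K) : ℕ) : ℤ) = i := by
      exact_mod_cast this
    linarith
  have h6 : 6 ∣ u.length := by
    refine six_dvd_of_axisLabel_periodic (k₀ := k₀) fun j => ?_
    apply Option.some_injective
    rw [← hall, ← hall, Nat.add_mod_right]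
  have hu6 := hu _ _ (eq_flatten_take h6 (by norm_num) fun i hi => by
    have e1 := hall i
    have e2 := hall (i % 6)
    rw [Nat.mod_eq_of_lt hi] at e1
    rw [Nat.mod_eq_of_lt (lt_of_le_of_lt (Nat.mod_le _ _) hi)] at e2
    rw [e1, e2, ← axisLabel_add_six_mul (k₀ + ((i % 6 : ℕ) : ℤ)) ((i / 6 : ℕ) : ℤ)]
    congr 2
    omega)
  have hu' : u.length = 6 := by
    have := Nat.div_mul_cancel h6
    omega
  rw [hu'] at hlen
  omega

namespace HurwitzMap

variable {X : Type*} [TopologicalSpace X] [ChartedSpace ℂ X] (h : HurwitzMap X)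

/-- A parametrization of a mirror by the circle lifts to a monotone map to a geodesic. -/
theorem exists_strictMono_lift [CompactSpace X] (hP : P ∈ isoNormalizer h.deckGroup)
    {g : Equiv.Perm ℍ} (hg : g ∈ TriangleGroup) {γ : ℝ → X} (hγ : Continuous γ)
    (hper : ∀ s s' : ℝ, γ s = γ s' ↔ ∃ n : ℤ, s = s' + n)
    (hrange : Set.range γ = Set.range (h.axisCurve g)) :
    ∃ g' ∈ TriangleGroup, ∃ φ : ℝ → ℝ, Continuous φ ∧ StrictMono φ ∧ (∀ s, φ (s + 1) = φ s + h.axisPeriod) ∧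
      ∀ s, γ s = h.axisCurve g' (φ s) := by
  have hgc := (isometry_of_mem_triangleGroup (inv_mem hg)).continuous
  obtain ⟨x₀, hx₀⟩ : γ 0 ∈ Set.range (h.axisCurve g) := hrange ▸ ⟨0, rfl⟩
  obtain ⟨F, ⟨hF0, hF⟩, -⟩ := h.isCoveringMap.existsUnique_continuousMap_lifts ⟨γ, hγ⟩ (0 : ℝ)
    (g (ax x₀)) hx₀
  have hF' : ∀ s, h.proj (F s) = γ s := congrFun hF
  -- the reflected lift is again a lift, and so the lift stays on the axis
  have hPF : (fun s => g (P (g⁻¹ (F s)))) = F := by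
    refine h.eq_of_proj_eq ((isometry_of_mem_triangleGroup hg).continuous.comp
      ((isometry_of_mem_extGroup P_mem).continuous.comp (hgc.comp F.continuous))) F.continuous
      (fun s => ?_) 0 ?_
    · obtain ⟨y, hy⟩ : γ s ∈ Set.range (h.axisCurve g) := hrange ▸ ⟨s, rfl⟩
      rw [hF']
      rw [← hF', axisCurve] at hy
      obtain ⟨m, hm, hmy⟩ := h.proj_eq_iff_deckGroup.1 hy
      have hm' := (hP.2 _).1 (h.inv_mul_mul_mem_deckGroup hg hm)
      have h1 := h.proj_apply (h.conj_mem_deckGroup hg hm') (g (ax y))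
      simp only [Equiv.Perm.mul_apply, perm_inv_apply, P_inv, P_ax] at h1
      rw [hmy] at h1
      rw [h1, ← hF', hy]
    · rw [hF0, perm_inv_apply, P_ax]
  have hφ : ∀ s, F s = g (ax (Real.log (g⁻¹ (F s)).im)) := by
    intro s
    have h1 : P (g⁻¹ (F s)) = g⁻¹ (F s) := by
      apply g.injective
      rw [perm_apply_inv]
      exact congrFun hPF s
    rw [← eq_ax h1, perm_apply_inv]
  set φ : ℝ → ℝ := fun s => Real.log (g⁻¹ (F s)).im with hφdef
  have hφc : Continuous φ :=
    (UpperHalfPlane.continuous_im.comp (hgc.comp F.continuous)).log fun s => (im_pos _).ne'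
  have hγφ : ∀ s, γ s = h.axisCurve g (φ s) := fun s => by rw [← hF', hφ s]; rfl
  have hΛ := h.axisPeriod_pos
  have hiff : ∀ s s', (∃ n : ℤ, φ s' = φ s + n * h.axisPeriod) ↔ ∃ n : ℤ, s = s' + n := by
    intro s s'
    rw [← hper, hγφ, hγφ, h.axisCurve_eq_iff hP hg]
  rcases strictMono_or_strictAnti_of_periodic hφc hΛ hiff with hm | hm
  · exact ⟨g, hg, φ, hφc, hm, apply_add_one_of_strictMono hφc hm hΛ hiff, hγφ⟩
  · -- the half-turn `A` reverses the axis
    refine ⟨g * rotA, mul_mem hg rotA_mem, fun s => -φ s, hφc.neg, hm.neg,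
      apply_add_one_of_strictMono hφc.neg hm.neg hΛ fun s s' => ?_, fun s => ?_⟩
    · rw [← hiff]
      constructor
      · rintro ⟨n, hn⟩
        rw [Pi.neg_apply, Pi.neg_apply] at hn
        exact ⟨-n, by push_cast; linarith⟩
      · rintro ⟨n, hn⟩
        refine ⟨-n, ?_⟩
        rw [Pi.neg_apply, Pi.neg_apply, hn]
        push_cast
        ring
    · rw [hγφ, axisCurve, axisCurve, Equiv.Perm.mul_apply, rotA_ax, neg_neg]

/-- All patterns of a mirror are read along one period of the axis. -/
theorem exists_of_isPattern [CompactSpace X] (hP : P ∈ isoNormalizer h.deckGroup)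
    {g : Equiv.Perm ℍ} (hg : g ∈ TriangleGroup) {w : List (Fin 3)}
    (hw : h.IsPattern (Set.range (h.axisCurve g)) w) :
    ∃ k₀ : ℤ, w.length = 6 * h.translationOrder ∧
      ∀ i, i < 6 * h.translationOrder → w[i]? = some (axisLabel (k₀ + i)) := by
  obtain ⟨γ, hγ, hper, hrange, t, ht, htr, htw⟩ := hw
  obtain ⟨g', hg', φ, hφc, hmono, hadd, hγφ⟩ := h.exists_strictMono_lift hP hg hγ hper hrange
  have hpos := h.isDiscreteOver.axisPos_strictMono
  have hΛ := h.axisPeriod_pos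
  have hmem : ∀ s i, γ s ∈ h.geometricPoint i ↔ ∃ k, axisPos k = φ s ∧ axisLabel k = i := by
    intro s i
    rw [hγφ, h.axisCurve_mem_geometricPoint hg', h.isDiscreteOver.ax_mem_iff]
  have hk : ∀ j, ∃ k, axisPos k = φ (t j) ∧ axisLabel k = w.get j := fun j => (hmem _ _).1 (htw j)
  choose k hk1 hk2 using hk
  have hkmono : StrictMono k := fun i j hij => hpos.lt_iff_lt.1 (by
    rw [hk1, hk1]; exact hmono (ht hij))
  have hKpos : ∀ j : ℤ, axisPos (j + 6 * h.translationOrder) = axisPos j + h.axisPeriod := by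
    intro j
    rw [axisPos_add_six_mul, axisPeriod]
    push_cast
    ring
  have hφ1 : φ 1 = φ 0 + h.axisPeriod := by simpa using hadd 0
  -- `k₀` is the index of the first geometric point after the start
  obtain ⟨k₀, hk₀⟩ : ∃ k₀ : ℤ, ∀ k, φ 0 ≤ axisPos k ↔ k₀ ≤ k := by
    have hl := h.isDiscreteOver.translationLength_pos
    have h6 : ∀ q : ℤ, axisPos (6 * q) = x₃ + q * translationLength := by
      intro q
      have := axisPos_add q 0
      simpa [basePos] using this
    obtain ⟨q, hq⟩ := exists_int_gt ((φ 0 - x₃) / translationLength)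
    obtain ⟨q', hq'⟩ := exists_int_lt ((φ 0 - x₃) / translationLength)
    rw [div_lt_iff₀ hl] at hq
    rw [lt_div_iff₀ hl] at hq'
    obtain ⟨k₀, h1, h2⟩ := Int.exists_least_of_bdd (P := fun k => φ 0 ≤ axisPos k)
      ⟨6 * q', fun k hk => by
        rw [← hpos.le_iff_le]
        refine le_trans ?_ hk
        rw [h6]
        linarith⟩ ⟨6 * q, by rw [h6]; linarith⟩
    exact ⟨k₀, fun k => ⟨h2 k, fun hk => h1.trans (hpos.monotone hk)⟩⟩
  have hkrange : Set.range k = Set.Ico k₀ (k₀ + 6 * h.translationOrder) := by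
    ext j
    have hj : j < k₀ + 6 * h.translationOrder ↔ axisPos j < φ 0 + h.axisPeriod := by
      have e1 := hk₀ (j - 6 * h.translationOrder)
      have e2 := hKpos (j - 6 * h.translationOrder)
      rw [sub_add_cancel] at e2
      constructor
      · intro hlt
        by_contra! hge
        have := e1.1 (by linarith)
        linarith
      · intro hlt
        by_contra! hge
        have := e1.2 (by linarith)
        linarith
    rw [Set.mem_Ico, ← hk₀, hj]
    constructor
    · rintro ⟨i, rfl⟩
      obtain ⟨⟨h0, h1⟩, -⟩ : t i ∈ {s | s ∈ Set.Ico (0 : ℝ) 1 ∧ ∃ i, γ s ∈ h.geometricPoint i} :=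
        htr ▸ ⟨i, rfl⟩
      rw [hk1, ← hφ1]
      exact ⟨hmono.monotone h0, hmono h1⟩
    · rintro ⟨h0, h1⟩
      obtain ⟨s, hs, hsj⟩ := intermediate_value_Icc (zero_le_one' ℝ) hφc.continuousOn
        (show axisPos j ∈ Set.Icc (φ 0) (φ 1) from ⟨h0, by rw [hφ1]; exact h1.le⟩)
      have hs1 : s < 1 := hmono.lt_iff_lt.1 (by rw [hsj, hφ1]; exact h1)
      obtain ⟨i, hi⟩ : s ∈ Set.range t := by
        rw [htr]
        exact ⟨⟨hs.1, hs1⟩, _, (hmem s _).2 ⟨j, hsj.symm, rfl⟩⟩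
      refine ⟨i, hpos.injective ?_⟩
      rw [hk1, hi, hsj]
  have hlen : w.length = 6 * h.translationOrder := by
    have h1 : (Finset.univ.image k) = Finset.Ico k₀ (k₀ + 6 * h.translationOrder) := by
      apply Finset.coe_injective
      simp [hkrange]
    have h2 := congrArg Finset.card h1
    rw [Finset.card_image_of_injective _ hkmono.injective, Int.card_Ico, Finset.card_univ,
      Fintype.card_fin] at h2
    omega
  have hkeq : k = fun j : Fin w.length => k₀ + (j : ℕ) := by
    refine (hkmono.range_inj (fun i j hij => by simpa using hij)).1 ?_
    rw [hkrange]
    ext j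
    simp only [Set.mem_Ico, Set.mem_range]
    constructor
    · rintro ⟨h0, h1⟩
      exact ⟨⟨(j - k₀).toNat, by omega⟩, by simp only; omega⟩
    · rintro ⟨i, rfl⟩
      have := i.2
      omega
  refine ⟨k₀, hlen, fun i hi => ?_⟩
  have hi' : i < w.length := by omega
  have := hk2 ⟨i, hi'⟩
  rw [hkeq] at this
  rw [List.getElem?_eq_getElem hi']
  exact congrArg some this.symm

theorem isPattern_axisCurve [CompactSpace X] (hP : P ∈ isoNormalizer h.deckGroup)
    {g : Equiv.Perm ℍ} (hg : g ∈ TriangleGroup) :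
    h.IsPattern (Set.range (h.axisCurve g))
      (List.replicate h.translationOrder baseWord).flatten := by
  have hΛ := h.axisPeriod_pos
  have hpos := h.isDiscreteOver.axisPos_strictMono
  have hlen : (List.replicate h.translationOrder baseWord).flatten.length =
      6 * h.translationOrder := by
    rw [length_flatten_replicate, mul_comm]
    rfl
  have hx₃ : axisPos 0 = x₃ := by
    have := axisPos_add 0 0
    simpa [basePos] using this
  have hend : axisPos (6 * h.translationOrder) = x₃ + h.axisPeriod := by
    have := axisPos_add_six_mul 0 h.translationOrder
    rw [zero_add] at this
    rw [this, hx₃, axisPeriod]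
    push_cast
    rfl
  have hmem : ∀ s i, h.axisCurve g (x₃ + s * h.axisPeriod) ∈ h.geometricPoint i ↔
      ∃ k, axisPos k = x₃ + s * h.axisPeriod ∧ axisLabel k = i := by
    intro s i
    rw [h.axisCurve_mem_geometricPoint hg, h.isDiscreteOver.ax_mem_iff]
  refine ⟨fun s => h.axisCurve g (x₃ + s * h.axisPeriod),
    (h.continuous_axisCurve hg).comp (by fun_prop), fun s s' => ?_, ?_,
    fun j => (axisPos (j : ℕ) - x₃) / h.axisPeriod, ?_, ?_, ?_⟩
  · rw [h.axisCurve_eq_iff hP hg]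
    constructor
    · rintro ⟨n, hn⟩
      refine ⟨-n, ?_⟩
      have : (s' - s - n) * h.axisPeriod = 0 := by linarith
      rcases mul_eq_zero.1 this with h1 | h1
      · push_cast; linarith
      · exact absurd h1 hΛ.ne'
    · rintro ⟨n, rfl⟩
      exact ⟨-n, by push_cast; ring⟩
  · refine subset_antisymm ?_ ?_
    · rintro _ ⟨s, rfl⟩
      exact ⟨_, rfl⟩
    · rintro _ ⟨x, rfl⟩
      refine ⟨(x - x₃) / h.axisPeriod, ?_⟩
      simp only
      rw [div_mul_cancel₀ _ hΛ.ne']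
      congr 1
      ring
  · intro i j hij
    have h1 : axisPos ((i : ℕ) : ℤ) < axisPos ((j : ℕ) : ℤ) := hpos (by exact_mod_cast hij)
    simp only
    gcongr
  · ext s
    constructor
    · rintro ⟨j, rfl⟩
      have hj := j.2
      have h0 : axisPos 0 ≤ axisPos ((j : ℕ) : ℤ) := hpos.monotone (by positivity)
      have h1 : axisPos ((j : ℕ) : ℤ) < axisPos (6 * h.translationOrder) := hpos (by omega)
      refine ⟨⟨?_, ?_⟩, axisLabel (j : ℕ), ?_⟩
      · simp only
        exact div_nonneg (by linarith) hΛ.le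
      · simp only
        rw [div_lt_one hΛ]
        linarith
      · rw [hmem]
        refine ⟨(j : ℕ), ?_, rfl⟩
        rw [div_mul_cancel₀ _ hΛ.ne']
        ring
    · rintro ⟨⟨h0, h1⟩, i, hi⟩
      obtain ⟨k, hk, -⟩ := (hmem s i).1 hi
      have hk0 : 0 ≤ k := by
        rw [← hpos.le_iff_le, hk, hx₃]
        have := mul_nonneg h0 hΛ.le
        linarith
      have hk1 : k < 6 * h.translationOrder := by
        rw [← hpos.lt_iff_lt, hk, hend]
        nlinarith
      refine ⟨⟨k.toNat, by omega⟩, ?_⟩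
      simp only
      rw [Int.toNat_of_nonneg hk0, hk, div_eq_iff hΛ.ne']
      ring
  · intro j
    rw [hmem]
    refine ⟨(j : ℕ), ?_, ?_⟩
    · rw [div_mul_cancel₀ _ hΛ.ne']
      ring
    · apply Option.some_injective
      have hj := j.2
      have hj' : (j : ℕ) < h.translationOrder * baseWord.length :=
        hj.trans_eq (length_flatten_replicate _ _)
      rw [List.get_eq_getElem, ← List.getElem?_eq_getElem, getElem?_flatten_replicate _ _ _ hj']
      change _ = baseWord[(j : ℕ) % 6]?
      rw [baseWord_getElem? _ (Nat.mod_lt _ (by norm_num)),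
        ← axisLabel_add_six_mul (((j : ℕ) % 6 : ℕ) : ℤ) (((j : ℕ) / 6 : ℕ) : ℤ)]
      congr 2
      omega

/-- The link index of a mirror is the order of `axisTranslation` modulo the deck group. -/
theorem mirrorHasLinkIndex_iff [CompactSpace X] (hP : P ∈ isoNormalizer h.deckGroup)
    {g : Equiv.Perm ℍ} (hg : g ∈ TriangleGroup) (N : ℕ) :
    h.MirrorHasLinkIndex (Set.range (h.axisCurve g)) N ↔ N = h.translationOrder := by
  constructor
  · rintro ⟨u, hu, hpat⟩
    obtain ⟨k₀, hlen, hk₀⟩ := h.exists_of_isPattern hP hg hpat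
    rw [length_flatten_replicate] at hlen
    exact eq_of_isPrimitiveWord hu h.translationOrder_pos hlen hk₀
  · rintro rfl
    exact ⟨baseWord, isPrimitiveWord_baseWord, h.isPattern_axisCurve hP hg⟩

theorem mirrorHasLinkIndex_iff_of_isMirror [CompactSpace X] [T2Space X] [IsManifold 𝓘(ℂ) ω X]
    {L : Set X} (hL : IsMirror L) (N : ℕ) :
    h.MirrorHasLinkIndex L N ↔ N = h.translationOrder := by
  obtain ⟨hP, g, hg, rfl⟩ := h.exists_of_isMirror hL
  exact h.mirrorHasLinkIndex_iff hP hg N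

theorem hasLinkIndex_iff [CompactSpace X] [T2Space X] [IsManifold 𝓘(ℂ) ω X] (N : ℕ) :
    h.HasLinkIndex N ↔ P ∈ isoNormalizer h.deckGroup ∧ N = h.translationOrder := by
  constructor
  · rintro ⟨L, hL, hN⟩
    exact ⟨(h.exists_of_isMirror hL).1, (h.mirrorHasLinkIndex_iff_of_isMirror hL N).1 hN⟩
  · rintro ⟨hP, rfl⟩
    exact ⟨_, h.isMirror_range_axisCurve hP, (h.mirrorHasLinkIndex_iff hP (one_mem _) _).2 rfl⟩

end HurwitzMap

end

section

/-! ### Verified coset enumeration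

A computation in the style of Todd and Coxeter bounds the index of a subgroup of a group with two
generators `a`, `b`, `a ^ 2 = 1`. The tables below are evaluated by the kernel; what is proved about
them is only that every entry of a table is a true statement about the action of the group. -/

namespace CosetEnumeration

/-- The letters `a`, `b`, `b⁻¹`; as `a ^ 2 = 1`, the letter `a` is its own inverse. -/
inductive Letter
  | a
  | b
  | b'

namespace Letter

/-- The inverse letter. -/
def inv : Letter → Letter
  | a => a
  | b => b'
  | b' => b

/-- The index of a letter in a row of a coset table. -/
def idx : Letter → ℕ
  | a => 0
  | b => 1
  | b' => 2

/-- The element of a group named by a letter. -/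
def eval {G : Type*} [Group G] (x y : G) : Letter → G
  | a => x
  | b => y
  | b' => y⁻¹

theorem eval_inv {G : Type*} [Group G] {x y : G} (hx : x ^ 2 = 1) (l : Letter) :
    l.inv.eval x y = (l.eval x y)⁻¹ := by
  cases l
  · exact eq_inv_of_mul_eq_one_left (by rw [← hx, sq]; rfl)
  · rfl
  · exact (inv_inv y).symm

end Letter

/-- The value of a word; the first letter is the one that acts first. -/
def wordEval {G : Type*} [Group G] (x y : G) : List Letter → G
  | [] => 1
  | l :: w => wordEval x y w * l.eval x y

theorem wordEval_append {G : Type*} [Group G] (x y : G) (u w : List Letter) :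
    wordEval x y (u ++ w) = wordEval x y w * wordEval x y u := by
  induction u with
  | nil => simp [wordEval]
  | cons l u ih => simp [wordEval, ih, mul_assoc]

theorem wordEval_reverse_inv {G : Type*} [Group G] {x y : G} (hx : x ^ 2 = 1) (w : List Letter) :
    wordEval x y (w.reverse.map Letter.inv) = (wordEval x y w)⁻¹ := by
  induction w with
  | nil => simp [wordEval]
  | cons l w ih =>
    rw [List.reverse_cons, List.map_append, wordEval_append, ih]
    simp [wordEval, Letter.eval_inv hx]

/-- A partial map from `ℕ` to `ℕ`, encoded in one natural number, on which the kernel computes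
fast: the binary digits `10 * k`, …, `10 * k + 9` are those of `0` if there is no value at `k`, and of
`y + 1` if the value is `y`. -/
abbrev Table : Type := ℕ

namespace Table

/-- The empty table. -/
def empty : Table := (0 : ℕ)

/-- The ten binary digits that belong to the key `k`. -/
def field (t : Table) (k : ℕ) : ℕ := Nat.shiftRight t (10 * k) % 1024

/-- The entry at the key `k`. -/
def get (t : Table) (k : ℕ) : Option ℕ :=
  match t.field k with
  | 0 => none
  | y + 1 => some y

/-- Overwrites the entry at the key `k`; values that are too large are ignored. -/
def set (t : Table) (k y : ℕ) : Table :=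
  bif (y + 1).blt 1024 then Nat.xor t (Nat.shiftLeft (Nat.xor (t.field k) (y + 1)) (10 * k)) else t

theorem get_empty (k : ℕ) : empty.get k = none := by
  have : empty.field k = 0 := by
    change (0 >>> (10 * k)) % 1024 = 0
    rw [Nat.zero_shiftRight]
  rw [get, this]

theorem field_set {t : Table} {k k' y : ℕ} (hy : y + 1 < 1024) :
    (t.set k y).field k' = if k' = k then y + 1 else t.field k' := by
  have hset : t.set k y = ((t : ℕ) ^^^ (((t.field k) ^^^ (y + 1)) <<< (10 * k)) : ℕ) := by
    rw [set, Nat.blt_eq.mpr hy, cond_true]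
    rfl
  have hf : ∀ (s : Table) (m : ℕ), field s m = (s >>> (10 * m)) % 2 ^ 10 := fun _ _ => rfl
  have hd : (t.field k) ^^^ (y + 1) < 2 ^ 10 := by
    refine Nat.xor_lt_two_pow ?_ hy
    rw [hf]
    exact Nat.mod_lt _ (by norm_num)
  rw [hset, hf]
  apply Nat.eq_of_testBit_eq
  intro i
  rw [Nat.testBit_mod_two_pow, Nat.testBit_shiftRight, Nat.testBit_xor, Nat.testBit_shiftLeft]
  rcases lt_trichotomy k' k with hk | rfl | hk
  · rw [if_neg hk.ne, hf t k', Nat.testBit_mod_two_pow, Nat.testBit_shiftRight]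
    by_cases hi : i < 10
    · have : ¬ (10 * k' + i ≥ 10 * k) := by omega
      simp [this]
    · simp [hi]
  · rw [if_pos rfl, Nat.testBit_xor, hf, Nat.testBit_mod_two_pow, Nat.testBit_shiftRight]
    by_cases hi : i < 10
    · have : 10 * k' + i ≥ 10 * k' := by omega
      simp [hi]
    · have : (y + 1).testBit i = false :=
        Nat.testBit_lt_two_pow (hy.trans_le (Nat.pow_le_pow_right (by norm_num : 0 < 2) (not_lt.1 hi)))
      rw [this]
      simp [hi]
  · rw [if_neg hk.ne', hf t k', Nat.testBit_mod_two_pow, Nat.testBit_shiftRight]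
    have : ((t.field k) ^^^ (y + 1)).testBit (10 * k' + i - 10 * k) = false :=
      Nat.testBit_lt_two_pow (hd.trans_le (Nat.pow_le_pow_right (by norm_num : 0 < 2) (by omega)))
    rw [this]
    simp

theorem get_set {t : Table} {k k' y u : ℕ} (h : (t.set k y).get k' = some u) :
    t.get k' = some u ∨ k' = k ∧ u = y := by
  by_cases hy : y + 1 < 1024
  · by_cases hk : k' = k
    · right
      rw [get, field_set hy, if_pos hk] at h
      exact ⟨hk, (Option.some.inj h).symm⟩
    · left
      rwa [get, field_set hy, if_neg hk] at h
  · left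
    have hb : (y + 1).blt 1024 = false := Bool.eq_false_iff.2 fun hb => hy (Nat.blt_eq.mp hb)
    have : t.set k y = t := by
      rw [set, hb, cond_false]
    rwa [this] at h

/-- The image of the coset `x` under the letter `l`, if the table has it. -/
def look (t : Table) (l : Letter) (x : ℕ) : Option ℕ := t.get (3 * x + l.idx)

/-- Records that the letter `l` takes the coset `x` to `y`. -/
def put (t : Table) (l : Letter) (x y : ℕ) : Table := t.set (3 * x + l.idx) y

/-- Records that `l` takes `x` to `y`, and the inverse of `l` takes `y` to `x`. -/
def link (t : Table) (l : Letter) (x y : ℕ) : Table := (t.put l x y).put l.inv y x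

/-- The image of the coset `x` under a word, if the table has all the intermediate steps. -/
def trace (t : Table) : List Letter → ℕ → Option ℕ
  | [], x => some x
  | l :: w, x => match t.look l x with
    | none => none
    | some y => t.trace w y

/-- Copies the entry of the letter `l` in the row `y` to the row `x`, for two names `x < y` of the
same coset; a conflict is put on the list of coincidences. -/
def mergeLetter (x y : ℕ) (s : List (ℕ × ℕ) × Table) (l : Letter) : List (ℕ × ℕ) × Table :=
  match s.2.look l y with
  | none => s
  | some z =>
    let z' := bif z == y then x else z
    let t := s.2.put l.inv z' x
    match t.look l x with
    | none => (s.1, t.put l x z')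
    | some u =>
      let u' := bif u == y then x else u
      bif z' == u' then (s.1, t) else ((z', u') :: s.1, t)

/-- Processes a list of coincidences, with `n` as the bound for the number of steps. -/
def merge : ℕ → List (ℕ × ℕ) → Table → Table
  | 0, _, t => t
  | _, [], t => t
  | n + 1, (p, q) :: c, t =>
    bif p == q then merge n c t
    else
      let x := min p q
      let y := max p q
      let f := fun z => bif z == y then x else z
      let s := [Letter.a, .b, .b'].foldl (mergeLetter x y) (c.map fun r => (f r.1, f r.2), t)
      merge n s.1 s.2

/-- Uses the fact that `l` takes `x` to `y`: either a new entry or a coincidence. -/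
def deduce (t : Table) (l : Letter) (x y : ℕ) : Table :=
  match t.look l x with
  | some z => merge 100 [(z, y)] t
  | none => match t.look l.inv y with
    | some z => merge 100 [(z, x)] t
    | none => t.link l x y

/-- Uses the fact that the word `w` fixes the coset `z`, to make a deduction about the letter at the
position `i` of `w`. -/
def scan (t : Table) (w : List Letter) (i z : ℕ) : Table :=
  match w.drop i with
  | [] => t
  | l :: u => match t.trace (w.take i) z, t.trace (u.reverse.map Letter.inv) z with
    | some x, some y => t.deduce l x y
    | _, _ => t

/-- Defines the cosets `n`, `n + 1`, …: an entry `(l, x)` of the list says that the letter `l` takes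
the earlier coset `x` to the coset that is being defined. -/
def define : ℕ → List (Letter × ℕ) → Table → Table
  | _, [], t => t
  | n, (l, x) :: c, t => define (n + 1) c (bif x.blt n then t.link l x n else t)

end Table

/-- The word used by a scan: the relator of number `r`, or the word for an element of the subgroup,
which is known to fix the coset `0` only. -/
def scanWord (rels : List (List Letter)) (sub : List Letter) (r z : ℕ) : List Letter :=
  match rels[r]? with
  | some w => w
  | none => bif z == 0 then sub else []

/-- The table obtained from a list `defs` of definitions by performing a list of scans; the scan
`(r, i, z)` applies the word of number `r` to the coset `z` and makes a deduction about its letter at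
the position `i`. -/
def enumerate (rels : List (List Letter)) (sub : List Letter) (defs : List (Letter × ℕ))
    (scans : List (ℕ × ℕ × ℕ)) : Table :=
  scans.foldl (fun t s => t.scan (scanWord rels sub s.1 s.2.2) s.2.1 s.2.2)
    (Table.define 1 defs Table.empty)

/-- The list `V` of cosets contains `0` and is closed under all the letters. -/
def isClosed (t : Table) (V : List ℕ) : Bool :=
  V.elem 0 && V.all fun x => [Letter.a, .b, .b'].all fun l =>
    match t.look l x with
    | none => false
    | some y => V.elem y

section Soundness

variable {G S : Type*} [Group G] [MulAction G S] {x y : G} {v : ℕ → S}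

/-- All entries of the table are true, if the coset `n` is interpreted as the point `v n`. -/
def IsSound (x y : G) (v : ℕ → S) (t : Table) : Prop :=
  ∀ l i j, t.look l i = some j → l.eval x y • v i = v j

namespace IsSound

variable {t : Table}

theorem put (h : IsSound x y v t) {l : Letter} {i j : ℕ} (hl : l.eval x y • v i = v j) :
    IsSound x y v (t.put l i j) := by
  intro l' i' j' h'
  rcases Table.get_set h' with h' | ⟨hk, rfl⟩
  · exact h l' i' j' h'
  · have : i' = i ∧ l' = l := by
      cases l <;> cases l' <;> simp only [Letter.idx] at hk <;>
        first | exact ⟨by omega, rfl⟩ | omega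
    rw [this.1, this.2, hl]

theorem inv_smul_eq (hx : x ^ 2 = 1) {l : Letter} {i j : ℕ} (hl : l.eval x y • v i = v j) :
    l.inv.eval x y • v j = v i := by
  rw [Letter.eval_inv hx, ← hl, inv_smul_smul]

theorem link (h : IsSound x y v t) (hx : x ^ 2 = 1) {l : Letter} {i j : ℕ}
    (hl : l.eval x y • v i = v j) : IsSound x y v (t.link l i j) :=
  (h.put hl).put (inv_smul_eq hx hl)

theorem trace (h : IsSound x y v t) {w : List Letter} {i j : ℕ} (hw : t.trace w i = some j) :
    wordEval x y w • v i = v j := by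
  induction w generalizing i with
  | nil =>
    rw [← Option.some.inj hw]
    exact one_smul G _
  | cons l w ih =>
    rw [Table.trace] at hw
    split at hw
    · cases hw
    · next k hk => rw [wordEval, mul_smul, h l i k hk, ih hw]

theorem mergeLetter {c : List (ℕ × ℕ)} (h : IsSound x y v t) (hx : x ^ 2 = 1)
    (hc : ∀ r ∈ c, v r.1 = v r.2) {i j : ℕ} (hij : v i = v j) (l : Letter) :
    (∀ r ∈ (Table.mergeLetter i j (c, t) l).1, v r.1 = v r.2) ∧
      IsSound x y v (Table.mergeLetter i j (c, t) l).2 := by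
  have hf : ∀ z, v (bif z == j then i else z) = v z := by
    intro z
    by_cases hz : z = j
    · rw [hz, beq_self_eq_true, cond_true, hij]
    · rw [beq_eq_false_iff_ne.2 hz, cond_false]
  unfold Table.mergeLetter
  split
  · exact ⟨hc, h⟩
  · next z hz =>
    have hl : l.eval x y • v i = v (bif z == j then i else z) := by rw [hf, hij, h l j z hz]
    have ht := h.put (inv_smul_eq hx hl)
    dsimp only
    split
    · exact ⟨hc, ht.put hl⟩
    · next u hu =>
      cases hb : ((bif z == j then i else z) == (bif u == j then i else u)) with
      | true => exact ⟨hc, ht⟩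
      | false =>
        refine ⟨?_, ht⟩
        intro r hr
        rcases List.mem_cons.1 hr with rfl | hr
        · dsimp only
          rw [← hl, hf, ht l i u hu]
        · exact hc r hr

theorem merge (hx : x ^ 2 = 1) (n : ℕ) (c : List (ℕ × ℕ)) (t : Table) (h : IsSound x y v t)
    (hc : ∀ r ∈ c, v r.1 = v r.2) : IsSound x y v (Table.merge n c t) := by
  induction n generalizing c t with
  | zero => cases c <;> exact h
  | succ n ih =>
    match c with
    | [] => exact h
    | (p, q) :: c =>
      rw [List.forall_mem_cons] at hc
      unfold Table.merge
      cases hpq : p == q with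
      | true => exact ih c t h hc.2
      | false =>
        have hm : v (min p q) = v (max p q) := by
          rcases le_total p q with hle | hle
          · rw [min_eq_left hle, max_eq_right hle, hc.1]
          · rw [min_eq_right hle, max_eq_left hle, hc.1]
        have hf : ∀ z, v (bif z == max p q then min p q else z) = v z := by
          intro z
          by_cases hz : z = max p q
          · rw [← hz, beq_self_eq_true, cond_true, hm, ← hz]
          · rw [beq_eq_false_iff_ne.2 hz, cond_false]
        have key : ∀ (L : List Letter) (s : List (ℕ × ℕ) × Table),
            ((∀ r ∈ s.1, v r.1 = v r.2) ∧ IsSound x y v s.2) →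
            ((∀ r ∈ (L.foldl (Table.mergeLetter (min p q) (max p q)) s).1, v r.1 = v r.2) ∧
              IsSound x y v (L.foldl (Table.mergeLetter (min p q) (max p q)) s).2) := by
          intro L
          induction L with
          | nil => exact fun s hs => hs
          | cons l L ihL => exact fun s hs => ihL _ (hs.2.mergeLetter hx hs.1 hm l)
        have hk := key [.a, .b, .b'] (c.map fun r =>
          ((bif r.1 == max p q then min p q else r.1), (bif r.2 == max p q then min p q else r.2)), t)
          ⟨by
            intro r hr
            obtain ⟨r', hr', rfl⟩ := List.mem_map.1 hr
            dsimp only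
            rw [hf, hf, hc.2 r' hr'], h⟩
        exact ih _ _ hk.2 hk.1

theorem deduce (h : IsSound x y v t) (hx : x ^ 2 = 1) {l : Letter} {i j : ℕ}
    (hl : l.eval x y • v i = v j) : IsSound x y v (t.deduce l i j) := by
  unfold Table.deduce
  split
  · next z hz => exact merge hx _ _ _ h (by simpa using (h l i z hz).symm.trans hl)
  · split
    · next z hz => exact merge hx _ _ _ h (by
        simpa using (h l.inv j z hz).symm.trans (inv_smul_eq hx hl))
    · exact h.link hx hl

theorem scan (h : IsSound x y v t) (hx : x ^ 2 = 1) {w : List Letter} (n : ℕ) {i : ℕ}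
    (hw : wordEval x y w • v i = v i) : IsSound x y v (t.scan w n i) := by
  unfold Table.scan
  split
  · exact h
  · next l u hu =>
    split
    · next j k hj hk =>
      refine h.deduce hx ?_
      rw [← List.take_append_drop n w, hu, wordEval_append, wordEval, mul_smul, mul_smul,
        h.trace hj] at hw
      rw [← h.trace hk, wordEval_reverse_inv hx]
      exact eq_inv_smul_iff.2 hw
    · exact h

end IsSound

/-- The points named by a list of definitions. -/
def point (x y : G) (s : S) (defs : List (Letter × ℕ)) (n : ℕ) : S :=
  match n with
  | 0 => s
  | n + 1 => match defs[n]? with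
    | none => s
    | some (l, i) => if i < n + 1 then l.eval x y • point x y s defs i else s
termination_by n

theorem IsSound.define (hx : x ^ 2 = 1) (s : S) (defs tail : List (Letter × ℕ)) (n : ℕ) (t : Table)
    (hc : ∀ i, tail[i]? = defs[n + i]?) (h : IsSound x y (point x y s defs) t) :
    IsSound x y (point x y s defs) (Table.define (n + 1) tail t) := by
  induction tail generalizing n t with
  | nil => exact h
  | cons r tail ih =>
    obtain ⟨l, i⟩ := r
    refine ih (n + 1) _ (fun j => ?_) ?_
    · rw [← List.getElem?_cons_succ (a := (l, i)), hc (j + 1)]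
      congr 1
      omega
    · cases hi : i.blt (n + 1) with
      | false => exact h
      | true =>
        refine h.link hx ?_
        have h0 := hc 0
        rw [List.getElem?_cons_zero, Nat.add_zero] at h0
        rw [point.eq_def x y s defs (n + 1)]
        dsimp only
        rw [← h0]
        dsimp only
        rw [if_pos (Nat.blt_eq.mp hi)]

/-- If an enumeration of the cosets of `H` closes up, then the number of cosets found is an upper
bound for the index of `H`. -/
theorem card_quotient_le (hx : x ^ 2 = 1) (hG : Subgroup.closure {x, y} = ⊤) (H : Subgroup G)
    (rels : List (List Letter)) (sub : List Letter) (defs : List (Letter × ℕ))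
    (scans : List (ℕ × ℕ × ℕ)) (V : List ℕ) (hrels : ∀ w ∈ rels, wordEval x y w = 1)
    (hsub : wordEval x y sub ∈ H) (hV : isClosed (enumerate rels sub defs scans) V = true) :
    Finite (G ⧸ H) ∧ Nat.card (G ⧸ H) ≤ V.length := by
  let s : G ⧸ H := QuotientGroup.mk 1
  let v := point x y s defs
  have hv : v 0 = s := by simp only [v]; rw [point]
  have hs : IsSound x y v (enumerate rels sub defs scans) := by
    clear hV
    unfold enumerate
    have h0 : IsSound x y v (Table.define 1 defs Table.empty) := by
      refine IsSound.define hx s defs defs 0 _ (fun i => by rw [Nat.zero_add]) ?_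
      intro l i j hl
      rw [Table.look, Table.get_empty] at hl
      cases hl
    generalize Table.define 1 defs Table.empty = t at h0
    induction scans generalizing t with
    | nil => exact h0
    | cons r scans ih =>
      refine ih _ (IsSound.scan h0 hx _ ?_)
      unfold scanWord
      split
      · next w hw => rw [hrels w (List.mem_of_getElem? hw), one_smul]
      · cases hz : r.2.2 == 0 with
        | false => exact one_smul G _
        | true =>
          rw [beq_iff_eq.1 hz, cond_true, hv]
          exact (QuotientGroup.eq.2 (by simpa using H.inv_mem hsub))
  rw [isClosed, Bool.and_eq_true, List.all_eq_true] at hV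
  obtain ⟨h0, hV⟩ := hV
  have hstep : ∀ (l : Letter) (i : ℕ), i ∈ V → ∃ j ∈ V, l.eval x y • v i = v j := by
    intro l i hi
    have h1 := List.all_eq_true.1 (hV i hi) l (by cases l <;> simp)
    split at h1
    · cases h1
    · next j hj => exact ⟨j, List.elem_iff.1 h1, hs l i j hj⟩
  have hall : ∀ g : G, ∀ i ∈ V, ∃ j ∈ V, g • v i = v j := by
    intro g
    have hg : g ∈ Subgroup.closure {x, y} := hG ▸ Subgroup.mem_top g
    induction hg using Subgroup.closure_induction_left with
    | one => exact fun i hi => ⟨i, hi, one_smul G _⟩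
    | mul_left z hz w _ ih =>
      intro i hi
      obtain ⟨j, hj, hw⟩ := ih i hi
      rw [mul_smul, hw]
      rcases hz with rfl | rfl
      · exact hstep .a j hj
      · exact hstep .b j hj
    | inv_mul_cancel z hz w _ ih =>
      intro i hi
      obtain ⟨j, hj, hw⟩ := ih i hi
      rw [mul_smul, hw]
      rcases hz with rfl | rfl
      · have := hstep .a j hj
        rwa [show Letter.eval z y .a = z⁻¹ from Letter.eval_inv (y := y) hx .a] at this
      · exact hstep .b' j hj
  have hsurj : Function.Surjective fun i : Fin V.length => v (V.get i) := by
    intro q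
    obtain ⟨g, rfl⟩ := QuotientGroup.mk_surjective q
    obtain ⟨j, hj, hg⟩ := hall g 0 (List.elem_iff.1 h0)
    obtain ⟨n, rfl⟩ := List.get_of_mem hj
    refine ⟨n, hg.symm.trans ?_⟩
    rw [hv]
    change (QuotientGroup.mk (g * 1) : G ⧸ H) = _
    rw [mul_one]
  refine ⟨Finite.of_surjective _ hsurj, ?_⟩
  have := Nat.card_le_card_of_surjective _ hsurj
  rwa [Nat.card_fin] at this

end Soundness

end CosetEnumeration

end

section

/-! ### Hurwitz pairs in `PSL(2, F)` -/

/-- A pair of elements that satisfies the defining relations of the triangle group `Γ[2,3,7]`, as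
`A` and `B` do; the element `C` is then `y⁻¹ * x`. -/
structure IsHurwitzPair {G : Type*} [Group G] (x y : G) : Prop where
  sq_eq_one : x ^ 2 = 1
  cube_eq_one : y ^ 3 = 1
  pow_seven_eq_one : (y⁻¹ * x) ^ 7 = 1

/-- The element of a group with a Hurwitz pair that corresponds to the translation along the mirror
of the reflection `P`: the product of the half-turns about two successive edge-centres. -/
def mirrorWord {G : Type*} [Group G] (x y : G) : G :=
  x * (((y⁻¹ * x) ^ 3 * y) * x * ((y⁻¹ * x) ^ 3 * y)⁻¹)

theorem IsHurwitzPair.map {G H : Type*} [Group G] [Group H] {x y : G} (h : IsHurwitzPair x y)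
    (f : G →* H) : IsHurwitzPair (f x) (f y) where
  sq_eq_one := by rw [← map_pow, h.sq_eq_one, map_one]
  cube_eq_one := by rw [← map_pow, h.cube_eq_one, map_one]
  pow_seven_eq_one := by rw [← map_inv, ← map_mul, ← map_pow, h.pow_seven_eq_one, map_one]

theorem map_mirrorWord {G H : Type*} [Group G] [Group H] (x y : G) (f : G →* H) :
    f (mirrorWord x y) = mirrorWord (f x) (f y) := by
  simp only [mirrorWord, map_mul, map_pow, map_inv]

section SL2

open Matrix

variable {F : Type*} [Field F]

/-- The trace of an element of `SL(2, F)`. -/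
def slTrace (g : SpecialLinearGroup (Fin 2) F) : F := g 0 0 + g 1 1

theorem sl_det (g : SpecialLinearGroup (Fin 2) F) : g 0 0 * g 1 1 - g 0 1 * g 1 0 = 1 := by
  rw [← det_fin_two, g.det_coe]

theorem sl_mul_apply (g h : SpecialLinearGroup (Fin 2) F) (i j : Fin 2) :
    (g * h) i j = g i 0 * h 0 j + g i 1 * h 1 j := by
  change ((g : Matrix (Fin 2) (Fin 2) F) * (h : Matrix (Fin 2) (Fin 2) F)) i j = _
  rw [mul_apply, Fin.sum_univ_two]

theorem sl_inv_apply (g : SpecialLinearGroup (Fin 2) F) :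
    g⁻¹ 0 0 = g 1 1 ∧ g⁻¹ 0 1 = -g 0 1 ∧ g⁻¹ 1 0 = -g 1 0 ∧ g⁻¹ 1 1 = g 0 0 := by
  have h : ∀ i j, g⁻¹ i j = (adjugate (g : Matrix (Fin 2) (Fin 2) F)) i j := fun _ _ => rfl
  simp only [h, adjugate_fin_two]
  exact ⟨rfl, rfl, rfl, rfl⟩

theorem slTrace_mul_comm (g h : SpecialLinearGroup (Fin 2) F) :
    slTrace (g * h) = slTrace (h * g) := by
  simp only [slTrace, sl_mul_apply]
  ring

theorem slTrace_inv (g : SpecialLinearGroup (Fin 2) F) : slTrace g⁻¹ = slTrace g := by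
  obtain ⟨h1, -, -, h4⟩ := sl_inv_apply g
  rw [slTrace, slTrace, h1, h4, add_comm]

/-- The fundamental trace identity. -/
theorem slTrace_mul (g h : SpecialLinearGroup (Fin 2) F) :
    slTrace (g * h) = slTrace g * slTrace h - slTrace (g * h⁻¹) := by
  obtain ⟨h1, h2, h3, h4⟩ := sl_inv_apply h
  simp only [slTrace, sl_mul_apply, h1, h2, h3, h4]
  ring

theorem slTrace_mul_mul_inv (g h : SpecialLinearGroup (Fin 2) F) :
    slTrace (g * h * g⁻¹) = slTrace h := by
  rw [slTrace_mul_comm, inv_mul_cancel_left]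

theorem slTrace_one : slTrace (1 : SpecialLinearGroup (Fin 2) F) = 2 := by
  simp [slTrace, one_add_one_eq_two]

/-- The trace of the mirror word, as a function of the trace of `y⁻¹ * x`. -/
theorem slTrace_mirrorWord {x y : SpecialLinearGroup (Fin 2) F} (hx : slTrace x = 0)
    (hy : slTrace y ^ 2 = 1) :
    slTrace (mirrorWord x y) =
      2 - slTrace (y⁻¹ * x) ^ 2 - ((slTrace (y⁻¹ * x) ^ 2 - 1) ^ 2 - slTrace (y⁻¹ * x) ^ 2) ^ 2 := by
  obtain ⟨c, hc⟩ : ∃ c, c = y⁻¹ * x := ⟨_, rfl⟩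
  have hyc : y = x * c⁻¹ := by rw [hc]; group
  rw [mirrorWord, ← hc]
  set t := slTrace c with ht
  have hxi : ∀ g, slTrace (g * x⁻¹) = -slTrace (g * x) := fun g => by
    rw [slTrace_mul g x⁻¹, slTrace_inv, hx, inv_inv]
    ring
  -- the trace of `c * x`
  have hxc : slTrace (x * c) ^ 2 = 1 := by
    have : slTrace (x * c) = -slTrace y := by
      rw [slTrace_mul, hx, hyc]
      ring
    rw [this, neg_sq, hy]
  -- the trace of the commutator of `x` and `c`
  have hk : slTrace (x * c * x⁻¹ * c⁻¹) = t ^ 2 - 1 := by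
    have h1 := slTrace_mul (x * c * x⁻¹) c
    rw [slTrace_mul_mul_inv] at h1
    have h2 : slTrace (x * c * x⁻¹ * c) = 1 := by
      have h3 : slTrace (x * c * (x⁻¹ * c)) =
          slTrace (x * c) * slTrace (x⁻¹ * c) - slTrace (x * c * (x⁻¹ * c)⁻¹) := slTrace_mul _ _
      have h4 : slTrace (x⁻¹ * c) = -slTrace (x * c) := by
        rw [slTrace_mul_comm, hxi, slTrace_mul_comm]
      have h5 : slTrace (x * c * (x⁻¹ * c)⁻¹) = -2 := by
        rw [_root_.mul_inv_rev, inv_inv, mul_assoc, mul_inv_cancel_left, slTrace_mul, mul_inv_cancel,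
          slTrace_one, hx]
        ring
      rw [mul_assoc, h3, h4, h5]
      linear_combination -hxc
    rw [h2, ← ht] at h1
    linear_combination h1
  have hpow : ∀ g, slTrace (g * c ^ 3) = (t ^ 2 - 1) * slTrace (g * c) - t * slTrace g := by
    intro g
    have e2 : slTrace (g * c ^ 2) = t * slTrace (g * c) - slTrace g := by
      rw [sq, ← mul_assoc, slTrace_mul, mul_inv_cancel_right, ← ht]
      ring
    have e3 : slTrace (g * c ^ 3) = t * slTrace (g * c ^ 2) - slTrace (g * c) := by
      rw [pow_succ c 2, ← mul_assoc, slTrace_mul, ← ht,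
        show g * c ^ 2 * c⁻¹ = g * c by group]
      ring
    rw [e3, e2]
    ring
  obtain ⟨d, hd⟩ : ∃ d, d = c ^ 3 * y := ⟨_, rfl⟩
  rw [← hd]
  -- the trace of `c ^ 3 * y` and of `x * c ^ 3 * y`
  have hd1 : slTrace d ^ 2 = t ^ 2 := by
    have : slTrace d = t * slTrace (x * c) := by
      have e : slTrace d = slTrace (x * c ^ 2) := by
        rw [hd, hyc, show c ^ 3 * (x * c⁻¹) = c * (c ^ 2 * x) * c⁻¹ by group,
          slTrace_mul_mul_inv, slTrace_mul_comm]
      rw [e, sq, ← mul_assoc, slTrace_mul, mul_inv_cancel_right, hx, ← ht]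
      ring
    rw [this, mul_pow, hxc, mul_one]
  have hd2 : slTrace (x * d) = t ^ 2 - (t ^ 2 - 1) ^ 2 := by
    have e : slTrace (x * d) = slTrace (x * c⁻¹ * x * c ^ 3) := by
      rw [hd, hyc, ← mul_assoc, ← mul_assoc, mul_assoc, slTrace_mul_comm]
      simp only [mul_assoc]
    have e1 : slTrace (x * c⁻¹ * x * c) = 1 - t ^ 2 := by
      have h1 : slTrace (x * c * x⁻¹ * c⁻¹) = - slTrace (x * c⁻¹ * x * c) := by
        rw [mul_assoc (x * c), slTrace_mul_comm, mul_assoc x⁻¹, slTrace_mul_comm x⁻¹, hxi,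
          slTrace_mul_comm _ x]
        simp only [mul_assoc]
      linear_combination h1 - hk
    have e2 : slTrace (x * c⁻¹ * x) = -t := by
      have := hxi (x * c⁻¹)
      rw [slTrace_mul_mul_inv, slTrace_inv] at this
      linear_combination this
    rw [e, hpow, e1, e2]
    ring
  have hx2 : x * (d * x * d⁻¹) = (x * d) * (d * x⁻¹)⁻¹ := by group
  have h1 := slTrace_mul (x * d) (d * x⁻¹)
  have h2 : slTrace (x * d * (d * x⁻¹)) = slTrace d ^ 2 - 2 := by
    rw [show x * d * (d * x⁻¹) = x * (d * d) * x⁻¹ by group, slTrace_mul_mul_inv, slTrace_mul,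
      mul_inv_cancel, slTrace_one]
    ring
  rw [hx2]
  rw [h2, hxi, slTrace_mul_comm d x, hd2, hd1] at h1
  linear_combination h1

/-- The sequence `1, t, t ^ 2 - 1, …` of the coefficients of the powers of a matrix of determinant
`1` and trace `t`. -/
def powCoeff (t : F) : ℕ → F
  | 0 => 0
  | 1 => 1
  | n + 2 => t * powCoeff t (n + 1) - powCoeff t n

theorem sl_sq (g : SpecialLinearGroup (Fin 2) F) :
    (g : Matrix (Fin 2) (Fin 2) F) * g = slTrace g • (g : Matrix (Fin 2) (Fin 2) F) - 1 := by
  have h := sl_det g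
  ext i j
  fin_cases i <;> fin_cases j <;>
    simp [mul_apply, Fin.sum_univ_two, slTrace] <;>
      first | linear_combination -h | ring

theorem sl_pow_succ (g : SpecialLinearGroup (Fin 2) F) (n : ℕ) :
    ((g ^ (n + 1) : SpecialLinearGroup (Fin 2) F) : Matrix (Fin 2) (Fin 2) F) =
      powCoeff (slTrace g) (n + 1) • (g : Matrix (Fin 2) (Fin 2) F) -
        powCoeff (slTrace g) n • (1 : Matrix (Fin 2) (Fin 2) F) := by
  induction n with
  | zero => simp [powCoeff]
  | succ n ih =>
    rw [pow_succ, Matrix.SpecialLinearGroup.coe_mul, ih, sub_mul, smul_mul_assoc, smul_mul_assoc, sl_sq,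
      one_mul, powCoeff]
    module

theorem mem_center_sl_iff (g : SpecialLinearGroup (Fin 2) F) :
    g ∈ Subgroup.center (SpecialLinearGroup (Fin 2) F) ↔
      ∃ r : F, (g : Matrix (Fin 2) (Fin 2) F) = r • (1 : Matrix (Fin 2) (Fin 2) F) := by
  rw [Matrix.SpecialLinearGroup.mem_center_iff]
  constructor
  · rintro ⟨r, -, h⟩
    exact ⟨r, by rw [← h, scalar_apply, smul_one_eq_diagonal]⟩
  · rintro ⟨r, h⟩
    refine ⟨r, ?_, by rw [h, scalar_apply, smul_one_eq_diagonal]⟩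
    rw [← g.det_coe, h, det_smul, det_one, mul_one]

/-- The order of the image of a matrix in `PSL(2, F)` is determined by its trace. -/
theorem sl_pow_mem_center_iff (g : SpecialLinearGroup (Fin 2) F) (n : ℕ) :
    g ^ n ∈ Subgroup.center (SpecialLinearGroup (Fin 2) F) ↔
      g ∈ Subgroup.center (SpecialLinearGroup (Fin 2) F) ∨ powCoeff (slTrace g) n = 0 := by
  cases n with
  | zero => simp [powCoeff]
  | succ n =>
    constructor
    · intro h
      by_contra! hn
      obtain ⟨r, hr⟩ := (mem_center_sl_iff _).1 h
      refine hn.1 ((mem_center_sl_iff _).2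
        ⟨(powCoeff (slTrace g) (n + 1))⁻¹ * (r + powCoeff (slTrace g) n), ?_⟩)
      rw [sl_pow_succ, sub_eq_iff_eq_add, ← add_smul] at hr
      rw [mul_smul, ← hr, inv_smul_smul₀ hn.2]
    · rintro (h | h)
      · exact Subgroup.pow_mem _ h _
      · refine (mem_center_sl_iff _).2 ⟨-powCoeff (slTrace g) n, ?_⟩
        rw [sl_pow_succ, h]
        module

theorem powCoeff_two (t : F) : powCoeff t 2 = t := by simp [powCoeff]

theorem powCoeff_three (t : F) : powCoeff t 3 = t ^ 2 - 1 := by simp [powCoeff, sq]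

theorem powCoeff_seven (t : F) : powCoeff t 7 = t ^ 6 - 5 * t ^ 4 + 6 * t ^ 2 - 1 := by
  simp only [powCoeff]
  ring

open scoped MatrixGroups in
theorem mk_pow_eq_one_iff (g : SpecialLinearGroup (Fin 2) F) (n : ℕ) :
    (QuotientGroup.mk g : PSL(2, F)) ^ n = 1 ↔
      (QuotientGroup.mk g : PSL(2, F)) = 1 ∨ powCoeff (slTrace g) n = 0 := by
  rw [← QuotientGroup.mk_pow, QuotientGroup.eq_one_iff, QuotientGroup.eq_one_iff,
    sl_pow_mem_center_iff]

end SL2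

end

section

/-! ### Hurwitz generators of `PSL(2, 7)` and `PSL(2, 8)` -/

section PSL2

open Matrix

open scoped MatrixGroups

theorem IsHurwitzPair.ne_one {G : Type*} [Group G] [Nontrivial G] {x y : G}
    (h : IsHurwitzPair x y) (hG : Subgroup.closure {x, y} = ⊤) :
    x ≠ 1 ∧ y ≠ 1 ∧ y⁻¹ * x ≠ 1 := by
  have key : ¬ (x = 1 ∧ y = 1) := by
    rintro ⟨rfl, rfl⟩
    rw [Set.pair_eq_singleton, Subgroup.closure_singleton_one] at hG
    exact bot_ne_top hG
  have h7 := h.pow_seven_eq_one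
  refine ⟨fun hx => key ⟨hx, ?_⟩, fun hy => key ⟨?_, hy⟩, fun hc => ?_⟩
  · rw [hx, mul_one, inv_pow, inv_eq_one] at h7
    calc y = y ^ 7 * ((y ^ 3) ^ 2)⁻¹ := by group
      _ = 1 := by rw [h7, h.cube_eq_one]; simp
  · rw [hy, inv_one, one_mul] at h7
    calc x = x ^ 7 * ((x ^ 2) ^ 3)⁻¹ := by group
      _ = 1 := by rw [h7, h.sq_eq_one]; simp
  · have hxy : y = x := (inv_mul_eq_one.1 hc)
    have h3 := h.cube_eq_one
    have hx : x = 1 := by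
      calc x = x ^ 3 * (x ^ 2)⁻¹ := by group
        _ = 1 := by rw [h.sq_eq_one, ← hxy, h3]; simp
    exact key ⟨hx, hxy.trans hx⟩

variable {F : Type*} [Field F]

/-- The traces of lifts of a Hurwitz pair of generators of `PSL(2, F)`. -/
theorem IsHurwitzPair.slTrace_eq {a b : SL(2, F)}
    (h : IsHurwitzPair (QuotientGroup.mk a : PSL(2, F)) (QuotientGroup.mk b))
    (hG : Subgroup.closure {(QuotientGroup.mk a : PSL(2, F)), QuotientGroup.mk b} = ⊤) :
    slTrace a = 0 ∧ slTrace b ^ 2 = 1 ∧ powCoeff (slTrace (b⁻¹ * a)) 7 = 0 := by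
  obtain ⟨h1, h2, h3⟩ := h.ne_one hG
  have ha := ((mk_pow_eq_one_iff _ _).1 h.sq_eq_one).resolve_left h1
  have hb := ((mk_pow_eq_one_iff _ _).1 h.cube_eq_one).resolve_left h2
  have hc := ((mk_pow_eq_one_iff (b⁻¹ * a) 7).1 h.pow_seven_eq_one).resolve_left h3
  rw [powCoeff_two] at ha
  rw [powCoeff_three] at hb
  exact ⟨ha, by linear_combination hb, hc⟩

theorem mk_mirrorWord (a b : SL(2, F)) :
    (QuotientGroup.mk (mirrorWord a b) : PSL(2, F)) =
      mirrorWord (QuotientGroup.mk a) (QuotientGroup.mk b) :=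
  map_mirrorWord a b (QuotientGroup.mk' _)

theorem mirrorWord_sq_of_charTwo (h2 : (2 : F) = 0) {a b : SL(2, F)} (ha : slTrace a = 0)
    (hb : slTrace b ^ 2 = 1) (hc : powCoeff (slTrace (b⁻¹ * a)) 7 = 0) :
    mirrorWord (QuotientGroup.mk a : PSL(2, F)) (QuotientGroup.mk b) ^ 2 = 1 := by
  rw [← mk_mirrorWord, mk_pow_eq_one_iff, powCoeff_two, slTrace_mirrorWord ha hb]
  right
  rw [powCoeff_seven] at hc
  set t := slTrace (b⁻¹ * a)
  linear_combination (-(t ^ 2 + 1)) * hc + (t ^ 6 - 5 * t ^ 4 + 5 * t ^ 2) * h2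

theorem mirrorWord_cube_of_charSeven (h7 : (7 : F) = 0) {a b : SL(2, F)} (ha : slTrace a = 0)
    (hb : slTrace b ^ 2 = 1) (hc : powCoeff (slTrace (b⁻¹ * a)) 7 = 0) :
    mirrorWord (QuotientGroup.mk a : PSL(2, F)) (QuotientGroup.mk b) ^ 3 = 1 := by
  rw [← mk_mirrorWord, mk_pow_eq_one_iff, powCoeff_three, slTrace_mirrorWord ha hb]
  right
  rw [powCoeff_seven] at hc
  set t := slTrace (b⁻¹ * a)
  -- modulo `7`, the condition on `t` says that `(t ^ 2 - 4) ^ 3 = 0`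
  have h4 : t ^ 2 - 4 = 0 := by
    refine pow_eq_zero_iff (n := 3) (by norm_num) |>.1 ?_
    linear_combination hc + (-t ^ 4 + 6 * t ^ 2 - 9) * h7
  have h4' : t ^ 2 = 4 := sub_eq_zero.1 h4
  rw [h4']
  linear_combination 104 * h7

theorem sl_ext {g h : SL(2, F)} (h00 : g 0 0 = h 0 0) (h01 : g 0 1 = h 0 1)
    (h10 : g 1 0 = h 1 0) (h11 : g 1 1 = h 1 1) : g = h := by
  refine (Matrix.SpecialLinearGroup.ext_iff g h).2 fun i j => ?_
  fin_cases i <;> fin_cases j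
  exacts [h00, h01, h10, h11]

/-- The matrix with the rows `(p, q)` and `(r, s)`. -/
def slMk (p q r s : F) (h : p * s - q * r = 1) : SL(2, F) :=
  ⟨!![p, q; r, s], by rw [det_fin_two_of, h]⟩

theorem slMk_apply (p q r s : F) (h : p * s - q * r = 1) :
    slMk p q r s h 0 0 = p ∧ slMk p q r s h 0 1 = q ∧ slMk p q r s h 1 0 = r ∧
      slMk p q r s h 1 1 = s := ⟨rfl, rfl, rfl, rfl⟩

/-- An upper unipotent matrix. -/
def upper (s : F) : SL(2, F) := slMk 1 s 0 1 (by ring)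

/-- A lower unipotent matrix. -/
def lower (s : F) : SL(2, F) := slMk 1 0 s 1 (by ring)

theorem upper_add (s t : F) : upper (s + t) = upper s * upper t := by
  apply sl_ext <;> simp only [upper, sl_mul_apply, slMk_apply] <;> ring

theorem eq_top_of_unipotent_mem {I : Subgroup SL(2, F)} (hu : ∀ s, upper s ∈ I)
    (hl : ∀ s, lower s ∈ I) : I = ⊤ := by
  have key : ∀ g : SL(2, F), g 1 0 ≠ 0 → g ∈ I := by
    intro g hg
    have h := sl_det g
    have : g = upper ((g 0 0 - 1) / g 1 0) * lower (g 1 0) * upper ((g 1 1 - 1) / g 1 0) := by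
      apply sl_ext <;> simp only [upper, lower, sl_mul_apply, slMk_apply] <;> field_simp <;>
        first | ring1 | linear_combination -h
    rw [this]
    exact I.mul_mem (I.mul_mem (hu _) (hl _)) (hu _)
  rw [eq_top_iff]
  intro g _
  by_cases hg : g 1 0 = 0
  · have h := sl_det g
    rw [hg, mul_zero, sub_zero] at h
    have h1 : lower 1 * g ∈ I := key _ (by
      have : (lower 1 * g : SL(2, F)) 1 0 = g 0 0 := by
        simp only [sl_mul_apply, lower, slMk_apply, hg]
        ring
      rw [this]
      exact left_ne_zero_of_mul_eq_one h)
    simpa using I.mul_mem (I.inv_mem (hl 1)) h1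
  · exact key g hg

theorem isHurwitzPair_mk {a b : SL(2, F)} (ha : slTrace a = 0) (hb : slTrace b ^ 2 = 1)
    (hc : powCoeff (slTrace (b⁻¹ * a)) 7 = 0) :
    IsHurwitzPair (QuotientGroup.mk a : PSL(2, F)) (QuotientGroup.mk b) where
  sq_eq_one := (mk_pow_eq_one_iff _ _).2 (Or.inr (by rw [powCoeff_two, ha]))
  cube_eq_one := (mk_pow_eq_one_iff _ _).2 (Or.inr (by rw [powCoeff_three, hb, sub_self]))
  pow_seven_eq_one := (mk_pow_eq_one_iff (b⁻¹ * a) _).2 (Or.inr hc)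

theorem closure_mk_eq_top {a b : SL(2, F)} (h : Subgroup.closure {a, b} = ⊤) :
    Subgroup.closure {(QuotientGroup.mk a : PSL(2, F)), QuotientGroup.mk b} = ⊤ := by
  have := Subgroup.map_top_of_surjective _
    (QuotientGroup.mk'_surjective (Subgroup.center SL(2, F)))
  rw [← h, MonoidHom.map_closure, Set.image_pair] at this
  exact this

instance fact_prime_seven : Fact (Nat.Prime 7) := ⟨by norm_num⟩

/-- A parabolic element of order `7` and a half-turn generate `PSL(2, 7)`. -/
theorem exists_hurwitzPair_seven : ∃ x y : PSL(2, ZMod 7), IsHurwitzPair x y ∧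
    Subgroup.closure {x, y} = ⊤ ∧ mirrorWord x y ^ 3 = 1 := by
  let a : SL(2, ZMod 7) := slMk 0 (-1) 1 0 (by ring)
  let b : SL(2, ZMod 7) := slMk 0 (-1) 1 (-1) (by ring)
  have hu : b⁻¹ * a = upper 1 := by
    rw [inv_mul_eq_iff_eq_mul]
    apply sl_ext <;> simp only [a, b, upper, sl_mul_apply, slMk_apply] <;> ring
  have ha : slTrace a = 0 := by simp only [slTrace, a, slMk_apply]; ring
  have hb : slTrace b ^ 2 = 1 := by simp only [slTrace, b, slMk_apply]; ring
  have hc : powCoeff (slTrace (b⁻¹ * a)) 7 = 0 := by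
    rw [hu, powCoeff_seven]
    simp only [slTrace, upper, slMk_apply]
    decide
  refine ⟨_, _, isHurwitzPair_mk ha hb hc, closure_mk_eq_top ?_,
    mirrorWord_cube_of_charSeven (by decide) ha hb hc⟩
  have ha' : a ∈ Subgroup.closure {a, b} := Subgroup.subset_closure (by simp)
  have hb' : b ∈ Subgroup.closure {a, b} := Subgroup.subset_closure (by simp)
  have hu1 : upper 1 ∈ Subgroup.closure {a, b} :=
    hu ▸ Subgroup.mul_mem _ (Subgroup.inv_mem _ hb') ha'
  have hun : ∀ n : ℕ, upper (n : ZMod 7) ∈ Subgroup.closure {a, b} := by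
    intro n
    induction n with
    | zero =>
      have : upper ((0 : ℕ) : ZMod 7) = 1 := by
        apply sl_ext <;> simp [upper, slMk_apply]
      rw [this]
      exact Subgroup.one_mem _
    | succ n ih =>
      rw [Nat.cast_succ, upper_add]
      exact Subgroup.mul_mem _ ih hu1
  have hus : ∀ s : ZMod 7, upper s ∈ Subgroup.closure {a, b} := fun s => by
    simpa using hun s.val
  refine eq_top_of_unipotent_mem hus fun s => ?_
  have : lower s = a * upper (-s) * a⁻¹ := by
    rw [eq_mul_inv_iff_mul_eq]
    apply sl_ext <;> simp only [a, upper, lower, sl_mul_apply, slMk_apply] <;> ring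
  rw [this]
  exact Subgroup.mul_mem _ (Subgroup.mul_mem _ ha' (hus _)) (Subgroup.inv_mem _ ha')

theorem exists_root_of_card_eq_eight [Finite F] (hF : Nat.card F = 8) (h2 : (2 : F) = 0) :
    ∃ t : F, t ^ 3 + t + 1 = 0 := by
  have : Fintype F := Fintype.ofFinite F
  rw [Nat.card_eq_fintype_card] at hF
  obtain ⟨t, ht0, ht1⟩ : ∃ t : F, t ≠ 0 ∧ t ≠ 1 := by
    classical
    have : ({0, 1} : Finset F).card < (Finset.univ : Finset F).card := by
      rw [Finset.card_univ, hF]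
      exact lt_of_le_of_lt Finset.card_le_two (by norm_num)
    obtain ⟨t, -, ht⟩ := Finset.exists_mem_notMem_of_card_lt_card this
    exact ⟨t, by simpa using ht⟩
  have h7 : t ^ 7 = 1 := by
    have := FiniteField.pow_card_sub_one_eq_one t ht0
    rwa [hF] at this
  have h : (t ^ 3 + t + 1) * (t ^ 3 + t ^ 2 + 1) = 0 := by
    refine (mul_eq_zero.1 ?_).resolve_left (sub_ne_zero.2 ht1)
    linear_combination h7 + (t ^ 4 - t ^ 3) * h2
  rcases mul_eq_zero.1 h with h | h
  · exact ⟨t, h⟩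
  · refine ⟨t⁻¹, ?_⟩
    field_simp
    linear_combination h

/-- In a field with eight elements, every element other than `0` and `1` generates the
multiplicative group. -/
theorem exists_pow_of_card_eq_eight (hF : Nat.card F = 8) {t : F} (ht0 : t ≠ 0) (ht1 : t ≠ 1)
    {s : F} (hs : s ≠ 0) : ∃ n : ℕ, t ^ n = s := by
  have hfin : Finite F := Nat.finite_of_card_ne_zero (by omega)
  have hcard : Nat.card Fˣ = 7 := by
    have := Nat.card_eq_card_units_add_one F
    omega
  have h := mem_zpowers_of_prime_card hcard (g := Units.mk0 t ht0) (g' := Units.mk0 s hs)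
    (fun h => ht1 (congrArg Units.val h))
  obtain ⟨n, hn⟩ := mem_powers_iff_mem_zpowers.2 h
  exact ⟨n, by simpa using congrArg Units.val hn⟩

/-- A diagonal element of order `7` and a suitable involution generate `PSL(2, 8)`. -/
theorem exists_hurwitzPair_eight (hF : Nat.card F = 8) (h2 : (2 : F) = 0) :
    ∃ x y : PSL(2, F), IsHurwitzPair x y ∧
      Subgroup.closure {x, y} = ⊤ ∧ mirrorWord x y ^ 2 = 1 := by
  have hfin : Finite F := Nat.finite_of_card_ne_zero (by omega)
  obtain ⟨t, ht⟩ := exists_root_of_card_eq_eight hF h2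
  -- `c` is diagonal with `t⁻¹ = t ^ 2 + 1`, and the diagonal entry of `a` is `(t + t⁻¹)⁻¹ = t ^ 2`,
  -- so that `a * c⁻¹` has trace `1`
  let a : SL(2, F) := slMk (t ^ 2) 1 (t ^ 2 + t + 1) (t ^ 2) (by grind)
  let c : SL(2, F) := slMk t 0 0 (t ^ 2 + 1) (by grind)
  let b : SL(2, F) := a * c⁻¹
  have hc' : c⁻¹ = slMk (t ^ 2 + 1) 0 0 t (by grind) := by
    rw [inv_eq_iff_mul_eq_one]
    apply sl_ext <;> simp [c, sl_mul_apply, slMk_apply] <;> grind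
  have hu : b⁻¹ * a = c := by simp [b]
  have ha : slTrace a = 0 := by simp only [slTrace, a, slMk_apply]; grind
  have hb : slTrace b ^ 2 = 1 := by
    simp only [slTrace, b, hc', a, sl_mul_apply, slMk_apply]; grind
  have hc : powCoeff (slTrace (b⁻¹ * a)) 7 = 0 := by
    rw [hu, powCoeff_seven]
    simp only [slTrace, c, slMk_apply]
    grind
  refine ⟨_, _, isHurwitzPair_mk ha hb hc, closure_mk_eq_top ?_,
    mirrorWord_sq_of_charTwo h2 ha hb hc⟩
  have ha' : a ∈ Subgroup.closure {a, b} := Subgroup.subset_closure (by simp)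
  have hb' : b ∈ Subgroup.closure {a, b} := Subgroup.subset_closure (by simp)
  generalize Subgroup.closure {a, b} = I at ha' hb'
  have hcI : c ∈ I := hu ▸ I.mul_mem (I.inv_mem hb') ha'
  have ht0 : t ≠ 0 := by
    rintro rfl
    simp at ht
  have ht1 : t ^ 2 ≠ 1 := by grind
  -- the fixed point of `a` on the projective line is carried to `∞` by `a * c⁻¹ ^ 2`, and to `0` by
  -- `a * c ^ 2`
  have hw1 : upper (t ^ 2 + 1) ∈ I := by
    have : upper (t ^ 2 + 1) = a * c⁻¹ * c⁻¹ * a * (c * c * a⁻¹) := by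
      rw [← mul_assoc, eq_mul_inv_iff_mul_eq]
      apply sl_ext <;> simp only [hc', upper, a, c, sl_mul_apply, slMk_apply] <;> grind
    rw [this]
    exact I.mul_mem (I.mul_mem (I.mul_mem (I.mul_mem ha' (I.inv_mem hcI)) (I.inv_mem hcI)) ha')
      (I.mul_mem (I.mul_mem hcI hcI) (I.inv_mem ha'))
  have hw2 : lower (t ^ 2 + t) ∈ I := by
    have : lower (t ^ 2 + t) = a * c * c * a * (c⁻¹ * c⁻¹ * a⁻¹) := by
      rw [← mul_assoc, eq_mul_inv_iff_mul_eq]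
      apply sl_ext <;> simp only [hc', lower, a, c, sl_mul_apply, slMk_apply] <;> grind
    rw [this]
    exact I.mul_mem (I.mul_mem (I.mul_mem (I.mul_mem ha' hcI) hcI) ha')
      (I.mul_mem (I.mul_mem (I.inv_mem hcI) (I.inv_mem hcI)) (I.inv_mem ha'))
  have hpu : ∀ n : ℕ, upper ((t ^ 2) ^ n * (t ^ 2 + 1)) ∈ I := by
    intro n
    induction n with
    | zero => simpa using hw1
    | succ n ih =>
      have : upper ((t ^ 2) ^ (n + 1) * (t ^ 2 + 1)) =
          c * upper ((t ^ 2) ^ n * (t ^ 2 + 1)) * c⁻¹ := by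
        rw [pow_succ]
        generalize (t ^ 2) ^ n = u
        apply sl_ext <;> simp only [hc', upper, c, sl_mul_apply, slMk_apply] <;> grind
      rw [this]
      exact I.mul_mem (I.mul_mem hcI ih) (I.inv_mem hcI)
  have hpl : ∀ n : ℕ, lower ((t ^ 2) ^ n * (t ^ 2 + t)) ∈ I := by
    intro n
    induction n with
    | zero => simpa using hw2
    | succ n ih =>
      have : lower ((t ^ 2) ^ (n + 1) * (t ^ 2 + t)) =
          c⁻¹ * lower ((t ^ 2) ^ n * (t ^ 2 + t)) * c := by
        rw [pow_succ]
        generalize (t ^ 2) ^ n = u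
        apply sl_ext <;> simp only [hc', lower, c, sl_mul_apply, slMk_apply] <;> grind
      rw [this]
      exact I.mul_mem (I.mul_mem (I.inv_mem hcI) ih) hcI
  have h0 : upper (0 : F) = 1 ∧ lower (0 : F) = 1 := by
    constructor <;> apply sl_ext <;> simp [upper, lower, slMk_apply]
  have hpow : ∀ r : F, r ≠ 0 → ∀ s : F, s ≠ 0 → ∃ n : ℕ, s = (t ^ 2) ^ n * r := by
    intro r hr s hs
    obtain ⟨n, hn⟩ := exists_pow_of_card_eq_eight hF (pow_ne_zero 2 ht0) ht1 (div_ne_zero hs hr)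
    exact ⟨n, by rw [hn, div_mul_cancel₀ _ hr]⟩
  refine eq_top_of_unipotent_mem (fun s => ?_) (fun s => ?_)
  · by_cases hs : s = 0
    · rw [hs, h0.1]; exact I.one_mem
    · obtain ⟨n, rfl⟩ := hpow (t ^ 2 + 1) (by grind) s hs
      exact hpu n
  · by_cases hs : s = 0
    · rw [hs, h0.2]; exact I.one_mem
    · obtain ⟨n, rfl⟩ := hpow (t ^ 2 + t) (by grind) s hs
      exact hpl n

/-- The big cell and the small cell of the Bruhat decomposition. -/
theorem le_card_sl [Finite F] :
    Nat.card F * (Nat.card F ^ 2 - 1) ≤ Nat.card SL(2, F) := by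
  let f : (Fˣ × F × F) ⊕ (Fˣ × F) → SL(2, F) := fun x => match x with
    | .inl (r, p, s) => slMk p ((p * s - 1) / r) r s (by field_simp; ring)
    | .inr (p, q) => slMk p q 0 (p⁻¹ : Fˣ) (by simp)
  have hf : Function.Injective f := by
    have he : ∀ {g h : SL(2, F)}, g = h → ∀ i j, g i j = h i j := by rintro g _ rfl i j; rfl
    rintro (⟨r, p, s⟩ | ⟨p, q⟩) (⟨r', p', s'⟩ | ⟨p', q'⟩) h
    · have e1 : p = p' := he h 0 0
      have e2 : (r : F) = r' := he h 1 0
      have e3 : s = s' := he h 1 1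
      rw [e1, Units.ext e2, e3]
    · exact absurd (he h 1 0 : (r : F) = 0) r.ne_zero
    · exact absurd (he h 1 0 : 0 = (r' : F)).symm r'.ne_zero
    · have e1 : (p : F) = p' := he h 0 0
      have e2 : q = q' := he h 0 1
      rw [Units.ext e1, e2]
  have hfin : Finite SL(2, F) := inferInstance
  have := Nat.card_le_card_of_injective f hf
  rw [Nat.card_sum, Nat.card_prod, Nat.card_prod, Nat.card_prod] at this
  refine le_trans (le_of_eq ?_) this
  obtain ⟨n, hn⟩ : ∃ n, Nat.card Fˣ = n := ⟨_, rfl⟩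
  rw [Nat.card_eq_card_units_add_one F, hn, Nat.pow_two, ← Nat.pow_two,
    show (n + 1) ^ 2 - 1 = n * (n + 2) by
      rw [show (n + 1) ^ 2 = n * (n + 2) + 1 by ring, Nat.add_sub_cancel]]
  ring

theorem card_sl_eq : Nat.card SL(2, F) =
    Nat.card PSL(2, F) * Nat.card (Subgroup.center SL(2, F)) :=
  Subgroup.card_eq_card_quotient_mul_card_subgroup _

theorem eq_one_or_of_mem_center {g : SL(2, F)} (hg : g ∈ Subgroup.center SL(2, F)) :
    g = 1 ∨ g = -1 := by
  obtain ⟨r, hr, h⟩ := Matrix.SpecialLinearGroup.mem_center_iff.1 hg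
  rw [Fintype.card_fin, sq_eq_one_iff] at hr
  rcases hr with rfl | rfl
  · left
    ext i j
    rw [← h]
    simp
  · right
    ext i j
    rw [← h]
    rw [Matrix.SpecialLinearGroup.coe_neg]
    simp [Matrix.diagonal_apply, Matrix.one_apply, apply_ite]

theorem le_card_psl_seven : 168 ≤ Nat.card PSL(2, ZMod 7) := by
  have h1 := le_card_sl (F := ZMod 7)
  have h2 : Nat.card (Subgroup.center SL(2, ZMod 7)) ≤ 2 := by
    have : ((Subgroup.center SL(2, ZMod 7) : Subgroup _) : Set SL(2, ZMod 7)) ⊆ {1, -1} :=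
      fun g hg => eq_one_or_of_mem_center hg
    calc Nat.card (Subgroup.center SL(2, ZMod 7))
        = ((Subgroup.center SL(2, ZMod 7) : Subgroup _) : Set SL(2, ZMod 7)).ncard := rfl
      _ ≤ ({1, -1} : Set SL(2, ZMod 7)).ncard := Set.ncard_le_ncard this
      _ ≤ 2 := Set.ncard_insert_le _ _ |>.trans (by simp)
  rw [card_sl_eq, Nat.card_zmod] at h1
  have := h1.trans (Nat.mul_le_mul_left _ h2)
  omega

theorem le_card_psl_eight (hF : Nat.card F = 8) (h2 : (2 : F) = 0) :
    504 ≤ Nat.card PSL(2, F) := by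
  have hfin : Finite F := Nat.finite_of_card_ne_zero (by omega)
  have h1 := le_card_sl (F := F)
  have hn : (-1 : SL(2, F)) = 1 := by
    ext i j
    have : (-1 : F) = 1 := by linear_combination -h2
    fin_cases i <;> fin_cases j <;> simp [this]
  have h3 : Nat.card (Subgroup.center SL(2, F)) = 1 := by
    rw [Subgroup.card_eq_one, eq_bot_iff]
    intro g hg
    rw [Subgroup.mem_bot]
    rcases eq_one_or_of_mem_center hg with h | h
    · exact h
    · rw [h, hn]
  rw [card_sl_eq, hF, h3] at h1
  omega

end PSL2

end

section

/-! ### Quotients of the triangle group in which the mirror word has small order -/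

namespace CosetEnumeration

/-- The relators of the triangle group, and the `k`-th power of a conjugate of the mirror word. -/
def relators (k : ℕ) : List (List Letter) :=
  [[.a, .a], [.b, .b, .b], (List.replicate 7 [.b, .a]).flatten, (List.replicate k
    [.a, .b, .a, .b, .a, .b, .a, .b', .a, .b, .a, .b', .a, .b', .a, .b']).flatten]

theorem wordEval_flatten_replicate {G : Type*} [Group G] (x y : G) (u : List Letter) (n : ℕ) :
    wordEval x y (List.replicate n u).flatten = wordEval x y u ^ n := by
  induction n with
  | zero => simp [wordEval]
  | succ n ih => rw [List.replicate_succ, List.flatten_cons, wordEval_append, ih, pow_succ]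

theorem wordEval_relators {G : Type*} [Group G] {x y : G} (h : IsHurwitzPair x y) {k : ℕ}
    (hk : mirrorWord x y ^ k = 1) {w : List Letter} (hw : w ∈ relators k) :
    wordEval x y w = 1 := by
  have hx : x⁻¹ = x := inv_eq_of_mul_eq_one_left (by rw [← sq, h.sq_eq_one])
  simp only [relators, List.mem_cons, List.not_mem_nil, or_false] at hw
  rcases hw with rfl | rfl | rfl | rfl
  · simpa [wordEval, Letter.eval, sq] using h.sq_eq_one
  · simpa [wordEval, Letter.eval, pow_succ] using h.cube_eq_one
  · have : wordEval x y [.b, .a] = (y⁻¹ * x)⁻¹ := by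
      simp [wordEval, Letter.eval, hx]
    rw [wordEval_flatten_replicate, this, inv_pow, h.pow_seven_eq_one, inv_one]
  · have : wordEval x y
        [.a, .b, .a, .b, .a, .b, .a, .b', .a, .b, .a, .b', .a, .b', .a, .b'] =
        x * mirrorWord x y * x⁻¹ := by
      have hxx : x * x = 1 := by rw [← sq, h.sq_eq_one]
      simp only [wordEval, Letter.eval, hx, mirrorWord, pow_succ, pow_zero, mul_inv_rev, mul_assoc,
        one_mul, inv_inv]
      rw [← mul_assoc x x, hxx, one_mul]
    rw [wordEval_flatten_replicate, this, conj_pow, hk, mul_one, mul_inv_cancel]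

theorem index_zpowers_le {G : Type*} [Group G] {x y : G} (h : IsHurwitzPair x y)
    (hG : Subgroup.closure {x, y} = ⊤) {k : ℕ} (hk : mirrorWord x y ^ k = 1)
    (defs : List (Letter × ℕ)) (scans : List (ℕ × ℕ × ℕ)) (V : List ℕ)
    (hV : isClosed (enumerate (relators k) [.b, .a] defs scans) V = true) :
    Finite (G ⧸ Subgroup.zpowers (y⁻¹ * x)) ∧
      Nat.card (G ⧸ Subgroup.zpowers (y⁻¹ * x)) ≤ V.length := by
  refine card_quotient_le h.sq_eq_one hG _ (relators k) [.b, .a] defs scans V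
    (fun w hw => wordEval_relators h hk hw) ?_ hV
  have hx : x⁻¹ = x := inv_eq_of_mul_eq_one_left (by rw [← sq, h.sq_eq_one])
  have : wordEval x y [.b, .a] = (y⁻¹ * x)⁻¹ := by
    simp [wordEval, Letter.eval, hx]
  rw [this]
  exact Subgroup.inv_mem _ (Subgroup.mem_zpowers _)

/-- If `W = 1`, then the enumeration finds no coset of the group generated by `C` but this group. -/
theorem isClosed_one : isClosed (enumerate (relators 1) [.b, .a]
      [(.b, 0), (.b', 0), (.a, 2), (.b, 3), (.b', 3), (.a, 4)]
      [(4, 1, 0), (1, 1, 0), (1, 1, 3), (3, 5, 0), (3, 6, 2), (2, 0, 1)])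
    [0] = true := by
  decide +kernel

/-- If `W ^ 2 = 1`, then the enumeration finds `72` cosets of the group generated by `C`. -/
theorem isClosed_two : isClosed (enumerate (relators 2) [.b, .a]
      [(.b, 0), (.b', 0), (.a, 2), (.b, 3), (.b', 3), (.a, 4), (.a, 5), (.b, 6), (.b', 6), (.b,
      7), (.b', 7), (.a, 8), (.a, 9), (.a, 10), (.a, 11), (.b', 12), (.b, 13), (.b', 13), (.b,
      14), (.b', 14), (.a, 16), (.a, 17), (.a, 18), (.a, 19), (.a, 20), (.b, 21), (.b', 21), (.b,
      22), (.b', 22), (.b, 23), (.b', 23), (.b, 24), (.b', 24), (.b, 25), (.b', 25), (.a, 26),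
      (.a, 27), (.a, 28), (.a, 29), (.a, 30), (.a, 33), (.a, 34), (.a, 35), (.b, 36), (.b', 36),
      (.b, 37), (.b', 37), (.b, 38), (.b', 38), (.b, 39), (.b', 39), (.b, 40), (.b', 40), (.b,
      41), (.b', 41), (.b, 42), (.b', 42), (.b, 43), (.b', 43), (.a, 50), (.a, 51), (.a, 52), (.a,
      55), (.a, 56), (.a, 57), (.b', 60), (.b', 61), (.b, 62), (.a, 66), (.b, 69), (.b', 69)]
      [(4, 1, 0), (1, 1, 0), (1, 1, 3), (1, 1, 6), (1, 1, 7), (2, 6, 1), (1, 1, 12), (1, 1, 13),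
      (1, 1, 14), (1, 1, 21), (1, 1, 22), (1, 1, 23), (2, 7, 4), (1, 1, 24), (1, 1, 25), (1, 1,
      36), (1, 1, 37), (2, 7, 8), (1, 1, 38), (1, 1, 39), (1, 1, 40), (3, 12, 0), (2, 3, 26), (1,
      1, 41), (1, 1, 42), (1, 1, 43), (2, 7, 10), (3, 18, 4), (2, 4, 44), (3, 25, 19), (2, 4, 28),
      (1, 1, 60), (1, 1, 61), (1, 1, 62), (2, 7, 17), (1, 1, 69), (2, 9, 50)])
    (List.range 72) = true := by
  decide +kernel

/-- If `W ^ 3 = 1`, then the enumeration finds `24` cosets of the group generated by `C`, after many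
coincidences. -/
theorem isClosed_three : isClosed (enumerate (relators 3) [.b, .a]
      [(.b, 0), (.b', 0), (.a, 2), (.b, 3), (.b', 3), (.a, 4), (.a, 5), (.b, 6), (.b', 6), (.b,
      7), (.b', 7), (.a, 8), (.a, 9), (.a, 10), (.a, 11), (.b', 12), (.b, 13), (.b', 13), (.b,
      14), (.b', 14), (.a, 16), (.a, 17), (.a, 18), (.a, 19), (.a, 20), (.b, 21), (.b', 21), (.b,
      22), (.b', 22), (.b, 23), (.b', 23), (.b, 24), (.b', 24), (.b, 25), (.b', 25), (.a, 26),
      (.a, 27), (.a, 28), (.a, 29), (.a, 30), (.a, 33), (.a, 34), (.a, 35), (.b, 36), (.b', 36),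
      (.b, 37), (.b', 38), (.b, 39), (.b', 39), (.b, 40), (.b', 40), (.b, 41), (.b', 41), (.b,
      42), (.b, 43), (.b', 43), (.a, 45), (.a, 46), (.a, 47), (.a, 48), (.a, 49), (.a, 50), (.a,
      51), (.a, 52), (.a, 53), (.a, 54), (.a, 55), (.b', 57), (.b, 58), (.b, 59), (.b', 59), (.b,
      60), (.b', 60), (.b, 61), (.b', 61), (.b, 62), (.b', 62), (.b, 63), (.b', 63), (.b, 64),
      (.b, 65), (.b', 65), (.b, 66), (.b', 66), (.b, 67), (.b', 67), (.a, 68), (.a, 69), (.a, 70),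
      (.a, 71), (.a, 72), (.a, 73), (.a, 74), (.a, 77), (.a, 78), (.a, 79), (.a, 80), (.a, 81),
      (.a, 84), (.a, 85), (.a, 86), (.b, 87), (.b', 87), (.b, 88), (.b', 88), (.b', 89), (.b, 90),
      (.b', 90), (.b, 91), (.b', 91), (.b, 92), (.b', 93), (.b, 94), (.b', 94), (.b, 95), (.b',
      95), (.b, 96), (.b', 98), (.b, 99), (.b', 100), (.b, 101), (.a, 102), (.a, 105), (.a, 106),
      (.a, 107), (.a, 110), (.a, 111), (.a, 112), (.a, 113), (.a, 114), (.a, 115), (.a, 116), (.a,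
      117), (.a, 118), (.a, 119), (.a, 120), (.a, 121), (.b', 122), (.b, 123), (.b', 124), (.b,
      125), (.b', 125), (.b, 126), (.b', 126), (.b, 127), (.b, 128), (.b', 128), (.b, 129), (.b,
      130), (.b', 130), (.b, 131), (.b', 132), (.b, 133), (.b', 133), (.b', 134), (.b, 135), (.b',
      135), (.b', 136), (.b, 137), (.a, 138), (.a, 139), (.a, 140), (.a, 141), (.a, 142), (.a,
      143), (.a, 144), (.a, 145), (.a, 146), (.a, 147), (.a, 148), (.a, 149), (.a, 152), (.a,
      153), (.a, 154), (.a, 155), (.a, 156), (.a, 157), (.a, 158), (.b', 161), (.b, 162), (.b',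
      162), (.b, 163), (.b', 164), (.b, 165), (.b, 166), (.b', 166), (.b, 167), (.b', 168), (.b,
      169), (.b', 171), (.b', 172), (.b, 175), (.b, 177), (.a, 183), (.a, 184)]
      [(4, 1, 0), (1, 1, 0), (1, 1, 3), (1, 1, 6), (1, 1, 7), (2, 6, 1), (1, 1, 12), (1, 1, 13),
      (1, 1, 14), (1, 1, 21), (1, 1, 22), (1, 1, 23), (2, 7, 4), (1, 1, 24), (1, 1, 36), (1, 1,
      39), (1, 1, 40), (1, 1, 43), (2, 7, 10), (1, 1, 59), (1, 1, 60), (1, 1, 61), (2, 7, 17), (1,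
      1, 62), (1, 1, 63), (1, 1, 65), (2, 7, 19), (1, 1, 66), (1, 1, 67), (2, 8, 30), (1, 1, 87),
      (2, 7, 26), (1, 1, 88), (1, 1, 90), (2, 7, 28), (1, 1, 91), (1, 1, 95), (1, 1, 96), (1, 1,
      125), (1, 1, 126), (1, 1, 128), (1, 1, 130), (2, 7, 50), (1, 1, 133), (1, 1, 135), (2, 8,
      74), (3, 21, 0), (2, 10, 102), (2, 8, 81), (1, 1, 161), (1, 1, 162), (2, 7, 70), (3, 31, 8),
      (2, 5, 85), (1, 1, 166), (2, 7, 72), (1, 1, 169), (2, 7, 78), (1, 1, 175), (3, 24, 2), (2,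
      8, 107), (3, 18, 86), (3, 28, 51), (2, 0, 146), (0, 1, 27), (3, 47, 178)])
    [0, 1, 2, 3, 4, 5, 6, 7, 8, 9, 10, 11, 12, 13, 14, 15, 16, 18, 21, 23, 26, 27, 30, 31] = true := by
  decide +kernel

end CosetEnumeration

section Bounds

variable {G : Type*} [Group G] {x y : G}

theorem IsHurwitzPair.card_le (h : IsHurwitzPair x y) {n : ℕ}
    (hn : Finite (G ⧸ Subgroup.zpowers (y⁻¹ * x)) ∧
      Nat.card (G ⧸ Subgroup.zpowers (y⁻¹ * x)) ≤ n) : Finite G ∧ Nat.card G ≤ n * 7 := by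
  have h7 : Nat.card (Subgroup.zpowers (y⁻¹ * x)) ≤ 7 := by
    rw [Nat.card_zpowers]
    exact orderOf_le_of_pow_eq_one (by norm_num) h.pow_seven_eq_one
  have hc := Subgroup.card_eq_card_quotient_mul_card_subgroup (Subgroup.zpowers (y⁻¹ * x))
  have hle : Nat.card G ≤ n * 7 := hc ▸ Nat.mul_le_mul hn.2 h7
  refine ⟨Nat.finite_of_card_ne_zero ?_, hle⟩
  have := hn.1
  have hf : IsOfFinOrder (y⁻¹ * x) :=
    isOfFinOrder_iff_pow_eq_one.2 ⟨7, by norm_num, h.pow_seven_eq_one⟩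
  rw [hc, Nat.card_zpowers]
  exact mul_ne_zero Nat.card_pos.ne' hf.orderOf_pos.ne'

theorem IsHurwitzPair.mirrorWord_ne_one [Nontrivial G] (h : IsHurwitzPair x y)
    (hG : Subgroup.closure {x, y} = ⊤) : mirrorWord x y ≠ 1 := by
  intro hw
  have hV := CosetEnumeration.index_zpowers_le h hG (k := 1) (by rw [hw, one_pow]) _ _ _
    CosetEnumeration.isClosed_one
  have := hV.1
  have hsub : Nat.card (G ⧸ Subgroup.zpowers (y⁻¹ * x)) = 1 :=
    le_antisymm hV.2 Nat.card_pos
  have htop : Subgroup.zpowers (y⁻¹ * x) = ⊤ := Subgroup.index_eq_one.1 hsub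
  obtain ⟨n, hn⟩ := Subgroup.mem_zpowers_iff.1 (htop ▸ Subgroup.mem_top x)
  have h7 : x ^ 7 = 1 := by
    rw [← hn, ← zpow_natCast, ← zpow_mul, mul_comm, zpow_mul, zpow_natCast, h.pow_seven_eq_one,
      one_zpow]
  refine (h.ne_one hG).1 ?_
  calc x = x ^ 7 * ((x ^ 2) ^ 3)⁻¹ := by group
    _ = 1 := by rw [h7, h.sq_eq_one]; simp

theorem IsHurwitzPair.card_le_of_sq (h : IsHurwitzPair x y)
    (hG : Subgroup.closure {x, y} = ⊤) (hw : mirrorWord x y ^ 2 = 1) :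
    Finite G ∧ Nat.card G ≤ 504 :=
  h.card_le (CosetEnumeration.index_zpowers_le h hG hw _ _ _ CosetEnumeration.isClosed_two)

theorem IsHurwitzPair.card_le_of_cube (h : IsHurwitzPair x y)
    (hG : Subgroup.closure {x, y} = ⊤) (hw : mirrorWord x y ^ 3 = 1) :
    Finite G ∧ Nat.card G ≤ 168 :=
  h.card_le (CosetEnumeration.index_zpowers_le h hG hw _ _ _ CosetEnumeration.isClosed_three)

theorem closure_pair_eq_top_of_surjective {H : Type*} [Group H]
    (hG : Subgroup.closure {x, y} = ⊤) {f : G →* H} (hf : Function.Surjective f) :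
    Subgroup.closure {f x, f y} = ⊤ := by
  rw [← Set.image_pair, ← MonoidHom.map_closure, hG, Subgroup.map_top_of_surjective f hf]

/-- If `n` is a bound for the order of the groups generated by a Hurwitz pair with `W ^ k = 1`, and
a simple group `T` of order at least `n` is one of them, then it is the only nontrivial one: the
subdirect product of `T` with another one is no larger than `T`. -/
theorem nonempty_mulEquiv_of_card_le {G T : Type} [Group G] [Group T] [Nontrivial G]
    [IsSimpleGroup T] {k n : ℕ} {x y : G} {x' y' : T} (h : IsHurwitzPair x y)
    (hG : Subgroup.closure {x, y} = ⊤) (hw : mirrorWord x y ^ k = 1) (h' : IsHurwitzPair x' y')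
    (hT : Subgroup.closure {x', y'} = ⊤) (hw' : mirrorWord x' y' ^ k = 1) (hn : n ≤ Nat.card T)
    (hbound : ∀ {D : Type} [Group D] {u v : D}, IsHurwitzPair u v →
      Subgroup.closure {u, v} = ⊤ → mirrorWord u v ^ k = 1 → Finite D ∧ Nat.card D ≤ n) :
    Nonempty (G ≃* T) := by
  let D : Subgroup (G × T) := Subgroup.closure {(x, x'), (y, y')}
  let u : D := ⟨(x, x'), Subgroup.subset_closure (by simp)⟩
  let v : D := ⟨(y, y'), Subgroup.subset_closure (by simp)⟩
  let p : D →* G := (MonoidHom.fst G T).comp D.subtype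
  let q : D →* T := (MonoidHom.snd G T).comp D.subtype
  have hD : Subgroup.closure {u, v} = ⊤ := by
    have := Subgroup.closure_closure_coe_preimage (k := {(x, x'), (y, y')})
    rw [← this]
    congr 1
    ext ⟨d, hd⟩
    simp only [u, v, Set.mem_insert_iff, Set.mem_singleton_iff, Set.mem_preimage, Subtype.mk.injEq]
  have inj : ∀ d : D, p d = 1 → q d = 1 → d = 1 := fun d h1 h2 => Subtype.ext (Prod.ext h1 h2)
  have hu : IsHurwitzPair u v :=
    ⟨inj _ h.sq_eq_one h'.sq_eq_one, inj _ h.cube_eq_one h'.cube_eq_one,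
      inj _ h.pow_seven_eq_one h'.pow_seven_eq_one⟩
  have huw : mirrorWord u v ^ k = 1 := by
    apply inj
    · rw [map_pow, map_mirrorWord]; exact hw
    · rw [map_pow, map_mirrorWord]; exact hw'
  have hp : Function.Surjective p := by
    rw [← MonoidHom.range_eq_top, eq_top_iff, ← hG, Subgroup.closure_le]
    rintro g (rfl | rfl)
    exacts [⟨u, rfl⟩, ⟨v, rfl⟩]
  have hq : Function.Surjective q := by
    rw [← MonoidHom.range_eq_top, eq_top_iff, ← hT, Subgroup.closure_le]
    rintro g (rfl | rfl)
    exacts [⟨u, rfl⟩, ⟨v, rfl⟩]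
  obtain ⟨hfin, hcard⟩ := hbound hu hD huw
  have hqb : Function.Bijective q :=
    hq.bijective_of_nat_card_le (hcard.trans hn)
  let e : D ≃* T := MulEquiv.ofBijective q hqb
  have hsimple : IsSimpleGroup D := e.isSimpleGroup
  have hker : p.ker = ⊥ := by
    refine (hsimple.eq_bot_or_eq_top_of_normal p.ker inferInstance).resolve_right fun htop => ?_
    obtain ⟨g, hg⟩ := exists_ne (1 : G)
    obtain ⟨d, rfl⟩ := hp g
    exact hg (by rw [← MonoidHom.mem_ker, htop]; exact Subgroup.mem_top d)
  exact ⟨(MulEquiv.ofBijective p ⟨(MonoidHom.ker_eq_bot_iff p).1 hker, hp⟩).symm.trans e⟩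

end Bounds

section Characterizations

open scoped MatrixGroups

theorem two_eq_zero_galoisField : (2 : GaloisField 2 3) = 0 := by
  exact_mod_cast CharP.cast_eq_zero (GaloisField 2 3) 2

theorem card_galoisField_eight : Nat.card (GaloisField 2 3) = 8 := by
  rw [GaloisField.card 2 3 (by norm_num)]
  norm_num

instance isSimpleGroup_psl_eight : IsSimpleGroup PSL(2, GaloisField 2 3) :=
  Matrix.ProjectiveSpecialLinearGroup.rank_two_simple (by rw [card_galoisField_eight]; norm_num)

instance isSimpleGroup_psl_seven : IsSimpleGroup PSL(2, ZMod 7) :=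
  Matrix.ProjectiveSpecialLinearGroup.rank_two_simple (by rw [Nat.card_zmod]; norm_num)

theorem le_card_psl_galoisField : 504 ≤ Nat.card PSL(2, GaloisField 2 3) :=
  le_card_psl_eight card_galoisField_eight two_eq_zero_galoisField

variable {G : Type} [Group G] {x y : G}

theorem IsHurwitzPair.nonempty_mulEquiv_of_sq [Nontrivial G] (h : IsHurwitzPair x y)
    (hG : Subgroup.closure {x, y} = ⊤) (hw : mirrorWord x y ^ 2 = 1) :
    Nonempty (G ≃* PSL(2, GaloisField 2 3)) := by
  obtain ⟨x', y', h', hT, hw'⟩ :=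
    exists_hurwitzPair_eight card_galoisField_eight two_eq_zero_galoisField
  exact nonempty_mulEquiv_of_card_le h hG hw h' hT hw' le_card_psl_galoisField
    fun hu hD huw => hu.card_le_of_sq hD huw

theorem IsHurwitzPair.nonempty_mulEquiv_of_cube [Nontrivial G] (h : IsHurwitzPair x y)
    (hG : Subgroup.closure {x, y} = ⊤) (hw : mirrorWord x y ^ 3 = 1) :
    Nonempty (G ≃* PSL(2, ZMod 7)) := by
  obtain ⟨x', y', h', hT, hw'⟩ := exists_hurwitzPair_seven
  exact nonempty_mulEquiv_of_card_le h hG hw h' hT hw' le_card_psl_seven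
    fun hu hD huw => hu.card_le_of_cube hD huw

theorem IsHurwitzPair.mirrorWord_sq_of_mulEquiv (h : IsHurwitzPair x y)
    (hG : Subgroup.closure {x, y} = ⊤) (e : G ≃* PSL(2, GaloisField 2 3)) :
    mirrorWord x y ^ 2 = 1 := by
  have h' := h.map e.toMonoidHom
  have hG' := closure_pair_eq_top_of_surjective hG (f := e.toMonoidHom) e.surjective
  apply e.injective
  rw [map_one, map_pow]
  change e.toMonoidHom (mirrorWord x y) ^ 2 = 1
  rw [map_mirrorWord]
  obtain ⟨a, ha⟩ := QuotientGroup.mk_surjective (e.toMonoidHom x)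
  obtain ⟨b, hb⟩ := QuotientGroup.mk_surjective (e.toMonoidHom y)
  rw [← ha, ← hb] at h' hG' ⊢
  obtain ⟨h1, h2, h3⟩ := h'.slTrace_eq hG'
  exact mirrorWord_sq_of_charTwo two_eq_zero_galoisField h1 h2 h3

theorem IsHurwitzPair.mirrorWord_cube_of_mulEquiv (h : IsHurwitzPair x y)
    (hG : Subgroup.closure {x, y} = ⊤) (e : G ≃* PSL(2, ZMod 7)) :
    mirrorWord x y ^ 3 = 1 := by
  have h' := h.map e.toMonoidHom
  have hG' := closure_pair_eq_top_of_surjective hG (f := e.toMonoidHom) e.surjective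
  apply e.injective
  rw [map_one, map_pow]
  change e.toMonoidHom (mirrorWord x y) ^ 3 = 1
  rw [map_mirrorWord]
  obtain ⟨a, ha⟩ := QuotientGroup.mk_surjective (e.toMonoidHom x)
  obtain ⟨b, hb⟩ := QuotientGroup.mk_surjective (e.toMonoidHom y)
  rw [← ha, ← hb] at h' hG' ⊢
  obtain ⟨h1, h2, h3⟩ := h'.slTrace_eq hG'
  exact mirrorWord_cube_of_charSeven (by decide) h1 h2 h3

end Characterizations

end

section

/-! ### The order of the translation and the automorphism group of a Hurwitz map -/

/-- The generator `A` of the triangle group. -/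
def genA : TriangleGroup := ⟨rotA, rotA_mem⟩

/-- The generator `B` of the triangle group. -/
def genB : TriangleGroup := ⟨rotB, rotB_mem⟩

theorem rotB_inv_mul_rotA : rotB⁻¹ * rotA = rotC := by
  rw [← rotA_inv, ← mul_inv_rev, inv_eq_iff_mul_eq_one, rotA_mul_rotB_mul_rotC]

theorem isHurwitzPair_gen : IsHurwitzPair genA genB where
  sq_eq_one := Subtype.ext (by rw [sq]; exact rotA_sq)
  cube_eq_one := Subtype.ext rotB_cube
  pow_seven_eq_one := Subtype.ext (by
    change (rotB⁻¹ * rotA) ^ 7 = 1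
    rw [rotB_inv_mul_rotA, rotC_pow_seven])

theorem mirrorWord_gen : mirrorWord genA genB = ⟨axisTranslation, axisTranslation_mem⟩ := by
  refine Subtype.ext ?_
  change rotA * (((rotB⁻¹ * rotA) ^ 3 * rotB) * rotA * ((rotB⁻¹ * rotA) ^ 3 * rotB)⁻¹) = _
  rw [rotB_inv_mul_rotA]
  rfl

theorem closure_gen : Subgroup.closure {genA, genB} = ⊤ := by
  refine (Subgroup.map_injective TriangleGroup.subtype_injective) ?_
  rw [MonoidHom.map_closure, Set.image_pair, ← MonoidHom.range_eq_map, Subgroup.range_subtype]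
  apply le_antisymm
  · rw [Subgroup.closure_le]
    rintro g (rfl | rfl)
    exacts [rotA_mem, rotB_mem]
  · change Subgroup.closure {rotA, rotB, rotC} ≤ Subgroup.closure {rotA, rotB}
    rw [Subgroup.closure_le]
    have hA : rotA ∈ Subgroup.closure {rotA, rotB} := Subgroup.subset_closure (by simp)
    have hB : rotB ∈ Subgroup.closure {rotA, rotB} := Subgroup.subset_closure (by simp)
    rintro g (rfl | rfl | rfl)
    · exact hA
    · exact hB
    · rw [← rotB_inv_mul_rotA]
      exact mul_mem (inv_mem hB) hA

section Quotient

variable (N : Subgroup TriangleGroup) [N.Normal]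

theorem isHurwitzPair_mk_gen :
    IsHurwitzPair (genA : TriangleGroup ⧸ N) (genB : TriangleGroup ⧸ N) :=
  isHurwitzPair_gen.map (QuotientGroup.mk' N)

theorem closure_mk_gen :
    Subgroup.closure {(genA : TriangleGroup ⧸ N), (genB : TriangleGroup ⧸ N)} = ⊤ :=
  closure_pair_eq_top_of_surjective closure_gen (f := QuotientGroup.mk' N)
    (QuotientGroup.mk'_surjective N)

theorem mirrorWord_mk_gen :
    mirrorWord (genA : TriangleGroup ⧸ N) (genB : TriangleGroup ⧸ N) =
      (⟨axisTranslation, axisTranslation_mem⟩ : TriangleGroup) := by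
  rw [← mirrorWord_gen]
  exact (map_mirrorWord genA genB (QuotientGroup.mk' N)).symm

end Quotient

namespace HurwitzMap

variable {X : Type*} [TopologicalSpace X] [ChartedSpace ℂ X] (h : HurwitzMap X)

theorem mk_ne_one_of_fixed {r : TriangleGroup} {z : ℍ} (hz : (r : Equiv.Perm ℍ) z = z)
    (hr : (r : Equiv.Perm ℍ) ≠ 1) : (r : TriangleGroup ⧸ h.mapSubgroup) ≠ 1 := by
  rw [Ne, QuotientGroup.eq_one_iff, ← h.coe_mem_deckGroup]
  exact fun hm => hr (h.eq_one_of_mem_of_fixed hm hz)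

instance nontrivial_quotient : Nontrivial (TriangleGroup ⧸ h.mapSubgroup) :=
  ⟨⟨_, _, h.mk_ne_one_of_fixed (r := genA) rotA_edgeCentre rotA_ne_one⟩⟩

theorem mirrorWord_pow_eq_one_iff (k : ℕ) :
    mirrorWord (genA : TriangleGroup ⧸ h.mapSubgroup) (genB : TriangleGroup ⧸ h.mapSubgroup) ^ k = 1
      ↔ h.translationOrder ∣ k := by
  rw [mirrorWord_mk_gen, translationOrder, orderOf_dvd_iff_pow_eq_one]

theorem translationOrder_ne_one : h.translationOrder ≠ 1 := by
  intro h1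
  have := (h.mirrorWord_pow_eq_one_iff 1).2 (by rw [h1])
  rw [pow_one] at this
  exact (isHurwitzPair_mk_gen h.mapSubgroup).mirrorWord_ne_one (closure_mk_gen _) this

/-- If `Γ / M` is of the greatest order that is possible for a group in which `W ^ k = 1`, then `M`
is invariant under the reflection `P`: as `P` commutes with `W`, the group `Γ / (M ⊓ P M P)` is
subject to the same bound. -/
theorem P_mem_isoNormalizer {k n : ℕ} (hk : h.translationOrder ∣ k)
    (hn : n ≤ Nat.card (TriangleGroup ⧸ h.mapSubgroup))
    (hbound : ∀ {D : Type} [Group D] {u v : D}, IsHurwitzPair u v →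
      Subgroup.closure {u, v} = ⊤ → mirrorWord u v ^ k = 1 → Finite D ∧ Nat.card D ≤ n) :
    P ∈ isoNormalizer h.deckGroup := by
  have hconj : ∀ g : TriangleGroup, P * g * P⁻¹ ∈ TriangleGroup := fun g =>
    conj_mem_triangleGroup P_mem g.2
  let φ : TriangleGroup →* TriangleGroup :=
    ((MulAut.conj P).toMonoidHom.comp TriangleGroup.subtype).codRestrict TriangleGroup hconj
  have hφ : ∀ g, ((φ g : TriangleGroup) : Equiv.Perm ℍ) = P * g * P⁻¹ := fun _ => rfl
  let M := h.mapSubgroup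
  have hmem : ∀ g, g ∈ M.comap φ ↔ φ g ∈ M := fun _ => Iff.rfl
  let W : TriangleGroup := ⟨axisTranslation, axisTranslation_mem⟩
  have hWM : W ^ k ∈ M := by
    have := (h.mirrorWord_pow_eq_one_iff k).2 hk
    rwa [mirrorWord_mk_gen, ← QuotientGroup.mk_pow, QuotientGroup.eq_one_iff] at this
  have hφW : φ W = W := Subtype.ext (by
    rw [hφ, mul_inv_eq_iff_eq_mul]
    exact P_mul_axisTranslation)
  have hb := hbound (isHurwitzPair_mk_gen (M ⊓ M.comap φ)) (closure_mk_gen _) (by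
    rw [mirrorWord_mk_gen, ← QuotientGroup.mk_pow, QuotientGroup.eq_one_iff]
    refine ⟨hWM, ?_⟩
    change φ (W ^ k) ∈ M
    rw [map_pow, hφW]
    exact hWM)
  have hle : M ≤ M.comap φ := by
    suffices (M ⊓ M.comap φ).relIndex M = 1 from
      (Subgroup.relIndex_eq_one.1 this).trans inf_le_right
    have h1 := Subgroup.relIndex_mul_index (inf_le_left : M ⊓ M.comap φ ≤ M)
    have h2 : (M ⊓ M.comap φ).index ≤ n := hb.2
    have h3 : n ≤ M.index := hn
    have h4 : (M ⊓ M.comap φ).index ≠ 0 := by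
      have := hb.1
      exact Nat.card_pos.ne'
    have h5 : (M ⊓ M.comap φ).relIndex M ≠ 0 := fun h0 => h4 (by rw [← h1, h0, zero_mul])
    by_contra hne
    have h6 : 2 ≤ (M ⊓ M.comap φ).relIndex M := by omega
    have := Nat.mul_le_mul_right M.index h6
    omega
  have hP : ∀ m ∈ h.deckGroup, P * m * P⁻¹ ∈ h.deckGroup := by
    intro m hm
    obtain ⟨hm1, hm2⟩ := h.mem_deckGroup.1 hm
    have := hle hm2
    rw [hmem, ← h.coe_mem_deckGroup, hφ] at this
    exact this
  refine ⟨isometry_of_mem_extGroup P_mem, fun m => ⟨hP m, fun hm => ?_⟩⟩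
  have := hP _ hm
  rw [P_inv] at this
  simpa [mul_assoc, P_mul_P_mul, P_mul_P] using this

section Compact

variable [CompactSpace X]

theorem card_quotient_of_isMacbeathSurface (hX : IsMacbeathSurface X) :
    h.translationOrder = 2 ∧ Nat.card (TriangleGroup ⧸ h.mapSubgroup) = 504 := by
  obtain ⟨h', ⟨e'⟩⟩ := hX
  obtain ⟨e⟩ := h.nonempty_quotient_mulEquiv h'
  have hH := isHurwitzPair_mk_gen h.mapSubgroup
  have hw := hH.mirrorWord_sq_of_mulEquiv (closure_mk_gen _) (e.trans e')
  have h2 := (h.mirrorWord_pow_eq_one_iff 2).1 hw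
  refine ⟨((Nat.dvd_prime Nat.prime_two).1 h2).resolve_left h.translationOrder_ne_one, ?_⟩
  refine le_antisymm (hH.card_le_of_sq (closure_mk_gen _) hw).2 ?_
  rw [Nat.card_congr (e.trans e').toEquiv]
  exact le_card_psl_galoisField

theorem card_quotient_of_isKleinSurface (hX : IsKleinSurface X) :
    h.translationOrder = 3 ∧ Nat.card (TriangleGroup ⧸ h.mapSubgroup) = 168 := by
  obtain ⟨h', ⟨e'⟩⟩ := hX
  obtain ⟨e⟩ := h.nonempty_quotient_mulEquiv h'
  have hH := isHurwitzPair_mk_gen h.mapSubgroup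
  have hw := hH.mirrorWord_cube_of_mulEquiv (closure_mk_gen _) (e.trans e')
  have h3 := (h.mirrorWord_pow_eq_one_iff 3).1 hw
  refine ⟨((Nat.dvd_prime Nat.prime_three).1 h3).resolve_left h.translationOrder_ne_one, ?_⟩
  refine le_antisymm (hH.card_le_of_cube (closure_mk_gen _) hw).2 ?_
  rw [Nat.card_congr (e.trans e').toEquiv]
  exact le_card_psl_seven

theorem hasLinkIndex_two_iff [T2Space X] [IsManifold 𝓘(ℂ) ω X] :
    h.HasLinkIndex 2 ↔ IsMacbeathSurface X := by
  rw [h.hasLinkIndex_iff]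
  constructor
  · rintro ⟨-, h2⟩
    exact ⟨h, (isHurwitzPair_mk_gen _).nonempty_mulEquiv_of_sq (closure_mk_gen _)
      ((h.mirrorWord_pow_eq_one_iff 2).2 (by rw [← h2]))⟩
  · intro hX
    obtain ⟨h2, hc⟩ := h.card_quotient_of_isMacbeathSurface hX
    exact ⟨h.P_mem_isoNormalizer (k := 2) (by rw [h2]) hc.ge
      fun hu hD hw => hu.card_le_of_sq hD hw, h2.symm⟩

theorem hasLinkIndex_three_iff [T2Space X] [IsManifold 𝓘(ℂ) ω X] :
    h.HasLinkIndex 3 ↔ IsKleinSurface X := by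
  rw [h.hasLinkIndex_iff]
  constructor
  · rintro ⟨-, h3⟩
    exact ⟨h, (isHurwitzPair_mk_gen _).nonempty_mulEquiv_of_cube (closure_mk_gen _)
      ((h.mirrorWord_pow_eq_one_iff 3).2 (by rw [← h3]))⟩
  · intro hX
    obtain ⟨h3, hc⟩ := h.card_quotient_of_isKleinSurface hX
    exact ⟨h.P_mem_isoNormalizer (k := 3) (by rw [h3]) hc.ge
      fun hu hD hw => hu.card_le_of_cube hD hw, h3.symm⟩

end Compact

/-! ### The number of vertices, edges and faces -/

/-- The images on `ℍ / M` of the points of an orbit of `Γ` with stabilizers of prime order `n`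
correspond to the cosets of a subgroup of order `n` of `Γ / M`. -/
theorem ncard_image_orbit_mul {p : ℍ} {r : TriangleGroup} {n : ℕ} (hn : n.Prime)
    (hp : (r : Equiv.Perm ℍ) p = p) (hr : (r : Equiv.Perm ℍ) ≠ 1) (hrn : r ^ n = 1)
    (hstab : ∀ g ∈ TriangleGroup, g p = p → g ∈ Subgroup.zpowers (r : Equiv.Perm ℍ)) :
    (h.proj '' {z | ∃ g ∈ TriangleGroup, g z = p}).ncard * n =
      Nat.card (TriangleGroup ⧸ h.mapSubgroup) := by
  let π := QuotientGroup.mk' h.mapSubgroup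
  let S := Subgroup.zpowers (π r)
  let K := S.comap π
  have hS : Nat.card S = n := by
    rw [Nat.card_zpowers]
    exact orderOf_eq_prime (hp := ⟨hn⟩) (by rw [← map_pow, hrn, map_one])
      (h.mk_ne_one_of_fixed hp hr)
  have hrj : ∀ j : ℤ, ((r ^ j : TriangleGroup) : Equiv.Perm ℍ) p = p := by
    intro j
    have h1 : r ∈ (MulAction.stabilizer (Equiv.Perm ℍ) p).comap TriangleGroup.subtype := hp
    exact Subgroup.zpow_mem _ h1 j
  let f : TriangleGroup → X := fun g => h.proj ((g : Equiv.Perm ℍ) p)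
  have hf : ∀ g g', f g = f g' ↔ g⁻¹ * g' ∈ K := by
    intro g g'
    change h.proj _ = h.proj _ ↔ π (g⁻¹ * g') ∈ S
    rw [h.proj_eq_iff, Subgroup.mem_zpowers_iff]
    constructor
    · rintro ⟨m, hm, hmg⟩
      have h1 : ((g'⁻¹ * m * g : TriangleGroup) : Equiv.Perm ℍ) p = p := by
        change (g' : Equiv.Perm ℍ)⁻¹ ((m : Equiv.Perm ℍ) ((g : Equiv.Perm ℍ) p)) = p
        rw [hmg, perm_inv_apply]
      obtain ⟨j, hj⟩ := Subgroup.mem_zpowers_iff.1 (hstab _ (Subtype.prop _) h1)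
      have hj' : r ^ j = g'⁻¹ * m * g := Subtype.ext hj
      have hm1 : π m = 1 := (QuotientGroup.eq_one_iff m).2 hm
      refine ⟨-j, ?_⟩
      rw [zpow_neg, ← map_zpow, hj', map_mul, map_mul, hm1, mul_one, ← map_mul, ← map_inv,
        mul_inv_rev, inv_inv]
    · rintro ⟨j, hj⟩
      have hm : g⁻¹ * g' * r ^ (-j) ∈ h.mapSubgroup := by
        rw [← QuotientGroup.eq_one_iff]
        change π _ = 1
        rw [map_mul, ← hj, map_zpow, zpow_neg, mul_inv_cancel]
      refine ⟨_, h.normal.conj_mem _ hm g, ?_⟩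
      have : g * (g⁻¹ * g' * r ^ (-j)) * g⁻¹ = g' * r ^ (-j) * g⁻¹ := by group
      rw [this]
      change (g' : Equiv.Perm ℍ) (((r ^ (-j) : TriangleGroup) : Equiv.Perm ℍ)
        ((g : Equiv.Perm ℍ)⁻¹ ((g : Equiv.Perm ℍ) p))) = _
      rw [perm_inv_apply, hrj]
  have hrange : h.proj '' {z | ∃ g ∈ TriangleGroup, g z = p} = Set.range f := by
    ext x
    constructor
    · rintro ⟨z, ⟨g, hg, rfl⟩, rfl⟩
      exact ⟨⟨g, hg⟩⁻¹, congrArg h.proj (perm_inv_apply g z)⟩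
    · rintro ⟨g, rfl⟩
      exact ⟨_, ⟨(g : Equiv.Perm ℍ)⁻¹, inv_mem g.2, perm_inv_apply _ _⟩, rfl⟩
  let F : TriangleGroup ⧸ K → X := Quotient.lift f fun g g' hgg' =>
    (hf g g').2 (QuotientGroup.leftRel_apply.1 hgg')
  have hF : Function.Injective F := by
    rintro ⟨g⟩ ⟨g'⟩ hgg'
    exact QuotientGroup.eq.2 ((hf g g').1 hgg')
  have hFr : Set.range F = Set.range f := by
    ext x
    constructor
    · rintro ⟨⟨g⟩, rfl⟩
      exact ⟨g, rfl⟩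
    · rintro ⟨g, rfl⟩
      exact ⟨QuotientGroup.mk g, rfl⟩
  have hK : (Set.range f).ncard = K.index := by
    rw [← hFr]
    exact Nat.card_range_of_injective hF
  rw [hrange, hK, Subgroup.index_comap_of_surjective S (QuotientGroup.mk'_surjective _)]
  conv_lhs => rw [← hS]
  exact S.index_mul_card

theorem geometricPoint_eq (i : Fin 3) :
    h.geometricPoint i = h.proj '' {z | ∃ g ∈ TriangleGroup, g z = cornerPt i} := by
  simp only [geometricPoint, universalGeometricPoint, mem_corner_iff]

theorem ncard_geometricPoint [CompactSpace X] :
    (h.geometricPoint 0).ncard * 7 = Nat.card (TriangleGroup ⧸ h.mapSubgroup) ∧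
    (h.geometricPoint 1).ncard * 2 = Nat.card (TriangleGroup ⧸ h.mapSubgroup) ∧
    (h.geometricPoint 2).ncard * 3 = Nat.card (TriangleGroup ⧸ h.mapSubgroup) := by
  have hN := h.isDiscreteOver
  rw [geometricPoint_eq, geometricPoint_eq, geometricPoint_eq]
  refine ⟨?_, ?_, ?_⟩
  · refine h.ncard_image_orbit_mul (r := ⟨rotC, rotC_mem⟩) (by norm_num) ?_ rotC_ne_one
      (Subtype.ext rotC_pow_seven) fun g hg => hN.stabilizer_vertex hg
    change R (P vertex) = vertex
    rw [P_vertex, R_vertex]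
  · exact h.ncard_image_orbit_mul (r := ⟨rotA, rotA_mem⟩) (by norm_num) rotA_edgeCentre rotA_ne_one
      (Subtype.ext ((sq rotA).trans rotA_sq)) fun g hg => hN.stabilizer_edgeCentre hg
  · exact h.ncard_image_orbit_mul (r := ⟨rotB, rotB_mem⟩) (by norm_num) rotB_faceCentre rotB_ne_one
      (Subtype.ext rotB_cube) fun g hg => hN.stabilizer_faceCentre hg

/-- The order of `Γ / M` is `84 * (g - 1)`. -/
theorem hasGenus_of_card_eq [CompactSpace X] {g : ℕ}
    (hg : (Nat.card (TriangleGroup ⧸ h.mapSubgroup) : ℤ) = 84 * (g - 1)) : h.HasGenus g := by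
  obtain ⟨h0, h1, h2⟩ := h.ncard_geometricPoint
  unfold HasGenus
  omega

end HurwitzMap

end

end HurwitzMirror

end

theorem mainTheorem1 {X : Type*} [TopologicalSpace X] [T2Space X] [CompactSpace X]
    [ConnectedSpace X] [ChartedSpace ℂ X] [IsManifold 𝓘(ℂ) ω X]
    (h : HurwitzMirror.HurwitzMap X) :
    -- the link index is the same for all mirrors, so that it is an invariant of the map
    (∃ K : ℕ, ∀ L : Set X, HurwitzMirror.IsMirror L →
      ∀ N : ℕ, h.MirrorHasLinkIndex L N ↔ N = K) ∧
    ¬ h.HasLinkIndex 1 ∧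
    ((h.HasLinkIndex 2 ↔ HurwitzMirror.IsMacbeathSurface X) ∧
      (HurwitzMirror.IsMacbeathSurface X → h.HasGenus 7)) ∧
    ((h.HasLinkIndex 3 ↔ HurwitzMirror.IsKleinSurface X) ∧
      (HurwitzMirror.IsKleinSurface X → h.HasGenus 3)) := by
  refine ⟨⟨h.translationOrder, fun L hL N => h.mirrorHasLinkIndex_iff_of_isMirror hL N⟩,
    fun h1 => h.translationOrder_ne_one ((h.hasLinkIndex_iff 1).1 h1).2.symm,
    ⟨h.hasLinkIndex_two_iff, fun hX => h.hasGenus_of_card_eq ?_⟩,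
    ⟨h.hasLinkIndex_three_iff, fun hX => h.hasGenus_of_card_eq ?_⟩⟩
  · rw [(h.card_quotient_of_isMacbeathSurface hX).2]
    norm_num
  · rw [(h.card_quotient_of_isKleinSurface hX).2]
    norm_num
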